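/- Let $m,p\ge 0$, $N=m+p$, and let $\Omega\subset\mathbb R^m\times\mathbb R^p$ be open and convex. Consider, for $u=(v,w)\in\Omega$, the nonconservative system $$v_t+g(v,w)_x=0,\qquad w_t+B(v,w)\,v_x+C(v,w)\,w_x=0,\tag{1}$$ with smooth $g,B,C$ on $\Omega$ with values in $\mathbb R^m$, $\mathbb R^{p\times m}$, $\mathbb R^{p\times p}$; in quasilinear form, $u_t+A(u)u_x=0$. Assume that (1) is endowed with a full set of entropies: there are smooth $U_k,F_k:\Omega\to\mathbb R$, $k=1,\dots,p$, with $U_k$ strictly convex, such that $U_k(u)_t+F_k(u)_x=0$ holds for all smooth solutions $u$ of (1) with values in $\Omega$, and $\det(\nabla_wU_1,\dots,\nabla_wU_p)\ne0$ on $\Omega$. Assume that (1) is strictly hyperbolic in $\Omega$ (the matrix $A(u)$ has real eigenvalues $\lambda_1(u)<\dots<\lambda_N(u)$) and genuinely nonlinear in $\Omega$ ($\nabla\lambda_j(u)\cdot r\neq0$ for every eigenvector $r$ of $A(u)$ for $\lambda_j(u)$, $j=1,\dots,N$). Let $u_*\in\Omega$. For $i=1,\dots,p$ let $\Phi_i=\Phi_i(u_0,\Lambda)$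 be a real-valued $C^1$ function, defined for $u_0\in\Omega$ and $\Lambda$ in $\bigcup_{j=1}^N\mathcal L_j$, where $\mathcal L_j=(\lambda_j(u_*)-\delta,\lambda_j(u_*)+\delta)$ for some $\delta>0$. Assume that there is a constant $K$ such that for all $i$, $j$ and all $u_0\in\Omega$, $$\Phi_i(u_0,\lambda_j(u_0))=0\ \text{ if }\lambda_j(u_0)\in\mathcal L_j,\qquad 0\le\partial_\Lambda\Phi_i(u_0,\Lambda)\le K\,(\Lambda-\lambda_j(u_0))^2\quad\text{for }\Lambda\in\mathcal L_j .$$ An *admissible shock* with left state $u_0=(v_0,w_0)$, right state $u_1=(v_1,w_1)$ and speed $\Lambda$ is one that satisfies the jump relations $-\Lambda(v_1-v_0)+g(u_1)-g(u_0)=0$, the kinetic relations $$-\Lambda\,(U_i(u_1)-U_i(u_0))+F_i(u_1)-F_i(u_0)=\Phi_i(u_0,\Lambda)\le0,\qquad i=1,\dots,p,$$ and, for some $j$, the Lax inequalities $\lambda_j(u_0)>\Lambda>\lambda_j(u_1)$. For $V\subset\Omega$, an *admissible solution in $V$* of the Riemann problem with data $u_l,u_r$ is a function $u=u(x,t)\in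 V$, $t>0$, with $u(x,t)\to u_l$ (if $x<0$) and $u(x,t)\to u_r$ (if $x>0$) as $t\to0+$, for which there are finitely many rays $x=st$, $t>0$, such that: in each open sector between consecutive rays (and in the two outer sectors) $u$ is a classical $C^1$ solution of (1) and is either constant or a centered rarefaction wave, i.e. $u(x,t)=R(x/t)$ where, for some $j$, $\lambda_j(R(\xi))=\xi$ and $R'(\xi)$ is an eigenvector of $A(R(\xi))$ for $\lambda_j(R(\xi))$; and along each ray $x=st$ the one-sided limits $u_-$ and $u_+$ of $u$ exist, are constant, and either $u_-=u_+$ or they are the left and right states of an admissible shock of speed $s$. Then the Riemann problem is uniquely solvable near $u_*$: there is a neighborhood $V_0\subset\Omega$ of $u_*$ such that for every neighborhood $V\subset V_0$ of $u_*$ there is a neighborhood $W\subset V$ of $u_*$ such that, for all $u_l,u_r\in W$, the Riemann problem with data $u_l,u_r$ has an admissible solution in $V$, and any two admissible solutions in $V$ coincide almost everywhere in $\{t>0\}$. -/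

import Mathlib

open Set Filter Topology MeasureTheory
open scoped ContDiff

/-- The phase space of states `u = (v, w)`, with `v ∈ ℝ^m` and `w ∈ ℝ^p`; thus `N = m + p`. -/
abbrev PhaseState (m p : ℕ) : Type := (Fin m → ℝ) × (Fin p → ℝ)

/-- Time derivative of a function of `(t, x)`. -/
noncomputable def dTime {G : Type*} [NormedAddCommGroup G] [NormedSpace ℝ G]
    (h : ℝ × ℝ → G) (z : ℝ × ℝ) : G :=
  fderiv ℝ h z (1, 0)

/-- Space derivative of a function of `(t, x)`. -/
noncomputable def dSpace {G : Type*} [NormedAddCommGroup G] [NormedSpace ℝ G]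
    (h : ℝ × ℝ → G) (z : ℝ × ℝ) : G :=
  fderiv ℝ h z (0, 1)

/-- The coefficients of the first-order system
`v_t + g(v,w)_x = 0`, `w_t + B(v,w) v_x + C(v,w) w_x = 0`. -/
structure NonconservativeSystem (m p : ℕ) where
  g : PhaseState m p → (Fin m → ℝ)
  B : PhaseState m p → Matrix (Fin p) (Fin m) ℝ
  C : PhaseState m p → Matrix (Fin p) (Fin p) ℝ

namespace NonconservativeSystem

variable {m p : ℕ}

/-- The coefficients are smooth on `Ω`. -/
structure IsSmoothOn (S : NonconservativeSystem m p) (Ω : Set (PhaseState m p)) : Prop where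
  smooth_g : ContDiffOn ℝ ∞ S.g Ω
  smooth_B : ∀ i j, ContDiffOn ℝ ∞ (fun u => S.B u i j) Ω
  smooth_C : ∀ i j, ContDiffOn ℝ ∞ (fun u => S.C u i j) Ω

/-- The matrix `A(u)` of the quasilinear form `u_t + A(u) u_x = 0`, as an endomorphism:
`A(u) (a, b) = (Dg(u) (a, b), B(u) a + C(u) b)`. -/
noncomputable def A (S : NonconservativeSystem m p) (u : PhaseState m p) :
    Module.End ℝ (PhaseState m p) :=
  LinearMap.prod (fderiv ℝ S.g u).toLinearMap
    (LinearMap.coprod (S.B u).mulVecLin (S.C u).mulVecLin)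

/-- `u = (v, w)`, a function of `(t, x)`, is continuously differentiable on the set `D`
and satisfies the system pointwise there. (Used for open sets `D` only.) -/
structure IsClassicalSolutionOn (S : NonconservativeSystem m p) (D : Set (ℝ × ℝ))
    (u : ℝ × ℝ → PhaseState m p) : Prop where
  contDiffOn : ContDiffOn ℝ 1 u D
  eq_v : ∀ z ∈ D, dTime (fun y => (u y).1) z + dSpace (fun y => S.g (u y)) z = 0
  eq_w : ∀ z ∈ D, dTime (fun y => (u y).2) z
    + (S.B (u z)).mulVec (dSpace (fun y => (u y).1) z)
    + (S.C (u z)).mulVec (dSpace (fun y => (u y).2) z) = 0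

/-- `(U, F)` is an entropy pair on `Ω`: the additional balance law `U(u)_t + F(u)_x = 0` holds
for all smooth solutions `u` of the system with values in `Ω`. -/
structure IsEntropyPair (S : NonconservativeSystem m p) (Ω : Set (PhaseState m p))
    (U F : PhaseState m p → ℝ) : Prop where
  smooth_entropy : ContDiffOn ℝ ∞ U Ω
  smooth_flux : ContDiffOn ℝ ∞ F Ω
  balance : ∀ (D : Set (ℝ × ℝ)) (u : ℝ × ℝ → PhaseState m p), IsOpen D → MapsTo u D Ω →
    S.IsClassicalSolutionOn D u →
    ∀ z ∈ D, dTime (fun y => U (u y)) z + dSpace (fun y => F (u y)) z = 0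

/-- The `p × p` matrix whose columns are the gradients `∇_w U_1(u), …, ∇_w U_p(u)`. -/
noncomputable def gradW (U : Fin p → PhaseState m p → ℝ) (u : PhaseState m p) :
    Matrix (Fin p) (Fin p) ℝ :=
  Matrix.of fun i k => fderiv ℝ (U k) u (0, Pi.single i 1)

/-- The system is endowed with a full set of entropies `(U_k, F_k)`, `k = 1, …, p`, on `Ω`. -/
structure HasFullSetOfEntropies (S : NonconservativeSystem m p) (Ω : Set (PhaseState m p))
    (U F : Fin p → PhaseState m p → ℝ) : Prop where
  strictConvex : ∀ k, StrictConvexOn ℝ Ω (U k)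
  entropyPair : ∀ k, S.IsEntropyPair Ω (U k) (F k)
  nondegenerate : ∀ u ∈ Ω, (gradW U u).det ≠ 0

/-- On `Ω`, the matrix `A(u)` has the `N = m + p` distinct real eigenvalues
`lam_1(u) < ⋯ < lam_N(u)`. -/
def IsStrictlyHyperbolicOn (S : NonconservativeSystem m p) (Ω : Set (PhaseState m p))
    (lam : Fin (m + p) → PhaseState m p → ℝ) : Prop :=
  ∀ u ∈ Ω, StrictMono (fun j => lam j u) ∧ ∀ j, (S.A u).HasEigenvalue (lam j u)

/-- All characteristic fields are genuinely nonlinear on `Ω`: `∇lam_j(u) · r ≠ 0` for every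
eigenvector `r` of `A(u)` for the eigenvalue `lam_j(u)`. -/
def IsGenuinelyNonlinearOn (S : NonconservativeSystem m p) (Ω : Set (PhaseState m p))
    (lam : Fin (m + p) → PhaseState m p → ℝ) : Prop :=
  ∀ u ∈ Ω, ∀ j r, (S.A u).HasEigenvector (lam j u) r → fderiv ℝ (lam j) u r ≠ 0

/-- The functions `Φ_i(u₀, Λ)`, `i = 1, …, p`, are continuously differentiable for `u₀ ∈ Ω` and
`Λ` in a neighbourhood of each speed `lam_j(uStar)`; in the neighbourhood of `lam_j(uStar)` they
vanish at `Λ = lam_j(u₀)`, and their `Λ`-derivative is `O(1) (Λ - lam_j(u₀))²` with a nonnegative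
and bounded factor `O(1)`. -/
def IsKineticFunction (lam : Fin (m + p) → PhaseState m p → ℝ) (Ω : Set (PhaseState m p))
    (uStar : PhaseState m p) (Φ : Fin p → PhaseState m p → ℝ → ℝ) : Prop :=
  ∃ δ > 0, ∃ K : ℝ,
    (∀ i, ContDiffOn ℝ 1 (fun q : PhaseState m p × ℝ => Φ i q.1 q.2)
      {q | q.1 ∈ Ω ∧ ∃ j, |q.2 - lam j uStar| < δ}) ∧
    ∀ i j, ∀ u₀ ∈ Ω,
      (|lam j u₀ - lam j uStar| < δ → Φ i u₀ (lam j u₀) = 0) ∧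
      ∀ Λ : ℝ, |Λ - lam j uStar| < δ →
        0 ≤ deriv (Φ i u₀) Λ ∧ deriv (Φ i u₀) Λ ≤ K * (Λ - lam j u₀) ^ 2

/-- The entropy dissipation `E(Λ; u₀, u₁)` of a discontinuity of speed `Λ`. -/
def entropyDissipation (U F : PhaseState m p → ℝ) (Λ : ℝ) (u₀ u₁ : PhaseState m p) : ℝ :=
  -Λ * (U u₁ - U u₀) + F u₁ - F u₀

/-- The discontinuity with left state `u₀`, right state `u₁` and speed `Λ` is an admissible shock:
it satisfies the jump relations of the conservative equations, the kinetic relations (including the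
sign of the entropy dissipation), and the Lax shock inequalities for some characteristic field. -/
structure IsAdmissibleShock (S : NonconservativeSystem m p) (U F : Fin p → PhaseState m p → ℝ)
    (lam : Fin (m + p) → PhaseState m p → ℝ) (Φ : Fin p → PhaseState m p → ℝ → ℝ)
    (Λ : ℝ) (u₀ u₁ : PhaseState m p) : Prop where
  jump : -Λ • (u₁.1 - u₀.1) + S.g u₁ - S.g u₀ = 0
  kinetic : ∀ i, entropyDissipation (U i) (F i) Λ u₀ u₁ = Φ i u₀ Λ ∧ Φ i u₀ Λ ≤ 0
  lax : ∃ j, lam j u₁ < Λ ∧ Λ < lam j u₀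

/-- The sector `{(t, x) : t > 0, x / t ∈ J}`. -/
def sector (J : Set ℝ) : Set (ℝ × ℝ) := {z | 0 < z.1 ∧ z.2 / z.1 ∈ J}

/-- In the sector over `J`, `u` is a centered rarefaction wave of the `j`-th field. -/
def IsRarefactionOn (S : NonconservativeSystem m p) (lam : Fin (m + p) → PhaseState m p → ℝ)
    (j : Fin (m + p)) (J : Set ℝ) (u : ℝ × ℝ → PhaseState m p) : Prop :=
  ∃ R : ℝ → PhaseState m p, (∀ z ∈ sector J, u z = R (z.2 / z.1)) ∧ ContDiffOn ℝ 1 R J ∧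
    ∀ ξ ∈ J, lam j (R ξ) = ξ ∧ (S.A (R ξ)).HasEigenvector (lam j (R ξ)) (deriv R ξ)

/-- `u` (a function of `(t, x)`, considered for `t > 0`) is a `Φ`-admissible solution with values
in `V` of the Riemann problem with data `ul`, `ur`, in the class of piecewise smooth functions
consisting of a combination of rarefaction waves and admissible shock waves. There are finitely
many rays `x = s t`, `s ∈ P`; any number and any order of the waves is allowed. -/
structure IsRiemannSolution (S : NonconservativeSystem m p) (U F : Fin p → PhaseState m p → ℝ)
    (lam : Fin (m + p) → PhaseState m p → ℝ) (Φ : Fin p → PhaseState m p → ℝ → ℝ)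
    (V : Set (PhaseState m p)) (ul ur : PhaseState m p) (u : ℝ × ℝ → PhaseState m p) : Prop where
  mem : ∀ z : ℝ × ℝ, 0 < z.1 → u z ∈ V
  initial_left : ∀ x < 0, Tendsto (fun t => u (t, x)) (𝓝[>] 0) (𝓝 ul)
  initial_right : ∀ x > 0, Tendsto (fun t => u (t, x)) (𝓝[>] 0) (𝓝 ur)
  /-- between the rays, `u` is a classical solution, and is constant or a rarefaction wave;
  along each ray, `u` has constant one-sided limits, and is continuous or an admissible shock -/
  waves : ∃ P : Finset ℝ,
    (∀ J : Set ℝ, IsOpen J → J.OrdConnected → Disjoint J (P : Set ℝ) →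
      S.IsClassicalSolutionOn (sector J) u ∧
      ((∃ c, ∀ z ∈ sector J, u z = c) ∨ ∃ j, S.IsRarefactionOn lam j J u)) ∧
    ∀ s ∈ P, ∃ u₀ u₁ : PhaseState m p,
      (∀ t > 0, Tendsto u (𝓝[sector (Iio s)] (t, s * t)) (𝓝 u₀) ∧
        Tendsto u (𝓝[sector (Ioi s)] (t, s * t)) (𝓝 u₁)) ∧
      (u₀ = u₁ ∨ S.IsAdmissibleShock U F lam Φ s u₀ u₁)

end NonconservativeSystem

section DividedDifference

variable {E F : Type*} [NormedAddCommGroup E] [NormedSpace ℝ E]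
  [NormedAddCommGroup F] [NormedSpace ℝ F]

/-- The difference quotient `(G (u + ε d) - G u) / ε`, extended by `DG(u) d` at `ε = 0`,
as a function of `(ε, u, d)`. -/
noncomputable def dividedDiff (G : E → F) (p : ℝ × E × E) : F :=
  open Classical in
  if p.1 = 0 then fderiv ℝ G p.2.1 p.2.2 else p.1⁻¹ • (G (p.2.1 + p.1 • p.2.2) - G p.2.1)

theorem dividedDiff_zero (G : E → F) (u d : E) : dividedDiff G (0, u, d) = fderiv ℝ G u d := by
  simp [dividedDiff]

theorem smul_dividedDiff (G : E → F) (ε : ℝ) (u d : E) :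
    ε • dividedDiff G (ε, u, d) = G (u + ε • d) - G u := by
  by_cases h : ε = 0
  · simp [h]
  · simp [dividedDiff, h]

theorem dividedDiff_symm (G : E → F) {ε : ℝ} (hε : ε ≠ 0) (u d : E) :
    dividedDiff G (-ε, u + ε • d, d) = dividedDiff G (ε, u, d) := by
  simp only [dividedDiff, neg_eq_zero, hε, if_false, neg_smul, add_neg_cancel_right, inv_neg]
  rw [← smul_neg, neg_sub]

theorem hasDerivAt_smul_dividedDiff {G : E → F} {p : ℝ × E × E} {s : ℝ}
    (hG : DifferentiableAt ℝ G (p.2.1 + (s * p.1) • p.2.2)) :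
    HasDerivAt (fun s : ℝ => s • dividedDiff G (s * p.1, p.2.1, p.2.2))
      (fderiv ℝ G (p.2.1 + (s * p.1) • p.2.2) p.2.2) s := by
  obtain ⟨ε, u, d⟩ := p
  simp only at *
  by_cases h : ε = 0
  · subst h
    simp only [mul_zero, dividedDiff_zero, zero_smul, add_zero]
    simpa using (hasDerivAt_id s).smul_const (fderiv ℝ G u d)
  · have key : (fun s : ℝ => s • dividedDiff G (s * ε, u, d))
        = fun s => ε⁻¹ • (G (u + (s * ε) • d) - G u) := by
      funext s
      rw [← smul_dividedDiff G (s * ε) u d, smul_smul]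
      congr 1
      field_simp
    rw [key]
    have h1 : HasDerivAt (fun s : ℝ => u + (s * ε) • d) (ε • d) s := by
      simpa using (((hasDerivAt_id s).mul_const ε).smul_const d).const_add u
    have h2 := (hG.hasFDerivAt.comp_hasDerivAt s h1).sub_const (G u) |>.const_smul ε⁻¹
    convert! h2 using 1
    simp [smul_smul, inv_mul_cancel₀ h]

theorem exists_hasStrictFDerivAt_dividedDiff {G : E → F} {u : E} (hG : ContDiffAt ℝ 2 G u)
    (d : E) :
    ∃ L : ℝ × E × E →L[ℝ] F, HasStrictFDerivAt (dividedDiff G) L (0, u, d) ∧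
      ∀ e, L (0, 0, e) = fderiv ℝ G u e := by
  set p₀ : ℝ × E × E := (0, u, d) with hp₀
  set k : ℝ × E × E → F := fun p => fderiv ℝ G (p.2.1 + p.1 • p.2.2) p.2.2 with hk
  have hbase : ContDiffAt ℝ 1 (fun p : ℝ × E × E => p.2.1 + p.1 • p.2.2) p₀ := by
    fun_prop
  have hval : p₀.2.1 + p₀.1 • p₀.2.2 = u := by simp [hp₀]
  have hk1 : ContDiffAt ℝ 1 k p₀ := by
    have h1 : ContDiffAt ℝ 1 (fderiv ℝ G) u := hG.fderiv_right (by norm_num)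
    have h2 : ContDiffAt ℝ 1 (fun p : ℝ × E × E => fderiv ℝ G (p.2.1 + p.1 • p.2.2)) p₀ :=
      ContDiffAt.comp p₀ (g := fderiv ℝ G) (by rw [hval]; exact h1) hbase
    exact h2.clm_apply (by fun_prop)
  obtain ⟨k', hk'⟩ : ∃ k', HasStrictFDerivAt k k' p₀ :=
    ⟨_, hk1.hasStrictFDerivAt (by norm_num)⟩
  have hdiff : ∀ᶠ p in 𝓝 p₀, DifferentiableAt ℝ G (p.2.1 + p.1 • p.2.2) := by
    have h1 : ∀ᶠ v in 𝓝 u, DifferentiableAt ℝ G v :=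
      (hG.eventually (by norm_num)).mono fun v hv => hv.differentiableAt (by norm_num)
    have h2 := hbase.continuousAt.tendsto
    rw [hval] at h2
    exact h2.eventually h1
  set m : ℝ → ℝ × E × E →L[ℝ] ℝ × E × E := fun s =>
    (s • ContinuousLinearMap.fst ℝ ℝ (E × E)).prod (ContinuousLinearMap.snd ℝ ℝ (E × E)) with hm
  have hmap : ∀ s p, m s p = (s * p.1, p.2) := fun s p => by simp [hm]
  refine ⟨k'.comp (m (1 / 2)), ?_, ?_⟩
  · rw [hasStrictFDerivAt_iff_isLittleO, Asymptotics.isLittleO_iff]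
    intro c hc
    rw [hasStrictFDerivAt_iff_isLittleO, Asymptotics.isLittleO_iff] at hk'
    obtain ⟨ρ₁, hρ₁, h₁⟩ := Metric.eventually_nhds_iff_ball.1 (hk' hc)
    obtain ⟨ρ₂, hρ₂, h₂⟩ := Metric.eventually_nhds_iff_ball.1 hdiff
    have hscale : ∀ s ∈ Icc (0 : ℝ) 1, ∀ p : ℝ × E × E, ‖m s p‖ ≤ ‖p‖ := by
      intro s hs p
      rw [hmap, Prod.norm_def, Prod.norm_def]
      refine max_le_max ?_ le_rfl
      simp only [norm_mul, Real.norm_eq_abs, abs_of_nonneg hs.1]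
      exact mul_le_of_le_one_left (abs_nonneg _) hs.2
    have hscale' : ∀ s ∈ Icc (0 : ℝ) 1, ∀ p, ∀ ρ, p ∈ Metric.ball p₀ ρ → m s p ∈ Metric.ball p₀ ρ := by
      intro s hs p ρ hp
      rw [mem_ball_iff_norm] at *
      have : m s p - p₀ = m s (p - p₀) := by
        rw [map_sub]; congr 1; rw [hmap]; simp [hp₀]
      rw [this]
      exact (hscale s hs _).trans_lt hp
    refine Metric.eventually_nhds_iff_ball.2 ⟨min ρ₁ ρ₂, lt_min hρ₁ hρ₂, ?_⟩
    rintro ⟨p, p'⟩ hpp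
    rw [← ball_prod_same, mem_prod] at hpp
    obtain ⟨hp, hp'⟩ := hpp
    simp only at hp hp' ⊢
    have hder : ∀ q ∈ Metric.ball p₀ (min ρ₁ ρ₂), ∀ s ∈ Icc (0 : ℝ) 1,
        HasDerivAt (fun s : ℝ => s • dividedDiff G (s * q.1, q.2.1, q.2.2)) (k (m s q)) s := by
      intro q hq s hs
      have h3 := h₂ _ (hscale' s hs q ρ₂ (Metric.ball_subset_ball (min_le_right _ _) hq))
      rw [hmap] at h3 ⊢
      exact hasDerivAt_smul_dividedDiff h3
    have hlin : ∀ s : ℝ, HasDerivAt (fun s : ℝ => (s ^ 2 / 2) • k' ((p - p').1, 0)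
        + s • k' (0, (p - p').2)) (k' (m s (p - p'))) s := by
      intro s
      have h1 : HasDerivAt (fun s : ℝ => s ^ 2 / 2) s s := by
        simpa using ((hasDerivAt_id s).pow 2).div_const 2
      have h3 := (h1.smul_const (k' ((p - p').1, 0))).add
        ((hasDerivAt_id s).smul_const (k' (0, (p - p').2)))
      convert! h3 using 1
      rw [hmap, one_smul, ← map_smul, ← map_add]
      simp
    have hψ := norm_image_sub_le_of_norm_deriv_le_segment_01'
      (f := fun s : ℝ => s • dividedDiff G (s * p.1, p.2.1, p.2.2)
        - s • dividedDiff G (s * p'.1, p'.2.1, p'.2.2)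
        - ((s ^ 2 / 2) • k' ((p - p').1, 0) + s • k' (0, (p - p').2)))
      (f' := fun s => k (m s p) - k (m s p') - k' (m s (p - p'))) (C := c * ‖p - p'‖)
      (fun s hs => (((hder p hp s hs).sub (hder p' hp' s hs)).sub (hlin s)).hasDerivWithinAt)
      (by
        intro s hs
        have hs' := Ico_subset_Icc_self hs
        have h3 := h₁ (m s p, m s p') (by
          rw [← ball_prod_same]
          exact ⟨hscale' s hs' p ρ₁ (Metric.ball_subset_ball (min_le_left _ _) hp),
            hscale' s hs' p' ρ₁ (Metric.ball_subset_ball (min_le_left _ _) hp')⟩)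
        simp only at h3
        rw [← map_sub] at h3
        exact h3.trans (mul_le_mul_of_nonneg_left (hscale s hs' _) hc.le))
    have hfin : (k'.comp (m (1 / 2))) (p - p')
        = ((1 : ℝ) ^ 2 / 2) • k' ((p - p').1, 0) + (1 : ℝ) • k' (0, (p - p').2) := by
      rw [ContinuousLinearMap.comp_apply, hmap, one_smul, ← map_smul, ← map_add]
      simp
    simp only [one_smul, one_mul, zero_smul, sub_zero, Prod.mk.eta] at hψ hfin
    rw [hfin]
    simpa using hψ
  · intro e
    have h1 : HasFDerivAt (fun e : E => k (0, u, e))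
        (k'.comp ((0 : E →L[ℝ] ℝ).prod ((0 : E →L[ℝ] E).prod (ContinuousLinearMap.id ℝ E)))) d :=
      HasFDerivAt.comp d (g := k) (f := fun e : E => ((0 : ℝ), u, e)) hk'.hasFDerivAt
        ((hasFDerivAt_const 0 d).prodMk ((hasFDerivAt_const u d).prodMk (hasFDerivAt_id d)))
    have h2 : HasFDerivAt (fun e : E => k (0, u, e)) (fderiv ℝ G u) d := by
      simpa [hk] using (fderiv ℝ G u).hasFDerivAt (x := d)
    have h3 := congrArg (fun l : E →L[ℝ] F => l e) (h1.unique h2)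
    simpa [hmap] using h3

end DividedDifference

section ShockResolution

variable {E : Type*} [NormedAddCommGroup E] [NormedSpace ℝ E]

theorem ContinuousLinearMap.isInvertible_of_injective [FiniteDimensional ℝ E] {f : E →L[ℝ] E}
    (hf : Function.Injective f) : f.IsInvertible :=
  ⟨(LinearEquiv.ofInjectiveEndo (f : E →ₗ[ℝ] E) hf).toContinuousLinearEquiv, by ext; rfl⟩

/-- `r` is a simple, genuinely nonlinear characteristic field with speed `lam` of the system
`Z(u)_t + G(u)_x = 0` near `u₀`, normalized at `u₀`. -/
structure CharacteristicField (G Z : E → E) (lam : E → ℝ) (r : E → E) (u₀ : E) : Prop where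
  contDiff_flux : ContDiffAt ℝ 2 G u₀
  contDiff_density : ContDiffAt ℝ 2 Z u₀
  strict_speed : HasStrictFDerivAt lam (fderiv ℝ lam u₀) u₀
  continuousAt : ContinuousAt r u₀
  eigen : ∀ᶠ u in 𝓝 u₀, fderiv ℝ G u (r u) = lam u • fderiv ℝ Z u (r u)
  normalized : fderiv ℝ lam u₀ (r u₀) = 1
  simple : ∀ (d : E) (c : ℝ), fderiv ℝ G u₀ d - lam u₀ • fderiv ℝ Z u₀ d = c • fderiv ℝ Z u₀ (r u₀) →
    c = 0 ∧ ∃ a : ℝ, d = a • r u₀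

/-- A local resolution of the equations `(Q_G - (lam u + τ) Q_Z)(ε, u, d) = y`, `ℓ d = 1` for
`(d, τ) = ψ (ε, u, y)`, where `Q_G`, `Q_Z` are the difference quotients and `ℓ = ∇lam(u₀)`. -/
structure IsShockResolution (G Z : E → E) (lam : E → ℝ) (r : E → E) (u₀ : E) (L : ℝ)
    (ψ : ℝ × E × E → E × ℝ) : Prop where
  pos : 0 < L
  base : ψ (0, u₀, 0) = (r u₀, 0)
  continuousAt : ContinuousAt ψ (0, u₀, 0)
  lipschitz : ∀ᶠ x : (ℝ × E × E) × (ℝ × E × E) in 𝓝 ((0, u₀, 0), (0, u₀, 0)),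
    ‖ψ x.1 - ψ x.2‖ ≤ L * ‖x.1 - x.2‖
  speed_zero : ∀ᶠ u in 𝓝 u₀, (ψ (0, u, 0)).2 = 0
  speed_approx : ∀ c > 0, ∀ᶠ x : ℝ × E × E in 𝓝 (0, u₀, 0),
    |(ψ x).2 - x.1 / 2| ≤ c * |x.1| + L * ‖x.2.2‖
  solve : ∀ᶠ q : (ℝ × E × E) × (E × ℝ) in 𝓝 ((0, u₀, 0), (r u₀, 0)),
    (dividedDiff G (q.1.1, q.1.2.1, q.2.1)
        - (lam q.1.2.1 + q.2.2) • dividedDiff Z (q.1.1, q.1.2.1, q.2.1) = q.1.2.2 ∧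
      fderiv ℝ lam u₀ q.2.1 = 1) ↔ ψ q.1 = q.2

theorem CharacteristicField.hasStrictFDerivAt_shockEquation {G Z : E → E}
    {lam : E → ℝ} {r : E → E} {u₀ : E} (h : CharacteristicField G Z lam r u₀) :
    ∃ f' : (ℝ × E × E) × (E × ℝ) →L[ℝ] E × ℝ,
      HasStrictFDerivAt (fun q : (ℝ × E × E) × (E × ℝ) =>
        (dividedDiff G (q.1.1, q.1.2.1, q.2.1)
          - (lam q.1.2.1 + q.2.2) • dividedDiff Z (q.1.1, q.1.2.1, q.2.1) - q.1.2.2,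
        fderiv ℝ lam u₀ q.2.1)) f' ((0, u₀, 0), (r u₀, 0)) ∧
      ∀ d c, f' (0, (d, c)) = (fderiv ℝ G u₀ d - lam u₀ • fderiv ℝ Z u₀ d
        - c • fderiv ℝ Z u₀ (r u₀), fderiv ℝ lam u₀ d) := by
  obtain ⟨LG, hLG, hLG'⟩ := exists_hasStrictFDerivAt_dividedDiff h.contDiff_flux (r u₀)
  obtain ⟨LZ, hLZ, hLZ'⟩ := exists_hasStrictFDerivAt_dividedDiff h.contDiff_density (r u₀)
  let pu : (ℝ × E × E) × (E × ℝ) →L[ℝ] E :=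
    ((ContinuousLinearMap.fst ℝ E E).comp (ContinuousLinearMap.snd ℝ ℝ (E × E))).comp
        (ContinuousLinearMap.fst ℝ _ _)
  let pτ : (ℝ × E × E) × (E × ℝ) →L[ℝ] ℝ :=
    (ContinuousLinearMap.snd ℝ E ℝ).comp (ContinuousLinearMap.snd ℝ _ _)
  let py : (ℝ × E × E) × (E × ℝ) →L[ℝ] E :=
    ((ContinuousLinearMap.snd ℝ E E).comp (ContinuousLinearMap.snd ℝ ℝ (E × E))).comp
        (ContinuousLinearMap.fst ℝ _ _)
  let pd : (ℝ × E × E) × (E × ℝ) →L[ℝ] E :=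
    (ContinuousLinearMap.fst ℝ E ℝ).comp (ContinuousLinearMap.snd ℝ _ _)
  let pr : (ℝ × E × E) × (E × ℝ) →L[ℝ] ℝ × E × E :=
    ((ContinuousLinearMap.fst ℝ ℝ (E × E)).comp (ContinuousLinearMap.fst ℝ _ _)).prod
      (pu.prod pd)
  have hQ : ∀ {H : E → E} {LH : ℝ × E × E →L[ℝ] E},
      HasStrictFDerivAt (dividedDiff H) LH (0, u₀, r u₀) →
      HasStrictFDerivAt (fun q : (ℝ × E × E) × (E × ℝ) =>
        dividedDiff H (q.1.1, q.1.2.1, q.2.1)) (LH.comp pr) ((0, u₀, 0), (r u₀, 0)) :=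
    fun {H LH} hH => HasStrictFDerivAt.comp (x := ((0, u₀, 0), (r u₀, 0)))
      (g := dividedDiff H) (f := pr) hH pr.hasStrictFDerivAt
  have hspeed : HasStrictFDerivAt (fun q : (ℝ × E × E) × (E × ℝ) => lam q.1.2.1 + q.2.2)
      ((fderiv ℝ lam u₀).comp pu + pτ) ((0, u₀, 0), (r u₀, 0)) :=
    (HasStrictFDerivAt.comp (x := ((0, u₀, 0), (r u₀, 0))) (g := lam) (f := pu) h.strict_speed
      pu.hasStrictFDerivAt).add pτ.hasStrictFDerivAt
  refine ⟨_, (((hQ hLG).sub (hspeed.smul (hQ hLZ))).sub py.hasStrictFDerivAt).prodMk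
    (HasStrictFDerivAt.comp (x := ((0, u₀, 0), (r u₀, 0))) (g := fderiv ℝ lam u₀) (f := pd)
      (fderiv ℝ lam u₀).hasStrictFDerivAt pd.hasStrictFDerivAt), ?_⟩
  intro d c
  simp [pr, pu, pd, pτ, py, hLG', hLZ', dividedDiff_zero, sub_sub]

theorem CharacteristicField.exists_isShockResolution [FiniteDimensional ℝ E] {G Z : E → E}
    {lam : E → ℝ} {r : E → E} {u₀ : E} (h : CharacteristicField G Z lam r u₀) :
    ∃ L ψ, IsShockResolution G Z lam r u₀ L ψ := by
  have : CompleteSpace E := FiniteDimensional.complete ℝ E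
  obtain ⟨f', hf', hf'₂⟩ := h.hasStrictFDerivAt_shockEquation
  set f : (ℝ × E × E) × (E × ℝ) → E × ℝ := fun q =>
        (dividedDiff G (q.1.1, q.1.2.1, q.2.1)
          - (lam q.1.2.1 + q.2.2) • dividedDiff Z (q.1.1, q.1.2.1, q.2.1) - q.1.2.2,
        fderiv ℝ lam u₀ q.2.1) with hf
  have hf0 : f ((0, u₀, 0), (r u₀, 0)) = (0, 1) := by
    simp only [hf, dividedDiff_zero, add_zero, sub_zero]
    rw [h.eigen.self_of_nhds, h.normalized, sub_self]
  have hinv : (f' ∘L .inr ℝ (ℝ × E × E) (E × ℝ)).IsInvertible := by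
    apply ContinuousLinearMap.isInvertible_of_injective
    rw [injective_iff_map_eq_zero]
    rintro ⟨d, c⟩ hdc
    simp only [ContinuousLinearMap.comp_apply, ContinuousLinearMap.inr_apply, hf'₂,
      Prod.mk_eq_zero, sub_eq_zero] at hdc
    obtain ⟨rfl, a, rfl⟩ := h.simple d c hdc.1
    have : a = 0 := by simpa [h.normalized] using hdc.2
    simp [this]
  set ψ := hf'.implicitFunctionOfProdDomain hinv with hψ
  obtain ⟨ψ', hψ'⟩ : ∃ ψ', HasStrictFDerivAt ψ ψ' (0, u₀, 0) :=
    ⟨_, hf'.hasStrictFDerivAt_implicitFunctionOfProdDomain hinv⟩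
  have hsolve := hf'.eventually_apply_eq_iff_implicitFunctionOfProdDomain hinv
  rw [hf0, ← hψ] at hsolve
  have hsolve' : ∀ᶠ q : (ℝ × E × E) × (E × ℝ) in 𝓝 ((0, u₀, 0), (r u₀, 0)),
      (dividedDiff G (q.1.1, q.1.2.1, q.2.1)
        - (lam q.1.2.1 + q.2.2) • dividedDiff Z (q.1.1, q.1.2.1, q.2.1) = q.1.2.2 ∧
      fderiv ℝ lam u₀ q.2.1 = 1) ↔ ψ q.1 = q.2 := by
    filter_upwards [hsolve] with q hq
    rw [← hq, hf, Prod.mk.injEq, sub_eq_zero]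
  have hbase : ψ (0, u₀, 0) = (r u₀, 0) := hsolve.self_of_nhds.1 hf0
  have hzero : ∀ᶠ u in 𝓝 u₀, (ψ (0, u, 0)).2 = 0 := by
    have hn : Tendsto (fun u => (fderiv ℝ lam u₀ (r u))) (𝓝 u₀) (𝓝 1) := by
      have := (fderiv ℝ lam u₀).continuous.continuousAt.tendsto.comp h.continuousAt.tendsto
      rw [h.normalized] at this
      exact this
    have ht : Tendsto (fun u => (((0 : ℝ), u, (0 : E)), ((fderiv ℝ lam u₀ (r u))⁻¹ • r u, (0 : ℝ))))
        (𝓝 u₀) (𝓝 ((0, u₀, 0), (r u₀, 0))) := by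
      refine Tendsto.prodMk_nhds (by exact Continuous.tendsto' (by fun_prop) _ _ rfl)
        (Tendsto.prodMk_nhds ?_ tendsto_const_nhds)
      simpa using (hn.inv₀ one_ne_zero).smul h.continuousAt.tendsto
    filter_upwards [ht.eventually hsolve', h.eigen, hn.eventually_ne one_ne_zero] with u h1 h2 h3
    rw [h1.1]
    simp only [dividedDiff_zero, map_smul, h2, add_zero, smul_comm _ (lam u), sub_self,
      smul_eq_mul, inv_mul_cancel₀ h3, true_and]
  have hσy : ∀ h, (ψ' (0, h, 0)).2 = 0 := by
    have h1 : HasFDerivAt (fun u : E => (ψ (0, u, 0)).2)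
        (((ContinuousLinearMap.snd ℝ E ℝ).comp ψ').comp
          ((0 : E →L[ℝ] ℝ).prod ((ContinuousLinearMap.id ℝ E).prod (0 : E →L[ℝ] E)))) u₀ :=
      HasFDerivAt.comp u₀ (g := fun x => (ψ x).2) (f := fun u : E => ((0 : ℝ), u, (0 : E)))
        hψ'.hasFDerivAt.snd
        ((hasFDerivAt_const 0 _).prodMk ((hasFDerivAt_id _).prodMk (hasFDerivAt_const _ _)))
    have h2 : HasFDerivAt (fun u : E => (ψ (0, u, 0)).2) (0 : E →L[ℝ] ℝ) u₀ :=
      (hasFDerivAt_const (0 : ℝ) u₀).congr_of_eventuallyEq hzero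
    intro h
    simpa using congrArg (fun l : E →L[ℝ] ℝ => l h) (h1.unique h2)
  have hhalf : (ψ' (1, 0, 0)).2 = 1 / 2 := by
    have hψs : HasDerivAt (fun s : ℝ => ψ (s, u₀, 0)) (ψ' (1, 0, 0)) 0 :=
      HasFDerivAt.comp_hasDerivAt (0 : ℝ) (l := ψ) (f := fun s : ℝ => (s, u₀, (0 : E)))
        hψ'.hasFDerivAt ((hasDerivAt_id (0 : ℝ)).prodMk
          ((hasDerivAt_const (0 : ℝ) u₀).prodMk (hasDerivAt_const (0 : ℝ) (0 : E))))
    have hγ : HasDerivAt (fun s : ℝ => u₀ + s • (ψ (s, u₀, 0)).1) (r u₀) 0 := by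
      simpa [hbase] using ((hasDerivAt_id (0 : ℝ)).smul hψs.fst).const_add u₀
    have hγ0 : u₀ + (0 : ℝ) • (ψ (0, u₀, 0)).1 = u₀ := by simp
    have hR : HasDerivAt (fun s : ℝ => lam (u₀ + s • (ψ (s, u₀, 0)).1)
        + (ψ (-s, u₀ + s • (ψ (s, u₀, 0)).1, 0)).2)
        (fderiv ℝ lam u₀ (r u₀) + (ψ' (-1, r u₀, 0)).2) 0 := by
      refine HasDerivAt.add ?_ ?_
      · exact HasFDerivAt.comp_hasDerivAt (0 : ℝ) (l := lam)
          (f := fun s : ℝ => u₀ + s • (ψ (s, u₀, 0)).1)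
          (by rw [hγ0]; exact h.strict_speed.hasFDerivAt) hγ
      · exact (HasFDerivAt.comp_hasDerivAt (0 : ℝ) (l := ψ)
          (f := fun s : ℝ => (-s, u₀ + s • (ψ (s, u₀, 0)).1, (0 : E)))
          (by rw [hγ0, neg_zero]; exact hψ'.hasFDerivAt) ((hasDerivAt_neg (0 : ℝ)).prodMk
            (hγ.prodMk (hasDerivAt_const (0 : ℝ) (0 : E))))).snd
    have hLd : HasDerivAt (fun s : ℝ => lam u₀ + (ψ (s, u₀, 0)).2) (ψ' (1, 0, 0)).2 0 :=
      hψs.snd.const_add _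
    have ht1 : Tendsto (fun s : ℝ => ((s, u₀, (0 : E)), ψ (s, u₀, 0))) (𝓝 0)
        (𝓝 ((0, u₀, 0), (r u₀, 0))) := by
      refine Tendsto.prodMk_nhds (Continuous.tendsto' (by fun_prop) _ _ rfl) ?_
      have := hψs.continuousAt.tendsto
      rwa [hbase] at this
    have ht2 : Tendsto (fun s : ℝ => ((-s, u₀ + s • (ψ (s, u₀, 0)).1, (0 : E)),
        ((ψ (s, u₀, 0)).1, lam u₀ + (ψ (s, u₀, 0)).2 - lam (u₀ + s • (ψ (s, u₀, 0)).1)))) (𝓝 0)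
        (𝓝 ((0, u₀, 0), (r u₀, 0))) := by
      have hγt := hγ.continuousAt.tendsto
      rw [hγ0] at hγt
      have hψt := hψs.continuousAt.tendsto
      rw [hbase] at hψt
      refine Tendsto.prodMk_nhds (Tendsto.prodMk_nhds (by simpa using (continuous_neg (G := ℝ)).tendsto 0)
        (hγt.prodMk_nhds tendsto_const_nhds)) (Tendsto.prodMk_nhds hψt.fst_nhds ?_)
      simpa using (hψt.snd_nhds.const_add (lam u₀)).sub
        (h.strict_speed.continuousAt.tendsto.comp hγt)
    have hEq : (fun s : ℝ => lam u₀ + (ψ (s, u₀, 0)).2) =ᶠ[𝓝 0] fun s : ℝ =>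
        lam (u₀ + s • (ψ (s, u₀, 0)).1) + (ψ (-s, u₀ + s • (ψ (s, u₀, 0)).1, 0)).2 := by
      filter_upwards [ht1.eventually hsolve', ht2.eventually hsolve'] with s h1 h2
      by_cases hs : s = 0
      · subst hs; simp
      · have h3 := h1.2 rfl
        rw [dividedDiff_symm _ hs, dividedDiff_symm _ hs, add_sub_cancel] at h2
        have h4 := congrArg Prod.snd (h2.1 h3)
        simp only at h4
        rw [h4]
        ring
    have hu := hLd.unique (hR.congr_of_eventuallyEq hEq)
    have hsplit : ψ' (-1, r u₀, 0) = -ψ' (1, 0, 0) + ψ' (0, r u₀, 0) := by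
      rw [← map_neg, ← map_add]; simp
    rw [hsplit, Prod.snd_add, Prod.snd_neg, hσy, h.normalized] at hu
    linarith
  obtain ⟨K, t, ht, hK⟩ := hψ'.exists_lipschitzOnWith
  refine ⟨K + ‖ψ'‖ + 1, ψ, by positivity, hbase, hψ'.continuousAt, ?_, hzero, ?_, hsolve'⟩
  · filter_upwards [prod_mem_nhds ht ht] with x hx
    refine (hK.norm_sub_le hx.1 hx.2).trans ?_
    gcongr
    linarith [norm_nonneg ψ']
  · intro c hc
    have hc' : 0 < min c 1 := lt_min hc one_pos
    have h1 := hψ'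
    rw [hasStrictFDerivAt_iff_isLittleO, Asymptotics.isLittleO_iff] at h1
    have h2 : Tendsto (fun x : ℝ × E × E => (x, ((0 : ℝ), x.2.1, (0 : E)))) (𝓝 (0, u₀, 0))
        (𝓝 ((0, u₀, 0), (0, u₀, 0))) := Continuous.tendsto' (by fun_prop) _ _ rfl
    have h3 : Tendsto (fun x : ℝ × E × E => x.2.1) (𝓝 (0, u₀, 0)) (𝓝 u₀) :=
      Continuous.tendsto' (by fun_prop) _ _ rfl
    filter_upwards [h2.eventually (h1 hc'), h3.eventually hzero] with x hx hx0
    obtain ⟨ε, u, y⟩ := x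
    simp only [Prod.mk_sub_mk, sub_zero, sub_self] at hx hx0 ⊢
    have h4 := (norm_snd_le _).trans hx
    have h5 : ψ' (ε, 0, y) = ε • ψ' (1, 0, 0) + ψ' (0, 0, y) := by
      rw [← map_smul, ← map_add]; simp
    rw [Prod.snd_sub, Prod.snd_sub, hx0, h5, Prod.snd_add, Prod.smul_snd, hhalf,
      Real.norm_eq_abs, smul_eq_mul] at h4
    have h6 : ‖((ε, 0, y) : ℝ × E × E)‖ ≤ |ε| + ‖y‖ := by
      simp only [Prod.norm_def, Real.norm_eq_abs, norm_zero]
      refine max_le (by linarith [norm_nonneg y]) (max_le (by positivity) (by linarith [abs_nonneg ε]))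
    have h7 : |(ψ' (0, 0, y)).2| ≤ ‖ψ'‖ * ‖y‖ := by
      refine (norm_snd_le _).trans ((ψ'.le_opNorm _).trans_eq ?_)
      simp [Prod.norm_def]
    calc |(ψ (ε, u, y)).2 - ε / 2|
        = |((ψ (ε, u, y)).2 - 0 - (ε * (1 / 2) + (ψ' (0, 0, y)).2)) + (ψ' (0, 0, y)).2| := by
          ring_nf
      _ ≤ min c 1 * (|ε| + ‖y‖) + ‖ψ'‖ * ‖y‖ :=
          (abs_add_le _ _).trans (add_le_add (h4.trans (by gcongr)) h7)
      _ ≤ c * |ε| + (K + ‖ψ'‖ + 1) * ‖y‖ := by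
          have h8 : min c 1 * |ε| ≤ c * |ε| := by gcongr; exact min_le_left _ _
          have h9 : min c 1 * ‖y‖ ≤ 1 * ‖y‖ := by gcongr; exact min_le_right _ _
          have h10 : 0 ≤ (K : ℝ) * ‖y‖ := by positivity
          linarith

end ShockResolution

section ShockCurve

variable {E : Type*} [NormedAddCommGroup E] [NormedSpace ℝ E]

/-- `χ (u, τ)` is a cubically small dissipation term: it vanishes at `τ = 0`, is strictly
differentiable at `(u₀, 0)` with derivative zero, and its Lipschitz constant in `τ` is `O(τ²)`. -/
structure IsDissipationTerm (χ : E × ℝ → E) (u₀ : E) (K : ℝ) : Prop where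
  pos : 0 < K
  zero : ∀ᶠ u in 𝓝 u₀, χ (u, 0) = 0
  strict : HasStrictFDerivAt χ (0 : E × ℝ →L[ℝ] E) (u₀, 0)
  lipschitz : ∀ᶠ q : E × ℝ × ℝ in 𝓝 (u₀, 0, 0),
    ‖χ (q.1, q.2.1) - χ (q.1, q.2.2)‖ ≤ K * max |q.2.1| |q.2.2| ^ 2 * |q.2.1 - q.2.2|

theorem eventually_forall_abs_le {X : Type*} [TopologicalSpace X] {x₀ : X} {a : X → E} {b : X → ℝ}
    {u₀ : E} (ha : Tendsto a (𝓝 x₀) (𝓝 u₀)) (hb : Tendsto b (𝓝 x₀) (𝓝 0))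
    {P : E × ℝ × ℝ → Prop} (hP : ∀ᶠ q in 𝓝 (u₀, 0, 0), P q) :
    ∀ᶠ x in 𝓝 x₀, ∀ t t', |t| ≤ b x → |t'| ≤ b x → P (a x, t, t') := by
  obtain ⟨ρ, hρ, h⟩ := Metric.eventually_nhds_iff_ball.1 hP
  filter_upwards [ha.eventually (Metric.ball_mem_nhds _ hρ), hb.eventually (gt_mem_nhds hρ)]
    with x h1 h2 t t' ht ht'
  apply h
  rw [← ball_prod_same, ← ball_prod_same]
  refine ⟨h1, ?_, ?_⟩ <;> simp only [Metric.mem_ball, dist_zero_right, Real.norm_eq_abs]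
  · exact ht.trans_lt h2
  · exact ht'.trans_lt h2

theorem IsDissipationTerm.eventually_cubic {χ : E × ℝ → E} {u₀ : E} {K : ℝ}
    (hχ : IsDissipationTerm χ u₀ K) {X : Type*} [TopologicalSpace X] {x₀ : X} {a : X → E}
    {b : X → ℝ} (ha : Tendsto a (𝓝 x₀) (𝓝 u₀)) (hb : Tendsto b (𝓝 x₀) (𝓝 0)) :
    ∀ᶠ x in 𝓝 x₀, ∀ t, |t| ≤ b x → ‖χ (a x, t)‖ ≤ K * b x ^ 3 := by
  filter_upwards [eventually_forall_abs_le ha hb hχ.lipschitz, ha.eventually hχ.zero]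
    with x h1 h2 t ht
  have h3 := h1 t 0 ht (by simpa using (abs_nonneg t).trans ht)
  simp only [h2, sub_zero, abs_zero, max_eq_left (abs_nonneg t)] at h3
  refine h3.trans ?_
  have hK := hχ.pos
  calc K * |t| ^ 2 * |t| = K * |t| ^ 3 := by ring
    _ ≤ _ := by gcongr

variable {G Z : E → E} {lam : E → ℝ} {r : E → E} {u₀ : E} {L K : ℝ} {ψ : ℝ × E × E → E × ℝ}
  {χ : E × ℝ → E}

/-- The relative speed `τ` of the shock of strength `p.1` with left state `p.2`. -/
structure IsShockSpeed (ψ : ℝ × E × E → E × ℝ) (χ : E × ℝ → E) (L : ℝ) (p : ℝ × E) (τ : ℝ) :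
    Prop where
  bound : |τ| ≤ L * |p.1|
  fixed : (ψ (p.1, p.2, p.1⁻¹ • χ (p.2, τ))).2 = τ

theorem tendsto_const_mul_abs_fst (c : ℝ) :
    Tendsto (fun p : ℝ × E => c * |p.1|) (𝓝 (0, u₀)) (𝓝 0) :=
  Continuous.tendsto' (by fun_prop) _ _ (by simp)

theorem tendsto_snd_nhds_prod : Tendsto (fun p : ℝ × E => p.2) (𝓝 (0, u₀)) (𝓝 u₀) :=
  Continuous.tendsto' (by fun_prop) _ _ rfl

theorem norm_inv_smul_le_of_cubic {c ε : ℝ} {y : E} (h : ‖y‖ ≤ c * |ε| ^ 3) :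
    ‖ε⁻¹ • y‖ ≤ c * |ε| ^ 2 := by
  by_cases hε : ε = 0
  · simp [hε]
  · rw [norm_smul, norm_inv, Real.norm_eq_abs]
    have : 0 < |ε| := abs_pos.2 hε
    calc |ε|⁻¹ * ‖y‖ ≤ |ε|⁻¹ * (c * |ε| ^ 3) := by gcongr
      _ = c * |ε| ^ 2 := by field_simp

theorem IsDissipationTerm.eventually_norm_le (hχ : IsDissipationTerm χ u₀ K) (L : ℝ) :
    ∀ᶠ p : ℝ × E in 𝓝 (0, u₀), ∀ t, |t| ≤ L * |p.1| →
      ‖p.1⁻¹ • χ (p.2, t)‖ ≤ K * L ^ 3 * |p.1| ^ 2 := by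
  filter_upwards [hχ.eventually_cubic tendsto_snd_nhds_prod (tendsto_const_mul_abs_fst L)]
    with p hp t ht
  exact norm_inv_smul_le_of_cubic ((hp t ht).trans_eq (by ring))

theorem IsShockResolution.exists_isShockSpeed (hψ : IsShockResolution G Z lam r u₀ L ψ)
    (hχ : IsDissipationTerm χ u₀ K) :
    ∃ τ : ℝ × E → ℝ, ∀ᶠ p in 𝓝 (0, u₀), IsShockSpeed ψ χ L p (τ p) ∧
      ∀ t, IsShockSpeed ψ χ L p t → t = τ p := by
  have hL := hψ.pos
  have hK := hχ.pos
  suffices H : ∀ᶠ p : ℝ × E in 𝓝 (0, u₀), ∃ τ, IsShockSpeed ψ χ L p τ ∧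
      ∀ t, IsShockSpeed ψ χ L p t → t = τ by
    classical
    refine ⟨fun p => if h : ∃ τ, IsShockSpeed ψ χ L p τ ∧
      ∀ t, IsShockSpeed ψ χ L p t → t = τ then h.choose else 0, ?_⟩
    filter_upwards [H] with p hp
    rw [dif_pos hp]
    exact hp.choose_spec
  obtain ⟨ρ, hρ, hlip⟩ := Metric.eventually_nhds_iff_ball.1 hψ.lipschitz
  have hsm : ∀ᶠ p : ℝ × E in 𝓝 (0, u₀), K * L ^ 3 * |p.1| < 1 / 2 :=
    (tendsto_const_mul_abs_fst _).eventually (gt_mem_nhds (by norm_num))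
  have hε : ∀ᶠ p : ℝ × E in 𝓝 (0, u₀), 1 * |p.1| < ρ :=
    (tendsto_const_mul_abs_fst _).eventually (gt_mem_nhds hρ)
  filter_upwards [eventually_forall_abs_le tendsto_snd_nhds_prod (tendsto_const_mul_abs_fst L)
    hχ.lipschitz, hχ.eventually_norm_le L, hsm, hε,
    tendsto_snd_nhds_prod.eventually (Metric.ball_mem_nhds u₀ hρ),
    tendsto_snd_nhds_prod.eventually hψ.speed_zero] with p h1 h2 h3 h4 h5 h6
  obtain ⟨ε, u⟩ := p
  simp only [one_mul] at h1 h2 h3 h4 h5 h6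
  have hy : ∀ t, |t| ≤ L * |ε| → ‖ε⁻¹ • χ (u, t)‖ ≤ |ε| := fun t ht => by
    refine (h2 t ht).trans ?_
    have : K * L ^ 3 * |ε| ^ 2 = (K * L ^ 3 * |ε|) * |ε| := by ring
    rw [this]
    exact mul_le_of_le_one_left (abs_nonneg _) (by linarith)
  have hmem : ∀ y : E, ‖y‖ ≤ |ε| → (ε, u, y) ∈ Metric.ball ((0 : ℝ), u₀, (0 : E)) ρ := by
    intro y hy
    rw [← ball_prod_same, ← ball_prod_same]
    exact ⟨by simpa using h4, h5, by simpa using hy.trans_lt h4⟩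
  have hmem0 : ((0 : ℝ), u, (0 : E)) ∈ Metric.ball ((0 : ℝ), u₀, (0 : E)) ρ := by
    rw [← ball_prod_same, ← ball_prod_same]
    exact ⟨by simpa using hρ, h5, by simpa using hρ⟩
  have hlip' : ∀ x x', x ∈ Metric.ball ((0 : ℝ), u₀, (0 : E)) ρ →
      x' ∈ Metric.ball ((0 : ℝ), u₀, (0 : E)) ρ →
      |(ψ x).2 - (ψ x').2| ≤ L * ‖x - x'‖ := fun x x' hx hx' =>
    (norm_snd_le (ψ x - ψ x')).trans (hlip (x, x') (by rw [← ball_prod_same]; exact ⟨hx, hx'⟩))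
  have hcontr : ∀ t t', |t| ≤ L * |ε| → |t'| ≤ L * |ε| →
      |(ψ (ε, u, ε⁻¹ • χ (u, t))).2 - (ψ (ε, u, ε⁻¹ • χ (u, t'))).2| ≤ 1 / 2 * |t - t'| := by
    intro t t' ht ht'
    refine (hlip' _ _ (hmem _ (hy t ht)) (hmem _ (hy t' ht'))).trans ?_
    have h7 : ‖((ε, u, ε⁻¹ • χ (u, t)) - (ε, u, ε⁻¹ • χ (u, t')) : ℝ × E × E)‖
        = |ε|⁻¹ * ‖χ (u, t) - χ (u, t')‖ := by
      simp [Prod.norm_def, ← smul_sub, norm_smul]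
      positivity
    rw [h7]
    by_cases hε0 : ε = 0
    · simp [hε0]
    have hε1 : 0 < |ε| := abs_pos.2 hε0
    calc L * (|ε|⁻¹ * ‖χ (u, t) - χ (u, t')‖)
        ≤ L * (|ε|⁻¹ * (K * (L * |ε|) ^ 2 * |t - t'|)) := by
          gcongr
          refine (h1 t t' ht ht').trans ?_
          gcongr
          exact max_le ht ht'
      _ = (K * L ^ 3 * |ε|) * |t - t'| := by field_simp
      _ ≤ 1 / 2 * |t - t'| := by gcongr
  have hself : ∀ t, |t| ≤ L * |ε| → |(ψ (ε, u, ε⁻¹ • χ (u, t))).2| ≤ L * |ε| := by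
    intro t ht
    have h7 := hlip' _ _ (hmem _ (hy t ht)) hmem0
    rw [h6, sub_zero] at h7
    refine h7.trans ?_
    gcongr
    simp only [Prod.mk_sub_mk, sub_zero, sub_self, Prod.norm_def, Real.norm_eq_abs, norm_zero]
    exact max_le le_rfl (max_le (abs_nonneg _) (hy t ht))
  have hLε : 0 ≤ L * |ε| := by positivity
  obtain ⟨τ, hτ, hfix⟩ := exists_mem_Icc_isFixedPt_of_mapsTo
    (f := fun t => (ψ (ε, u, ε⁻¹ • χ (u, t))).2) (a := -(L * |ε|)) (b := L * |ε|)
    (by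
      refine LipschitzOnWith.continuousOn (K := 1 / 2) (LipschitzOnWith.of_dist_le_mul ?_)
      intro t ht t' ht'
      simpa [Real.dist_eq] using hcontr t t' (abs_le.2 ht) (abs_le.2 ht'))
    (by linarith) (fun t ht => abs_le.1 (hself t (abs_le.2 ht)))
  refine ⟨τ, ⟨abs_le.2 hτ, hfix⟩, fun t ht => ?_⟩
  have h7 := hcontr t τ ht.bound (abs_le.2 hτ)
  have h8 : (ψ (ε, u, ε⁻¹ • χ (u, τ))).2 = τ := hfix
  have h9 := ht.fixed
  simp only at h9
  rw [h8, h9] at h7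
  have : |t - τ| = 0 := le_antisymm (by linarith [abs_nonneg (t - τ)]) (abs_nonneg _)
  linarith [abs_eq_zero.1 this]

end ShockCurve

section ShockCurveRegularity

variable {E : Type*} [NormedAddCommGroup E] [NormedSpace ℝ E]
  {G Z : E → E} {lam : E → ℝ} {r : E → E} {u₀ : E} {L K : ℝ} {ψ : ℝ × E × E → E × ℝ}
  {χ : E × ℝ → E} {τ : ℝ × E → ℝ}

/-- The argument of the shock resolution along the shock curve. -/
noncomputable def shockArg (χ : E × ℝ → E) (τ : ℝ × E → ℝ) (p : ℝ × E) : ℝ × E × E :=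
  (p.1, p.2, p.1⁻¹ • χ (p.2, τ p))

/-- The right state of the shock of strength `p.1` with left state `p.2`. -/
noncomputable def shockState (ψ : ℝ × E × E → E × ℝ) (χ : E × ℝ → E) (τ : ℝ × E → ℝ)
    (p : ℝ × E) : E :=
  p.2 + p.1 • (ψ (shockArg χ τ p)).1

theorem shockState_zero (u : E) : shockState ψ χ τ (0, u) = u := by simp [shockState]

theorem tendsto_shockArg (hχ : IsDissipationTerm χ u₀ K)
    (hτ : ∀ᶠ p in 𝓝 (0, u₀), IsShockSpeed ψ χ L p (τ p)) :
    Tendsto (shockArg χ τ) (𝓝 (0, u₀)) (𝓝 (0, u₀, 0)) := by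
  have h1 : Tendsto (fun p : ℝ × E => p.1⁻¹ • χ (p.2, τ p)) (𝓝 (0, u₀)) (𝓝 0) := by
    apply squeeze_zero_norm' (a := fun p : ℝ × E => K * L ^ 3 * |p.1| ^ 2)
    · filter_upwards [hχ.eventually_norm_le L, hτ] with p h1 h2 using h1 _ h2.bound
    · exact Continuous.tendsto' (by fun_prop) _ _ (by simp)
  exact (continuous_fst.tendsto' _ _ rfl).prodMk_nhds
    ((continuous_snd.tendsto' _ _ rfl).prodMk_nhds h1)

theorem norm_shockState_sub_le {p p' : ℝ × E} {c₁ δ : ℝ} (hp : |p'.1| ≤ |p.1|)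
    (hK : 0 < K) (hL : 0 < L)
    (hτ : IsShockSpeed ψ χ L p (τ p)) (hτ' : IsShockSpeed ψ χ L p' (τ p'))
    (hzero : χ (p.2, 0) = 0) (hzero' : χ (p'.2, 0) = 0)
    (hlip : ∀ t t', |t| ≤ L * |p.1| → |t'| ≤ L * |p.1| →
      ‖χ (p.2, t) - χ (p.2, t')‖ ≤ K * max |t| |t'| ^ 2 * |t - t'|)
    (hstrict : ‖χ (p.2, τ p') - χ (p'.2, τ p')‖ ≤ c₁ * ‖p - p'‖)
    (hψlip : ‖ψ (shockArg χ τ p) - ψ (shockArg χ τ p')‖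
      ≤ L * ‖shockArg χ τ p - shockArg χ τ p'‖)
    (hsmall : K * L ^ 3 * |p.1| ≤ 1 / 2) (hε : |p.1| ≤ δ)
    (hy : ‖p'.1⁻¹ • χ (p'.2, τ p')‖ ≤ δ) (hdir : ‖(ψ (shockArg χ τ p')).1 - r u₀‖ ≤ δ) :
    ‖shockState ψ χ τ p - shockState ψ χ τ p' - (p.2 - p'.2) - (p.1 - p'.1) • r u₀‖
      ≤ (δ + L * (4 * δ + 2 * c₁)) * ‖p - p'‖ := by
  have hmul : ∀ q : ℝ × E, IsShockSpeed ψ χ L q (τ q) → χ (q.2, 0) = 0 →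
      q.1 • q.1⁻¹ • χ (q.2, τ q) = χ (q.2, τ q) := by
    intro q hq hq0
    by_cases h : q.1 = 0
    · have : τ q = 0 := by simpa [h] using hq.bound
      simp [h, this, hq0]
    · rw [smul_inv_smul₀ h]
  have hm := hmul p hτ hzero
  have hm' := hmul p' hτ' hzero'
  set y := p.1⁻¹ • χ (p.2, τ p) with hydef
  set y' := p'.1⁻¹ • χ (p'.2, τ p') with hydef'
  set N := ‖p - p'‖ with hN
  set D := ‖y - y'‖ with hD
  set q := ‖χ (p.2, τ p) - χ (p'.2, τ p')‖ with hq
  set a := |p.1| with ha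
  have ha0 : 0 ≤ a := abs_nonneg _
  have hN0 : 0 ≤ N := norm_nonneg _
  have hD0 : 0 ≤ D := norm_nonneg _
  have hN1 : |p.1 - p'.1| ≤ N := norm_fst_le (p - p')
  have hN2 : ‖p.2 - p'.2‖ ≤ N := norm_snd_le (p - p')
  have hX : ‖shockArg χ τ p - shockArg χ τ p'‖ ≤ N + D := by
    simp only [shockArg, Prod.mk_sub_mk, Prod.norm_def, Real.norm_eq_abs]
    exact max_le (by linarith) (max_le (by linarith) (by linarith))
  have hψ1 : ‖ψ (shockArg χ τ p) - ψ (shockArg χ τ p')‖ ≤ L * (N + D) :=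
    hψlip.trans (by gcongr)
  have hττ : |τ p - τ p'| ≤ L * (N + D) := by
    have h1 : (ψ (shockArg χ τ p)).2 = τ p := hτ.fixed
    have h2 : (ψ (shockArg χ τ p')).2 = τ p' := hτ'.fixed
    rw [← h1, ← h2]
    exact (norm_snd_le _).trans hψ1
  have haD : a * D ≤ q + N * δ := by
    have h1 : p.1 • (y - y') = (χ (p.2, τ p) - χ (p'.2, τ p')) - (p.1 - p'.1) • y' := by
      rw [smul_sub, hm, sub_smul, hm']; abel
    have h2 : a * D = ‖p.1 • (y - y')‖ := by rw [norm_smul, Real.norm_eq_abs]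
    rw [h2, h1]
    refine (norm_sub_le _ _).trans ?_
    rw [norm_smul, Real.norm_eq_abs]
    gcongr
  have hqle : q ≤ K * L ^ 3 * a ^ 2 * (N + D) + c₁ * N := by
    have h1 := hlip (τ p) (τ p') hτ.bound (hτ'.bound.trans (by gcongr))
    have h2 : max |τ p| |τ p'| ≤ L * a := max_le hτ.bound (hτ'.bound.trans (by gcongr))
    calc q ≤ ‖χ (p.2, τ p) - χ (p.2, τ p')‖ + ‖χ (p.2, τ p') - χ (p'.2, τ p')‖ :=
          norm_sub_le_norm_sub_add_norm_sub _ _ _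
      _ ≤ K * (L * a) ^ 2 * (L * (N + D)) + c₁ * N := by
          refine add_le_add (h1.trans ?_) hstrict
          gcongr
      _ = _ := by ring
  have hqle2 : K * L ^ 3 * a ^ 2 * (N + D) ≤ 1 / 2 * (a * N + a * D) := by
    calc K * L ^ 3 * a ^ 2 * (N + D) = (K * L ^ 3 * a) * (a * N + a * D) := by ring
      _ ≤ _ := by gcongr
  have haN : a * N ≤ N * δ := by rw [mul_comm]; gcongr
  have haD2 : a * D ≤ (3 * δ + 2 * c₁) * N := by nlinarith
  have key : shockState ψ χ τ p - shockState ψ χ τ p' - (p.2 - p'.2) - (p.1 - p'.1) • r u₀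
      = (p.1 - p'.1) • ((ψ (shockArg χ τ p')).1 - r u₀)
        + p.1 • ((ψ (shockArg χ τ p)).1 - (ψ (shockArg χ τ p')).1) := by
    simp only [shockState]; module
  rw [key]
  refine (norm_add_le _ _).trans ?_
  rw [norm_smul, norm_smul, Real.norm_eq_abs, Real.norm_eq_abs, ← ha]
  have h3 : ‖(ψ (shockArg χ τ p)).1 - (ψ (shockArg χ τ p')).1‖ ≤ L * (N + D) :=
    (norm_fst_le _).trans hψ1
  calc |p.1 - p'.1| * ‖(ψ (shockArg χ τ p')).1 - r u₀‖
        + a * ‖(ψ (shockArg χ τ p)).1 - (ψ (shockArg χ τ p')).1‖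
      ≤ N * δ + a * (L * (N + D)) := by gcongr
    _ = N * δ + L * (a * N + a * D) := by ring
    _ ≤ N * δ + L * (N * δ + (3 * δ + 2 * c₁) * N) := by gcongr
    _ = _ := by ring

theorem IsShockResolution.hasStrictFDerivAt_shockState
    (hψ : IsShockResolution G Z lam r u₀ L ψ) (hχ : IsDissipationTerm χ u₀ K)
    (hτ : ∀ᶠ p in 𝓝 (0, u₀), IsShockSpeed ψ χ L p (τ p)) :
    HasStrictFDerivAt (shockState ψ χ τ)
      ((ContinuousLinearMap.fst ℝ ℝ E).smulRight (r u₀) + ContinuousLinearMap.snd ℝ ℝ E)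
      (0, u₀) := by
  have hL := hψ.pos
  have hX := tendsto_shockArg hχ hτ
  rw [hasStrictFDerivAt_iff_isLittleO, Asymptotics.isLittleO_iff]
  intro c hc
  obtain ⟨δ, hδ, hδc⟩ : ∃ δ > 0, δ + L * (4 * δ + 2 * δ) ≤ c := by
    refine ⟨c / (1 + 6 * L), by positivity, le_of_eq ?_⟩
    field_simp; ring
  have hone : ∀ᶠ p : ℝ × E in 𝓝 (0, u₀), K * L ^ 3 * |p.1| ≤ 1 / 2 ∧ |p.1| ≤ δ ∧
      ‖p.1⁻¹ • χ (p.2, τ p)‖ ≤ δ ∧ ‖(ψ (shockArg χ τ p)).1 - r u₀‖ ≤ δ ∧ χ (p.2, 0) = 0 ∧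
      IsShockSpeed ψ χ L p (τ p) ∧ (∀ t t', |t| ≤ L * |p.1| → |t'| ≤ L * |p.1| →
      ‖χ (p.2, t) - χ (p.2, t')‖ ≤ K * max |t| |t'| ^ 2 * |t - t'|) := by
    have h1 : ∀ᶠ p : ℝ × E in 𝓝 (0, u₀), K * L ^ 3 * |p.1| < 1 / 2 :=
      (tendsto_const_mul_abs_fst _).eventually (gt_mem_nhds (by norm_num))
    have h2 : ∀ᶠ p : ℝ × E in 𝓝 (0, u₀), 1 * |p.1| < δ :=
      (tendsto_const_mul_abs_fst _).eventually (gt_mem_nhds hδ)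
    have h3 : ∀ᶠ p : ℝ × E in 𝓝 (0, u₀), ‖(shockArg χ τ p).2.2‖ < δ :=
      (by simpa using hX.snd_nhds.snd_nhds.norm :
        Tendsto (fun p => ‖(shockArg χ τ p).2.2‖) (𝓝 (0, u₀)) (𝓝 0)).eventually (gt_mem_nhds hδ)
    have h4 : ∀ᶠ p : ℝ × E in 𝓝 (0, u₀), ‖(ψ (shockArg χ τ p)).1 - r u₀‖ < δ := by
      have h5 := (hψ.continuousAt.tendsto.comp hX).fst_nhds
      rw [hψ.base] at h5
      have h6 := (h5.sub_const (r u₀)).norm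
      rw [sub_self, norm_zero] at h6
      exact h6.eventually (gt_mem_nhds hδ)
    filter_upwards [h1, h2, h3, h4, tendsto_snd_nhds_prod.eventually hχ.zero, hτ,
      eventually_forall_abs_le tendsto_snd_nhds_prod (tendsto_const_mul_abs_fst L) hχ.lipschitz]
      with p h1 h2 h3 h4 h5 h6 h7
    exact ⟨h1.le, by linarith, h3.le, h4.le, h5, h6, h7⟩
  have htwo : ∀ᶠ x : (ℝ × E) × (ℝ × E) in 𝓝 ((0, u₀), (0, u₀)),
      ‖ψ (shockArg χ τ x.1) - ψ (shockArg χ τ x.2)‖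
        ≤ L * ‖shockArg χ τ x.1 - shockArg χ τ x.2‖ ∧
      ‖χ (x.1.2, τ x.2) - χ (x.2.2, τ x.2)‖ ≤ δ * ‖x.1 - x.2‖ := by
    have hτ0 : Tendsto τ (𝓝 (0, u₀)) (𝓝 0) := by
      apply squeeze_zero_norm' _ (tendsto_const_mul_abs_fst L)
      filter_upwards [hτ] with p hp using hp.bound
    have hs := hχ.strict
    rw [hasStrictFDerivAt_iff_isLittleO, Asymptotics.isLittleO_iff] at hs
    have hf : Tendsto (fun x : (ℝ × E) × (ℝ × E) => x.1) (𝓝 ((0, u₀), (0, u₀))) (𝓝 (0, u₀)) :=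
      continuous_fst.tendsto' _ _ rfl
    have hg : Tendsto (fun x : (ℝ × E) × (ℝ × E) => x.2) (𝓝 ((0, u₀), (0, u₀))) (𝓝 (0, u₀)) :=
      continuous_snd.tendsto' _ _ rfl
    have h1 : Tendsto (fun x : (ℝ × E) × (ℝ × E) => (shockArg χ τ x.1, shockArg χ τ x.2))
        (𝓝 ((0, u₀), (0, u₀))) (𝓝 ((0, u₀, 0), (0, u₀, 0))) :=
      (hX.comp hf).prodMk_nhds (hX.comp hg)
    have h2 : Tendsto (fun x : (ℝ × E) × (ℝ × E) => ((x.1.2, τ x.2), (x.2.2, τ x.2)))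
        (𝓝 ((0, u₀), (0, u₀))) (𝓝 ((u₀, 0), (u₀, 0))) :=
      (hf.snd_nhds.prodMk_nhds (hτ0.comp hg)).prodMk_nhds (hg.snd_nhds.prodMk_nhds (hτ0.comp hg))
    filter_upwards [h1.eventually hψ.lipschitz, h2.eventually (hs hδ)] with x hx1 hx2
    refine ⟨hx1, ?_⟩
    simp only [zero_apply, sub_zero, Prod.mk_sub_mk, sub_self] at hx2
    refine hx2.trans ?_
    gcongr
    rw [Prod.norm_def, Prod.norm_def]
    simp
  have hswap : Tendsto (Prod.swap : (ℝ × E) × (ℝ × E) → _) (𝓝 ((0, u₀), (0, u₀)))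
      (𝓝 ((0, u₀), (0, u₀))) := continuous_swap.tendsto' _ _ rfl
  have hest : ∀ᶠ x : (ℝ × E) × (ℝ × E) in 𝓝 ((0, u₀), (0, u₀)), |x.2.1| ≤ |x.1.1| →
      ‖shockState ψ χ τ x.1 - shockState ψ χ τ x.2 - (x.1.2 - x.2.2) - (x.1.1 - x.2.1) • r u₀‖
        ≤ c * ‖x.1 - x.2‖ := by
    rw [nhds_prod_eq] at htwo ⊢
    filter_upwards [hone.prod_mk hone, htwo] with x ⟨h1, h2⟩ h3 hle
    obtain ⟨h1a, h1b, -, -, h1e, h1f, h1g⟩ := h1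
    obtain ⟨-, -, h2c, h2d, h2e, h2f, -⟩ := h2
    refine (norm_shockState_sub_le (δ := δ) (c₁ := δ) hle hχ.pos hL h1f h2f h1e h2e h1g h3.2 h3.1
      h1a h1b h2c h2d).trans ?_
    gcongr
  filter_upwards [hest, hswap.eventually hest] with x h1 h2
  have key : shockState ψ χ τ x.1 - shockState ψ χ τ x.2
      - ((ContinuousLinearMap.fst ℝ ℝ E).smulRight (r u₀) + ContinuousLinearMap.snd ℝ ℝ E)
        (x.1 - x.2)
      = shockState ψ χ τ x.1 - shockState ψ χ τ x.2 - (x.1.2 - x.2.2)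
        - (x.1.1 - x.2.1) • r u₀ := by
    simp; abel
  rw [key]
  rcases le_total |x.2.1| |x.1.1| with h | h
  · exact h1 h
  · have h3 := h2 h
    simp only [Prod.fst_swap, Prod.snd_swap] at h3
    rw [norm_sub_rev x.2 x.1, ← norm_neg] at h3
    refine le_of_eq_of_le (congrArg _ ?_) h3
    module

end ShockCurveRegularity

section ShockCurveMain

variable {E : Type*} [NormedAddCommGroup E] [NormedSpace ℝ E]
  {G Z : E → E} {lam : E → ℝ} {r : E → E} {u₀ : E} {L K : ℝ} {ψ : ℝ × E × E → E × ℝ}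
  {χ : E × ℝ → E} {τ : ℝ × E → ℝ}

theorem IsShockResolution.eventually_shockSpeed_approx
    (hψ : IsShockResolution G Z lam r u₀ L ψ) (hχ : IsDissipationTerm χ u₀ K)
    (hτ : ∀ᶠ p in 𝓝 (0, u₀), IsShockSpeed ψ χ L p (τ p)) :
    ∀ᶠ p in 𝓝 (0, u₀), |τ p - p.1 / 2| ≤ 1 / 4 * |p.1| := by
  have hL := hψ.pos
  have h1 : ∀ᶠ p : ℝ × E in 𝓝 (0, u₀), L * (K * L ^ 3) * |p.1| < 1 / 8 :=
    (tendsto_const_mul_abs_fst _).eventually (gt_mem_nhds (by norm_num))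
  filter_upwards [h1, hτ, hχ.eventually_norm_le L,
    (tendsto_shockArg hχ hτ).eventually (hψ.speed_approx (1 / 8) (by norm_num))] with p h1 h2 h3 h4
  have h5 : (ψ (shockArg χ τ p)).2 = τ p := h2.fixed
  rw [h5] at h4
  have h6 := h3 _ h2.bound
  simp only [shockArg] at h4
  calc |τ p - p.1 / 2| ≤ 1 / 8 * |p.1| + L * (K * L ^ 3 * |p.1| ^ 2) := h4.trans (by gcongr)
    _ = 1 / 8 * |p.1| + (L * (K * L ^ 3) * |p.1|) * |p.1| := by ring
    _ ≤ 1 / 8 * |p.1| + 1 / 8 * |p.1| := by gcongr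
    _ = _ := by ring

theorem IsShockResolution.eventually_rankineHugoniot
    (hψ : IsShockResolution G Z lam r u₀ L ψ) (hχ : IsDissipationTerm χ u₀ K)
    (hτ : ∀ᶠ p in 𝓝 (0, u₀), IsShockSpeed ψ χ L p (τ p)) :
    ∀ᶠ p in 𝓝 (0, u₀), G (shockState ψ χ τ p) - G p.2
      - (lam p.2 + τ p) • (Z (shockState ψ χ τ p) - Z p.2) = χ (p.2, τ p) := by
  have hX := tendsto_shockArg hχ hτ
  have h1 : Tendsto (fun p => (shockArg χ τ p, ψ (shockArg χ τ p))) (𝓝 (0, u₀))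
      (𝓝 ((0, u₀, 0), (r u₀, 0))) := by
    refine hX.prodMk_nhds ?_
    have := hψ.continuousAt.tendsto.comp hX
    rwa [hψ.base] at this
  filter_upwards [h1.eventually hψ.solve, hτ, tendsto_snd_nhds_prod.eventually hχ.zero]
    with p h1 h2 h3
  have h4 := (h1.2 rfl).1
  have h5 : (ψ (shockArg χ τ p)).2 = τ p := h2.fixed
  simp only [h5] at h4
  have h6 := congrArg (p.1 • ·) h4
  simp only [shockArg, smul_sub] at h6
  rw [smul_comm p.1 (lam p.2 + τ p), smul_dividedDiff, smul_dividedDiff] at h6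
  have h7 : p.1 • p.1⁻¹ • χ (p.2, τ p) = χ (p.2, τ p) := by
    by_cases h : p.1 = 0
    · have : τ p = 0 := by simpa [h] using h2.bound
      simp [h, this, h3]
    · rw [smul_inv_smul₀ h]
  rw [h7] at h6
  exact h6

theorem CharacteristicField.exists_norm_sub_le [FiniteDimensional ℝ E]
    (h : CharacteristicField G Z lam r u₀) :
    ∃ C > 0, ∀ x : E, ‖x - fderiv ℝ lam u₀ x • r u₀‖
      ≤ C * ‖fderiv ℝ G u₀ x - lam u₀ • fderiv ℝ Z u₀ x‖ := by
  let M : E →L[ℝ] E × ℝ :=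
    (fderiv ℝ G u₀ - lam u₀ • fderiv ℝ Z u₀).prod (fderiv ℝ lam u₀)
  have hM : LinearMap.ker (M : E →ₗ[ℝ] E × ℝ) = ⊥ := by
    rw [LinearMap.ker_eq_bot']
    intro x hx
    have hx' : (fderiv ℝ G u₀ x - lam u₀ • fderiv ℝ Z u₀ x, fderiv ℝ lam u₀ x) = (0, 0) := hx
    rw [Prod.mk.injEq] at hx'
    obtain ⟨-, a, rfl⟩ := h.simple x 0 (by rw [hx'.1, zero_smul])
    have : a = 0 := by simpa [h.normalized] using hx'.2
    simp [this]
  obtain ⟨C, hC, hanti⟩ := (M : E →ₗ[ℝ] E × ℝ).exists_antilipschitzWith hM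
  refine ⟨C, hC, fun x => ?_⟩
  have h1 := hanti.le_mul_dist (x - fderiv ℝ lam u₀ x • r u₀) 0
  rw [dist_zero_right, map_zero, dist_zero_right] at h1
  refine h1.trans_eq ?_
  have h2 : (M : E →ₗ[ℝ] E × ℝ) (x - fderiv ℝ lam u₀ x • r u₀)
      = (fderiv ℝ G u₀ x - lam u₀ • fderiv ℝ Z u₀ x, 0) := by
    change M _ = _
    simp only [M, ContinuousLinearMap.prod_apply, map_sub, map_smul, h.normalized, sub_apply,
      smul_apply]
    rw [h.eigen.self_of_nhds, sub_self]
    simp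
  rw [h2]
  simp [Prod.norm_def]

theorem HasStrictFDerivAt.eventually_norm_le {F F' : Type*} [NormedAddCommGroup F]
    [NormedSpace ℝ F] [NormedAddCommGroup F'] [NormedSpace ℝ F'] {f : F → F'} {f' : F →L[ℝ] F'}
    {x : F} (hf : HasStrictFDerivAt f f' x) {c : ℝ} (hc : 0 < c) :
    ∀ᶠ q : F × F in 𝓝 (x, x), ‖f q.2 - f q.1 - f' (q.2 - q.1)‖ ≤ c * ‖q.2 - q.1‖ := by
  rw [hasStrictFDerivAt_iff_isLittleO, Asymptotics.isLittleO_iff] at hf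
  exact (continuous_swap.tendsto' (x, x) (x, x) rfl).eventually (hf hc)

theorem CharacteristicField.eventually_norm_jump_le [FiniteDimensional ℝ E]
    (h : CharacteristicField G Z lam r u₀) (hχ : IsDissipationTerm χ u₀ K) {c : ℝ} (hc : 0 < c) :
    ∃ B > 0, ∀ᶠ q : E × E in 𝓝 (u₀, u₀), ∀ t : ℝ, lam q.2 < lam q.1 + t → t < 0 →
      G q.2 - G q.1 - (lam q.1 + t) • (Z q.2 - Z q.1) = χ (q.1, t) →
      |t| ≤ B * ‖q.2 - q.1‖ ∧ ‖χ (q.1, t)‖ ≤ K * (B * ‖q.2 - q.1‖) ^ 3 ∧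
      ‖(q.2 - q.1) - fderiv ℝ lam u₀ (q.2 - q.1) • r u₀‖ ≤ c * ‖q.2 - q.1‖ := by
  have hK := hχ.pos
  obtain ⟨C, hC, hCle⟩ := h.exists_norm_sub_le
  have hG := (h.contDiff_flux.hasStrictFDerivAt (by norm_num))
  have hZ := (h.contDiff_density.hasStrictFDerivAt (by norm_num))
  set B := ‖fderiv ℝ lam u₀‖ + 1 with hB
  set BZ := ‖fderiv ℝ Z u₀‖ + 1 with hBZ
  have hBpos : 0 < B := by positivity
  have hBZpos : 0 < BZ := by positivity
  set c₁ := c / (C * (3 + BZ + |lam u₀|)) with hc₁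
  have hc₁pos : 0 < c₁ := by positivity
  have hfst : Tendsto (fun q : E × E => q.1) (𝓝 (u₀, u₀)) (𝓝 u₀) := continuous_fst.tendsto' _ _ rfl
  have hsnd : Tendsto (fun q : E × E => q.2) (𝓝 (u₀, u₀)) (𝓝 u₀) := continuous_snd.tendsto' _ _ rfl
  have hd : Tendsto (fun q : E × E => B * ‖q.2 - q.1‖) (𝓝 (u₀, u₀)) (𝓝 0) := by
    simpa using ((hsnd.sub hfst).norm).const_mul B
  have hd3 : ∀ᶠ q : E × E in 𝓝 (u₀, u₀), K * B ^ 3 * ‖q.2 - q.1‖ ^ 2 < c₁ := by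
    have : Tendsto (fun q : E × E => K * B ^ 3 * ‖q.2 - q.1‖ ^ 2) (𝓝 (u₀, u₀)) (𝓝 0) := by
      simpa using (((hsnd.sub hfst).norm).pow 2).const_mul (K * B ^ 3)
    exact this.eventually (gt_mem_nhds hc₁pos)
  have hlam : ∀ᶠ q : E × E in 𝓝 (u₀, u₀), |lam q.1 - lam u₀| + B * ‖q.2 - q.1‖ < c₁ := by
    have : Tendsto (fun q : E × E => |lam q.1 - lam u₀| + B * ‖q.2 - q.1‖) (𝓝 (u₀, u₀)) (𝓝 0) := by
      simpa using (((h.strict_speed.continuousAt.tendsto.comp hfst).sub_const (lam u₀)).abs).add hd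
    exact this.eventually (gt_mem_nhds hc₁pos)
  refine ⟨B, hBpos, ?_⟩
  filter_upwards [h.strict_speed.eventually_norm_le one_pos, hG.eventually_norm_le hc₁pos,
    hZ.eventually_norm_le hc₁pos, hZ.eventually_norm_le one_pos, hχ.eventually_cubic hfst hd,
    hd3, hlam] with q h1 h2 h3 h3' h4 h5 h6 t ht1 ht2 hRH
  set x := q.2 - q.1 with hx
  have hx0 := norm_nonneg x
  have ht : |t| ≤ B * ‖x‖ := by
    have h7 : |lam q.2 - lam q.1| ≤ B * ‖x‖ := by
      have h8 := norm_le_norm_sub_add (lam q.2 - lam q.1) (fderiv ℝ lam u₀ x)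
      have h9 := (fderiv ℝ lam u₀).le_opNorm x
      rw [Real.norm_eq_abs (lam q.2 - lam q.1)] at h8
      rw [hB, add_mul]
      linarith
    rw [abs_of_neg ht2]
    have := neg_abs_le (lam q.2 - lam q.1)
    linarith
  have hχt := h4 t ht
  refine ⟨ht, hχt, (hCle x).trans ?_⟩
  have hZx : ‖Z q.2 - Z q.1‖ ≤ BZ * ‖x‖ := by
    have h8 := norm_le_norm_sub_add (Z q.2 - Z q.1) (fderiv ℝ Z u₀ x)
    have h9 := (fderiv ℝ Z u₀).le_opNorm x
    rw [hBZ, add_mul]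
    linarith
  have key : fderiv ℝ G u₀ x - lam u₀ • fderiv ℝ Z u₀ x
      = χ (q.1, t) - (G q.2 - G q.1 - fderiv ℝ G u₀ x)
        + lam u₀ • (Z q.2 - Z q.1 - fderiv ℝ Z u₀ x)
        + (lam q.1 - lam u₀ + t) • (Z q.2 - Z q.1) := by
    rw [← hRH]; module
  have hbound : ‖fderiv ℝ G u₀ x - lam u₀ • fderiv ℝ Z u₀ x‖
      ≤ c₁ * (3 + BZ + |lam u₀|) * ‖x‖ := by
    rw [key]
    have e1 : ‖χ (q.1, t)‖ ≤ c₁ * ‖x‖ := by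
      refine hχt.trans ?_
      calc K * (B * ‖x‖) ^ 3 = (K * B ^ 3 * ‖x‖ ^ 2) * ‖x‖ := by ring
        _ ≤ _ := by gcongr
    have e2 : ‖lam u₀ • (Z q.2 - Z q.1 - fderiv ℝ Z u₀ x)‖ ≤ |lam u₀| * (c₁ * ‖x‖) := by
      rw [norm_smul, Real.norm_eq_abs]; gcongr
    have e3 : ‖(lam q.1 - lam u₀ + t) • (Z q.2 - Z q.1)‖ ≤ c₁ * (BZ * ‖x‖) := by
      rw [norm_smul, Real.norm_eq_abs]
      gcongr
      exact (abs_add_le _ _).trans (by linarith)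
    refine (norm_add₃_le).trans ?_
    have e4 := norm_sub_le (χ (q.1, t)) (G q.2 - G q.1 - fderiv ℝ G u₀ x)
    nlinarith [mul_nonneg hc₁pos.le hx0]
  calc C * ‖fderiv ℝ G u₀ x - lam u₀ • fderiv ℝ Z u₀ x‖
      ≤ C * (c₁ * (3 + BZ + |lam u₀|) * ‖x‖) := by gcongr
    _ = c * ‖x‖ := by rw [hc₁]; field_simp

theorem IsShockResolution.eventually_eq_shockState [FiniteDimensional ℝ E]
    (h : CharacteristicField G Z lam r u₀)
    (hψ : IsShockResolution G Z lam r u₀ L ψ) (hχ : IsDissipationTerm χ u₀ K)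
    (hτ : ∀ᶠ p in 𝓝 (0, u₀), IsShockSpeed ψ χ L p (τ p) ∧
      ∀ t, IsShockSpeed ψ χ L p t → t = τ p) :
    ∀ᶠ q : E × E in 𝓝 (u₀, u₀), ∀ t : ℝ, lam q.2 < lam q.1 + t → t < 0 →
      G q.2 - G q.1 - (lam q.1 + t) • (Z q.2 - Z q.1) = χ (q.1, t) →
      fderiv ℝ lam u₀ (q.2 - q.1) < 0 ∧
      q.2 = shockState ψ χ τ (fderiv ℝ lam u₀ (q.2 - q.1), q.1) ∧
      t = τ (fderiv ℝ lam u₀ (q.2 - q.1), q.1) := by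
  have hK := hχ.pos
  have hL := hψ.pos
  obtain ⟨ρ, hρ, hsolve⟩ := Metric.eventually_nhds_iff_ball.1 hψ.solve
  obtain ⟨ρ', hρ', hlip⟩ := Metric.eventually_nhds_iff_ball.1 hψ.lipschitz
  set R := ‖r u₀‖ + 1 with hR
  have hRpos : 0 < R := by positivity
  obtain ⟨c, hc, hc1, hc2⟩ : ∃ c > 0, c ≤ 1 / 2 ∧ c * (2 * R) < ρ :=
    ⟨min (1 / 2) (ρ / (4 * R)), by positivity, min_le_left _ _, by
      calc min (1 / 2) (ρ / (4 * R)) * (2 * R) ≤ ρ / (4 * R) * (2 * R) := by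
            gcongr; exact min_le_right _ _
        _ = ρ / 2 := by field_simp; norm_num
        _ < ρ := by linarith⟩
  obtain ⟨B, hB, hjump⟩ := h.eventually_norm_jump_le hχ hc
  have hfst : Tendsto (fun q : E × E => q.1) (𝓝 (u₀, u₀)) (𝓝 u₀) := continuous_fst.tendsto' _ _ rfl
  have hsnd : Tendsto (fun q : E × E => q.2) (𝓝 (u₀, u₀)) (𝓝 u₀) := continuous_snd.tendsto' _ _ rfl
  have hp : Tendsto (fun q : E × E => (fderiv ℝ lam u₀ (q.2 - q.1), q.1)) (𝓝 (u₀, u₀))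
      (𝓝 (0, u₀)) := Continuous.tendsto' (by fun_prop) _ _ (by simp)
  have hsmall : ∀ {b : ℝ}, 0 < b → ∀ a : ℝ,
      ∀ᶠ q : E × E in 𝓝 (u₀, u₀), a * |fderiv ℝ lam u₀ (q.2 - q.1)| < b := fun hb a =>
    hp.eventually ((tendsto_const_mul_abs_fst a).eventually (gt_mem_nhds hb))
  set M := K * (B * (2 * R)) ^ 3 with hM
  filter_upwards [hjump, hp.eventually hτ,
    hp.eventually (hψ.eventually_shockSpeed_approx hχ (hτ.mono fun _ h => h.1)),
    hsmall hρ 1, hsmall hρ' 1, hsmall one_pos M, hsmall hρ (B * (2 * R)),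
    hfst.eventually (Metric.ball_mem_nhds u₀ hρ), hfst.eventually (Metric.ball_mem_nhds u₀ hρ'),
    hfst.eventually hψ.speed_zero]
    with q h1 h2 h3 h4 h5 h6 h7 h8 h9 h10 t ht1 ht2 hRH
  obtain ⟨e1, e2, e3⟩ := h1 t ht1 ht2 hRH
  obtain ⟨a, b⟩ := q
  simp only at *
  set x := b - a with hx
  set ε := fderiv ℝ lam u₀ x with hε
  have hxle : ‖x‖ ≤ 2 * R * |ε| := by
    have f1 := norm_le_norm_sub_add x (ε • r u₀)
    rw [norm_smul, Real.norm_eq_abs] at f1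
    have f2 : |ε| * ‖r u₀‖ ≤ |ε| * R := by gcongr; linarith
    have f3 : c * ‖x‖ ≤ 1 / 2 * ‖x‖ := by gcongr
    linarith
  have hx0 : x ≠ 0 := by
    intro h0
    have : b = a := sub_eq_zero.1 h0
    rw [this] at ht1
    linarith
  have hε0 : ε ≠ 0 := by
    intro h0
    rw [h0, abs_zero, mul_zero] at hxle
    exact hx0 (norm_le_zero_iff.1 hxle)
  have hεpos : 0 < |ε| := abs_pos.2 hε0
  have ht : |t| ≤ B * (2 * R) * |ε| := e1.trans (by rw [mul_assoc]; gcongr)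
  have hy : ‖ε⁻¹ • χ (a, t)‖ ≤ |ε| := by
    refine (norm_inv_smul_le_of_cubic (c := M) (e2.trans ?_)).trans ?_
    · calc K * (B * ‖x‖) ^ 3 ≤ K * (B * (2 * R * |ε|)) ^ 3 := by gcongr
        _ = M * |ε| ^ 3 := by rw [hM]; ring
    · calc M * |ε| ^ 2 = (M * |ε|) * |ε| := by ring
        _ ≤ 1 * |ε| := by gcongr
        _ = |ε| := one_mul _
  have hd : ‖ε⁻¹ • x - r u₀‖ < ρ := by
    have f1 : ε⁻¹ • x - r u₀ = ε⁻¹ • (x - ε • r u₀) := by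
      rw [smul_sub ε⁻¹ x, inv_smul_smul₀ hε0]
    rw [f1, norm_smul, norm_inv, Real.norm_eq_abs]
    calc |ε|⁻¹ * ‖x - ε • r u₀‖ ≤ |ε|⁻¹ * (c * (2 * R * |ε|)) := by
          gcongr; exact e3.trans (by gcongr)
      _ = c * (2 * R) := by field_simp
      _ < ρ := hc2
  have hab : a + ε • ε⁻¹ • x = b := by rw [smul_inv_smul₀ hε0, hx]; abel
  have hres := hsolve ((ε, a, ε⁻¹ • χ (a, t)), (ε⁻¹ • x, t)) (by
    simp only [← ball_prod_same, mem_prod, Metric.mem_ball, dist_zero_right, Real.norm_eq_abs]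
    exact ⟨⟨by linarith, h8, by linarith⟩, by rwa [dist_eq_norm], ht.trans_lt h7⟩)
  have hψeq : ψ (ε, a, ε⁻¹ • χ (a, t)) = (ε⁻¹ • x, t) := by
    refine hres.1 ⟨?_, ?_⟩
    · simp only [dividedDiff, hε0, if_false, hab]
      rw [smul_comm (lam a + t), ← smul_sub, hRH]
    · simp [← hε, hε0]
  have hspeed : IsShockSpeed ψ χ L (ε, a) t := by
    refine ⟨?_, by simp [hψeq]⟩
    have f1 := hlip ((ε, a, ε⁻¹ • χ (a, t)), (0, a, 0)) (by
      simp only [← ball_prod_same, mem_prod, Metric.mem_ball, dist_zero_right, Real.norm_eq_abs]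
      exact ⟨⟨by linarith, h9, by linarith⟩, by simpa using hρ', h9, by simpa using hρ'⟩)
    have f2 := (norm_snd_le _).trans f1
    simp only [Prod.snd_sub, hψeq, h10, sub_zero, Real.norm_eq_abs] at f2
    refine f2.trans ?_
    gcongr
    simp only [Prod.mk_sub_mk, sub_zero, sub_self, Prod.norm_def, Real.norm_eq_abs, norm_zero]
    exact max_le le_rfl (max_le (abs_nonneg _) hy)
  have htτ := h2.2 t hspeed
  refine ⟨?_, ?_, htτ⟩
  · by_contra hneg
    have hpos : 0 < ε := lt_of_le_of_ne (not_lt.1 hneg) (Ne.symm hε0)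
    rw [← htτ, abs_of_pos hpos] at h3
    have := neg_abs_le (t - ε / 2)
    linarith
  · simp only [shockState, shockArg, ← htτ, hψeq, hab]

/-- The shock curve of a genuinely nonlinear field, with a cubically small dissipation term. The
strength of a shock is the linearized jump of the characteristic speed. -/
theorem CharacteristicField.exists_shockCurve [FiniteDimensional ℝ E]
    (h : CharacteristicField G Z lam r u₀) (hχ : IsDissipationTerm χ u₀ K) :
    ∃ (T : ℝ × E → E) (s : ℝ × E → ℝ),
      HasStrictFDerivAt T
        ((ContinuousLinearMap.fst ℝ ℝ E).smulRight (r u₀) + ContinuousLinearMap.snd ℝ ℝ E)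
        (0, u₀) ∧
      (∀ u, T (0, u) = u) ∧
      (∀ᶠ p in 𝓝 (0, u₀), G (T p) - G p.2 - s p • (Z (T p) - Z p.2) = χ (p.2, s p - lam p.2)) ∧
      (∀ᶠ p in 𝓝 (0, u₀), p.1 < 0 → lam (T p) < s p ∧ s p < lam p.2) ∧
      ∀ᶠ q : E × E in 𝓝 (u₀, u₀), ∀ σ : ℝ, lam q.2 < σ → σ < lam q.1 →
        G q.2 - G q.1 - σ • (Z q.2 - Z q.1) = χ (q.1, σ - lam q.1) →
        fderiv ℝ lam u₀ (q.2 - q.1) < 0 ∧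
        q.2 = T (fderiv ℝ lam u₀ (q.2 - q.1), q.1) ∧
        σ = s (fderiv ℝ lam u₀ (q.2 - q.1), q.1) := by
  obtain ⟨L, ψ, hψ⟩ := h.exists_isShockResolution
  obtain ⟨τ, hτ⟩ := hψ.exists_isShockSpeed hχ
  have hτ1 := hτ.mono fun _ h => h.1
  have hS := hψ.hasStrictFDerivAt_shockState hχ hτ1
  refine ⟨shockState ψ χ τ, fun p => lam p.2 + τ p, hS, shockState_zero, ?_, ?_, ?_⟩
  · filter_upwards [hψ.eventually_rankineHugoniot hχ hτ1] with p hp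
    rw [hp, add_sub_cancel_left]
  · have h0 : shockState ψ χ τ (0, u₀) = u₀ := shockState_zero u₀
    have hlS : HasStrictFDerivAt (fun p => lam (shockState ψ χ τ p)) _ (0, u₀) :=
      HasStrictFDerivAt.comp (0, u₀) (g := lam) (by rw [h0]; exact h.strict_speed) hS
    have ht : Tendsto (fun p : ℝ × E => (((0 : ℝ), p.2), p)) (𝓝 (0, u₀))
        (𝓝 ((0, u₀), (0, u₀))) := Continuous.tendsto' (by fun_prop) _ _ rfl
    filter_upwards [ht.eventually (hlS.eventually_norm_le (c := 1 / 8) (by norm_num)),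
      hψ.eventually_shockSpeed_approx hχ hτ1] with p h1 h2 hp
    simp only [shockState_zero] at h1
    have e1 : p - (0, p.2) = (p.1, 0) := by ext <;> simp
    have e2 : ‖((p.1, 0) : ℝ × E)‖ = |p.1| := by simp [Prod.norm_def]
    rw [e1, e2, Real.norm_eq_abs] at h1
    simp only [ContinuousLinearMap.comp_apply, add_apply,
      ContinuousLinearMap.smulRight_apply, ContinuousLinearMap.coe_fst',
      ContinuousLinearMap.coe_snd', add_zero, map_smul, h.normalized, smul_eq_mul, mul_one] at h1
    rw [abs_of_neg hp] at h1 h2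
    have e3 := abs_le.1 h1
    have e4 := abs_le.1 h2
    constructor <;> linarith [e3.1, e3.2, e4.1, e4.2]
  · filter_upwards [hψ.eventually_eq_shockState h hχ hτ] with q hq σ h1 h2 h3
    obtain ⟨e1, e2, e3⟩ := hq (σ - lam q.1) (by linarith) (by linarith)
      (by rw [add_sub_cancel]; exact h3)
    exact ⟨e1, e2, by linarith⟩

end ShockCurveMain

section LocalFlow

variable {E : Type*} [NormedAddCommGroup E] [NormedSpace ℝ E]

/-- The local flow of a `C¹` vector field `r` near `u₀`, as a function of time and initial state,
is strictly differentiable at `(0, u₀)`. -/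
theorem ContDiffAt.exists_strictFlow [CompleteSpace E] {r : E → E} {u₀ : E}
    (hr : ContDiffAt ℝ 1 r u₀) :
    ∃ T : ℝ × E → E,
      HasStrictFDerivAt T
        ((ContinuousLinearMap.fst ℝ ℝ E).smulRight (r u₀) + ContinuousLinearMap.snd ℝ ℝ E)
        (0, u₀) ∧
      (∀ᶠ u in 𝓝 u₀, T (0, u) = u) ∧
      ∀ᶠ p : ℝ × E in 𝓝 (0, u₀), HasDerivAt (fun ε => T (ε, p.2)) (r (T p)) p.1 := by
  obtain ⟨t₀, ht₀, a, ρ, L, K₀, hρ, hPL⟩ := IsPicardLindelof.of_contDiffAt_one hr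
  obtain ⟨α, hα, L', hL'⟩ :=
    (hPL 0).exists_forall_mem_closedBall_eq_hasDerivWithinAt_lipschitzOnWith
  simp only [zero_sub, zero_add] at hα hL'
  set T : ℝ × E → E := fun p => α p.2 p.1 with hT
  have hball : Metric.closedBall u₀ ρ ∈ 𝓝 u₀ := Metric.closedBall_mem_nhds _ (by exact_mod_cast hρ)
  have hIcc : Icc (-t₀) t₀ ∈ 𝓝 (0 : ℝ) := Icc_mem_nhds (by linarith) ht₀
  have hT0 : T (0, u₀) = u₀ := (hα u₀ (mem_of_mem_nhds hball)).1
  have hderiv : ∀ u ∈ Metric.closedBall u₀ (ρ : ℝ), ∀ t ∈ Ioo (-t₀) t₀,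
      HasDerivAt (fun t => T (t, u)) (r (T (t, u))) t := fun u hu t ht =>
    ((hα u hu).2 t (Ioo_subset_Icc_self ht)).hasDerivAt (Icc_mem_nhds ht.1 ht.2)
  have hcont : ContinuousAt T (0, u₀) := by
    have h1 : Tendsto (fun p : ℝ × E => (L' : ℝ) * ‖p.2 - u₀‖ + ‖T (p.1, u₀) - T (0, u₀)‖)
        (𝓝 (0, u₀)) (𝓝 0) := by
      have h2 : Tendsto (fun p : ℝ × E => T (p.1, u₀)) (𝓝 (0, u₀)) (𝓝 (T (0, u₀))) :=
        (hderiv u₀ (mem_of_mem_nhds hball) 0 ⟨by linarith, ht₀⟩).continuousAt.tendsto.comp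
          (continuous_fst.tendsto' _ _ rfl)
      have h3 : Tendsto (fun p : ℝ × E => p.2) (𝓝 (0, u₀)) (𝓝 u₀) :=
        continuous_snd.tendsto' _ _ rfl
      simpa using ((h3.sub_const u₀).norm.const_mul (L' : ℝ)).add (h2.sub_const (T (0, u₀))).norm
    rw [ContinuousAt, tendsto_iff_norm_sub_tendsto_zero]
    refine squeeze_zero' (Eventually.of_forall fun _ => norm_nonneg _) ?_ h1
    filter_upwards [prod_mem_nhds hIcc hball] with p hp
    refine (norm_sub_le_norm_sub_add_norm_sub _ (T (p.1, u₀)) _).trans ?_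
    gcongr
    exact (hL' p.1 hp.1).norm_sub_le hp.2 (mem_of_mem_nhds hball)
  obtain ⟨K, s, hs, hK⟩ := hr.exists_lipschitzOnWith
  refine ⟨T, ?_, ?_, ?_⟩
  · rw [hasStrictFDerivAt_iff_isLittleO, Asymptotics.isLittleO_iff]
    intro c hc
    have hrc : ∀ᶠ u in 𝓝 u₀, ‖r u - r u₀‖ < c / 2 := by
      have := (hr.continuousAt.tendsto.sub_const (r u₀)).norm
      rw [sub_self, norm_zero] at this
      exact this.eventually (gt_mem_nhds (by positivity))
    have hev : ∀ᶠ p : ℝ × E in 𝓝 (0, u₀), T p ∈ s ∧ ‖r (T p) - r u₀‖ < c / 2 ∧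
        p.1 ∈ Ioo (-t₀) t₀ ∧ p.2 ∈ Metric.closedBall u₀ (ρ : ℝ) ∧ K * L' * |p.1| < c / 2 := by
      have h1 := hcont.tendsto
      rw [hT0] at h1
      have h2 : Tendsto (fun p : ℝ × E => K * L' * |p.1|) (𝓝 (0, u₀)) (𝓝 0) :=
        Continuous.tendsto' (by fun_prop) _ _ (by simp)
      filter_upwards [h1.eventually hs, h1.eventually hrc,
        prod_mem_nhds (Ioo_mem_nhds (neg_lt_zero.2 ht₀) ht₀) hball,
        h2.eventually (gt_mem_nhds (show (0 : ℝ) < c / 2 by positivity))] with p h1 h2 h3 h4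
      exact ⟨h1, h2, h3.1, h3.2, h4⟩
    obtain ⟨δ, hδ, hδev⟩ := Metric.eventually_nhds_iff_ball.1 hev
    have hmem : Metric.ball ((0 : ℝ), u₀) δ ∈ 𝓝 ((0 : ℝ), u₀) := Metric.ball_mem_nhds _ hδ
    filter_upwards [prod_mem_nhds hmem hmem] with x hx
    obtain ⟨⟨ε, u⟩, ⟨ε', u'⟩⟩ := x
    simp only [← ball_prod_same, mem_prod] at hx
    obtain ⟨⟨hε, hu⟩, hε', hu'⟩ := hx
    simp only at hε hu hε' hu' ⊢
    have hseg : ∀ t ∈ Metric.ball (0 : ℝ) δ, ∀ v ∈ Metric.ball u₀ δ, T (t, v) ∈ s ∧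
        ‖r (T (t, v)) - r u₀‖ < c / 2 ∧ t ∈ Ioo (-t₀) t₀ ∧ v ∈ Metric.closedBall u₀ (ρ : ℝ) ∧
        K * L' * |t| < c / 2 := fun t ht v hv =>
      hδev (t, v) (by rw [← ball_prod_same]; exact ⟨ht, hv⟩)
    have h0 : (0 : ℝ) ∈ Metric.ball (0 : ℝ) δ := Metric.mem_ball_self hδ
    have hstate : ‖T (ε, u) - T (ε, u') - (u - u')‖ ≤ c / 2 * ‖u - u'‖ := by
      have h1 := (convex_uIcc (0 : ℝ) ε).norm_image_sub_le_of_norm_hasDerivWithin_le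
        (f := fun t => T (t, u) - T (t, u')) (f' := fun t => r (T (t, u)) - r (T (t, u')))
        (C := K * (L' * ‖u - u'‖)) (x := 0) (y := ε)
        (by
          intro t ht
          have ht' : t ∈ Metric.ball (0 : ℝ) δ :=
            ((convex_ball (0 : ℝ) δ).ordConnected.uIcc_subset h0 hε) ht
          obtain ⟨-, -, g3, g4, -⟩ := hseg t ht' u hu
          obtain ⟨-, -, -, g4', -⟩ := hseg t ht' u' hu'
          exact ((hderiv u g4 t g3).sub (hderiv u' g4' t g3)).hasDerivWithinAt)
        (by
          intro t ht
          have ht' : t ∈ Metric.ball (0 : ℝ) δ :=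
            ((convex_ball (0 : ℝ) δ).ordConnected.uIcc_subset h0 hε) ht
          obtain ⟨g1, -, g3, g4, -⟩ := hseg t ht' u hu
          obtain ⟨g1', -, -, g4', -⟩ := hseg t ht' u' hu'
          refine (hK.norm_sub_le g1 g1').trans ?_
          gcongr
          exact (hL' t (Ioo_subset_Icc_self g3)).norm_sub_le g4 g4')
        left_mem_uIcc right_mem_uIcc
      have e1 : T (0, u) = u := (hα u (hseg 0 h0 u hu).2.2.2.1).1
      have e2 : T (0, u') = u' := (hα u' (hseg 0 h0 u' hu').2.2.2.1).1
      rw [e1, e2, sub_zero, Real.norm_eq_abs] at h1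
      refine h1.trans ?_
      calc K * (L' * ‖u - u'‖) * |ε| = K * L' * |ε| * ‖u - u'‖ := by ring
        _ ≤ _ := by gcongr; exact (hseg ε hε u hu).2.2.2.2.le
    have htime : ‖T (ε, u') - T (ε', u') - (ε - ε') • r u₀‖ ≤ c / 2 * ‖ε - ε'‖ := by
      have h1 := (convex_uIcc ε' ε).norm_image_sub_le_of_norm_hasDerivWithin_le
        (f := fun t => T (t, u') - t • r u₀) (f' := fun t => r (T (t, u')) - (1 : ℝ) • r u₀)
        (C := c / 2) (x := ε') (y := ε)
        (by
          intro t ht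
          have ht' : t ∈ Metric.ball (0 : ℝ) δ :=
            ((convex_ball (0 : ℝ) δ).ordConnected.uIcc_subset hε' hε) ht
          obtain ⟨-, -, g3, g4, -⟩ := hseg t ht' u' hu'
          exact ((hderiv u' g4 t g3).sub ((hasDerivAt_id t).smul_const (r u₀))).hasDerivWithinAt)
        (by
          intro t ht
          have ht' : t ∈ Metric.ball (0 : ℝ) δ :=
            ((convex_ball (0 : ℝ) δ).ordConnected.uIcc_subset hε' hε) ht
          rw [one_smul]
          exact (hseg t ht' u' hu').2.1.le)
        left_mem_uIcc right_mem_uIcc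
      refine le_of_eq_of_le (congrArg _ ?_) h1
      module
    have key : T (ε, u) - T (ε', u')
        - ((ContinuousLinearMap.fst ℝ ℝ E).smulRight (r u₀) + ContinuousLinearMap.snd ℝ ℝ E)
          ((ε, u) - (ε', u'))
        = (T (ε, u) - T (ε, u') - (u - u')) + (T (ε, u') - T (ε', u') - (ε - ε') • r u₀) := by
      simp; abel
    rw [key]
    refine (norm_add_le _ _).trans ((add_le_add hstate htime).trans ?_)
    have e1 : ‖u - u'‖ ≤ ‖((ε, u) - (ε', u') : ℝ × E)‖ := norm_snd_le ((ε, u) - (ε', u'))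
    have e2 : ‖ε - ε'‖ ≤ ‖((ε, u) - (ε', u') : ℝ × E)‖ := norm_fst_le ((ε, u) - (ε', u'))
    nlinarith
  · filter_upwards [hball] with u hu using (hα u hu).1
  · filter_upwards [prod_mem_nhds (Ioo_mem_nhds (show -t₀ < 0 by linarith) ht₀) hball] with p hp
    exact hderiv p.2 hp.2 p.1 hp.1

end LocalFlow

section SimpleSpectrum

variable {E : Type*} [NormedAddCommGroup E] [NormedSpace ℝ E] [FiniteDimensional ℝ E] {N : ℕ}

theorem exists_basis_of_eigenvectors {f : Module.End ℝ E} (hN : Module.finrank ℝ E = N)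
    {μ : Fin N → ℝ} (hμ : Function.Injective μ) {v : Fin N → E}
    (hv : ∀ i, f.HasEigenvector (μ i) (v i)) :
    ∃ b : Module.Basis (Fin N) ℝ E, ∀ i, b i = v i := by
  have hli := Module.End.eigenvectors_linearIndependent' f μ hμ v hv
  refine ⟨basisOfLinearIndependentOfCardEqFinrank' v hli (by simp [hN]), fun i => by simp⟩

theorem Module.End.HasEigenvector.simple {f : Module.End ℝ E} (hN : Module.finrank ℝ E = N)
    {μ : Fin N → ℝ} (hμ : Function.Injective μ) (hev : ∀ i, f.HasEigenvalue (μ i)) {j : Fin N}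
    {v : E} (hv : f.HasEigenvector (μ j) v) {d : E} {c : ℝ} (h : f d - μ j • d = c • v) :
    c = 0 ∧ ∃ a : ℝ, d = a • v := by
  classical
  choose w hw using fun i => (hev i).exists_hasEigenvector
  obtain ⟨b, hb⟩ := exists_basis_of_eigenvectors hN hμ (v := Function.update w j v) (by
    intro i
    by_cases hij : i = j
    · subst hij; simpa using hv
    · simpa [hij] using hw i)
  have hbj : b j = v := by simp [hb]
  have hfb : ∀ i, f (b i) = μ i • b i := by
    intro i
    rw [hb]
    by_cases hij : i = j
    · subst hij; simpa using hv.apply_eq_smul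
    · simpa [hij] using (hw i).apply_eq_smul
  have hrepr : ∀ x i, b.repr (f x) i = μ i * b.repr x i := by
    intro x i
    have h1 : (b.coord i) ∘ₗ f = μ i • b.coord i := by
      refine b.ext fun k => ?_
      simp only [LinearMap.comp_apply, hfb, map_smul, LinearMap.smul_apply, Module.Basis.coord_apply,
        Module.Basis.repr_self, smul_eq_mul, Finsupp.single_apply]
      split_ifs with hki
      · rw [hki]
      · simp
    simpa using congrArg (fun l : E →ₗ[ℝ] ℝ => l x) h1
  have hcoord : ∀ i, (μ i - μ j) * b.repr d i = c * b.repr v i := by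
    intro i
    have := congrArg (fun x => b.repr x i) h
    simp only [map_sub, map_smul, Finsupp.sub_apply, Finsupp.smul_apply, hrepr, smul_eq_mul] at this
    rw [← this]; ring
  have hvj : b.repr v = Finsupp.single j 1 := by rw [← hbj, b.repr_self]
  have hc : c = 0 := by simpa [hvj] using (hcoord j).symm
  refine ⟨hc, b.repr d j, b.repr.injective ?_⟩
  ext i
  rw [map_smul, hvj]
  by_cases hij : i = j
  · subst hij; simp
  · have h1 := hcoord i
    rw [hc, zero_mul, mul_eq_zero, sub_eq_zero] at h1
    have h2 := h1.resolve_left (fun h => hij (hμ h))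
    simp [h2, Ne.symm hij]

theorem Module.End.HasEigenvalue.exists_eq {f : Module.End ℝ E} (hN : Module.finrank ℝ E = N)
    {μ : Fin N → ℝ} (hμ : Function.Injective μ) (hev : ∀ i, f.HasEigenvalue (μ i)) {ν : ℝ}
    (hν : f.HasEigenvalue ν) : ∃ i, μ i = ν := by
  by_contra! hne
  choose w hw using fun i => (hev i).exists_hasEigenvector
  obtain ⟨v, hv⟩ := hν.exists_hasEigenvector
  have hli := Module.End.eigenvectors_linearIndependent' f (fun o : Option (Fin N) => o.elim ν μ)
    (by
      rintro (_ | i) (_ | k) h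
      · rfl
      · exact absurd h.symm (hne k)
      · exact absurd h (hne i)
      · exact congrArg some (hμ h)) (fun o => o.elim v w)
    (by rintro (_ | i); exacts [hv, hw i])
  have := hli.fintype_card_le_finrank
  simp [hN] at this

theorem StrictMono.eq_of_hasEigenvalue {f : Module.End ℝ E} (hN : Module.finrank ℝ E = N)
    {μ ν : Fin N → ℝ} (hμ : StrictMono μ) (hν : StrictMono ν) (hμ' : ∀ i, f.HasEigenvalue (μ i))
    (hν' : ∀ i, f.HasEigenvalue (ν i)) : μ = ν := by
  rw [← hμ.range_inj hν]
  apply Subset.antisymm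
  · rintro _ ⟨i, rfl⟩
    exact (hμ' i).exists_eq hN hν.injective hν'
  · rintro _ ⟨i, rfl⟩
    exact (hν' i).exists_eq hN hμ.injective hμ'

/-- A simple eigenvalue and its eigenvector depend smoothly on the matrix. -/
theorem ContDiffAt.exists_eigenpair {A : E → E →L[ℝ] E} {u₀ : E} (hA : ContDiffAt ℝ ∞ A u₀)
    {μ₀ : ℝ} {r₀ : E} (hr₀ : r₀ ≠ 0) (heig : A u₀ r₀ = μ₀ • r₀)
    (hsimple : ∀ (d : E) (c : ℝ), A u₀ d - μ₀ • d = c • r₀ → c = 0 ∧ ∃ a : ℝ, d = a • r₀) :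
    ∃ (μ : E → ℝ) (r : E → E), ContDiffAt ℝ ∞ μ u₀ ∧ ContDiffAt ℝ ∞ r u₀ ∧ μ u₀ = μ₀ ∧
      r u₀ = r₀ ∧ ∀ᶠ u in 𝓝 u₀, A u (r u) = μ u • r u := by
  have : CompleteSpace E := FiniteDimensional.complete ℝ E
  obtain ⟨ℓ, hℓ⟩ : ∃ ℓ : E →L[ℝ] ℝ, ℓ r₀ = 1 := by
    obtain ⟨g, -, hg⟩ := exists_dual_vector ℝ r₀ (norm_ne_zero_iff.2 hr₀)
    refine ⟨‖r₀‖⁻¹ • g, ?_⟩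
    rw [smul_apply, hg]
    simp [hr₀]
  set f : E × (E × ℝ) → E × ℝ := fun q => (A q.1 q.2.1 - q.2.2 • q.2.1, ℓ q.2.1) with hf
  have hA' : ContDiffAt ℝ ∞ (fun q : E × (E × ℝ) => A q.1) (u₀, (r₀, μ₀)) :=
    ContDiffAt.comp (u₀, (r₀, μ₀)) (g := A) hA contDiffAt_fst
  have hfc : ContDiffAt ℝ ∞ f (u₀, (r₀, μ₀)) :=
    ((hA'.clm_apply (by fun_prop)).sub (by fun_prop)).prodMk (by fun_prop)
  have hpart : ∀ d c, (fderiv ℝ f (u₀, (r₀, μ₀))) (0, (d, c))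
      = (A u₀ d - (μ₀ • d + c • r₀), ℓ d) := by
    intro d c
    have h1 : HasFDerivAt (fun y : E × ℝ => f (u₀, y))
        ((fderiv ℝ f (u₀, (r₀, μ₀))).comp ((0 : E × ℝ →L[ℝ] E).prod
          (ContinuousLinearMap.id ℝ (E × ℝ)))) (r₀, μ₀) :=
      HasFDerivAt.comp (r₀, μ₀) (g := f) (f := fun y : E × ℝ => (u₀, y))
        (hfc.differentiableAt (by norm_num)).hasFDerivAt
        ((hasFDerivAt_const _ _).prodMk (hasFDerivAt_id _))
    have h2 := ((A u₀).hasFDerivAt.comp (r₀, μ₀) (hasFDerivAt_fst (𝕜 := ℝ) (E := E) (F := ℝ))).sub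
      ((hasFDerivAt_snd (𝕜 := ℝ) (p := (r₀, μ₀))).smul
        (hasFDerivAt_fst (𝕜 := ℝ) (p := (r₀, μ₀)))) |>.prodMk
      (ℓ.hasFDerivAt.comp (r₀, μ₀) (hasFDerivAt_fst (𝕜 := ℝ) (E := E) (F := ℝ)))
    have h3 := congrArg (fun l : E × ℝ →L[ℝ] E × ℝ => l (d, c)) (h1.unique h2)
    simpa using h3
  have hinv : (fderiv ℝ f (u₀, (r₀, μ₀)) ∘L .inr ℝ E (E × ℝ)).IsInvertible := by
    apply ContinuousLinearMap.isInvertible_of_injective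
    rw [injective_iff_map_eq_zero]
    rintro ⟨d, c⟩ hdc
    simp only [ContinuousLinearMap.comp_apply, ContinuousLinearMap.inr_apply, hpart,
      Prod.mk_eq_zero, sub_add_eq_sub_sub, sub_eq_zero] at hdc
    obtain ⟨rfl, a, rfl⟩ := hsimple d c hdc.1
    have : a = 0 := by simpa [hℓ] using hdc.2
    simp [this]
  set φ := hfc.implicitFunction (by norm_num) hinv with hφ
  have hφ1 : ContDiffAt ℝ ∞ φ u₀ := hfc.contDiffAt_implicitFunction (by norm_num) hinv
  have hφ0 : φ u₀ = (r₀, μ₀) := hfc.implicitFunction_apply_self (by norm_num) hinv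
  refine ⟨fun u => (φ u).2, fun u => (φ u).1, hφ1.snd, hφ1.fst, by simp [hφ0], by simp [hφ0], ?_⟩
  filter_upwards [hfc.eventually_apply_implicitFunction (by norm_num) hinv] with u hu
  have h1 := congrArg Prod.fst hu
  simp only [hf, heig, sub_self, ← hφ] at h1
  exact sub_eq_zero.1 h1

/-- In a strictly hyperbolic, genuinely nonlinear system, the characteristic speeds are smooth, and
there are smooth eigenvector fields `r` with `∇lam · r = 1`. -/
theorem exists_normalized_eigenvector {A : E → E →L[ℝ] E} {u₀ : E} (hA : ContDiffAt ℝ ∞ A u₀)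
    (hN : Module.finrank ℝ E = N) {lam : Fin N → E → ℝ}
    (hyp : ∀ᶠ u in 𝓝 u₀, StrictMono (fun j => lam j u) ∧
      ∀ j, Module.End.HasEigenvalue (A u : Module.End ℝ E) (lam j u))
    (gnl : ∀ j r, Module.End.HasEigenvector (A u₀ : Module.End ℝ E) (lam j u₀) r →
      fderiv ℝ (lam j) u₀ r ≠ 0) (j : Fin N) :
    ContDiffAt ℝ ∞ (lam j) u₀ ∧ ∃ r : E → E, ContDiffAt ℝ ∞ r u₀ ∧
      ∀ᶠ u in 𝓝 u₀, A u (r u) = lam j u • r u ∧ fderiv ℝ (lam j) u (r u) = 1 := by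
  obtain ⟨hmono, hev⟩ := hyp.self_of_nhds
  have hex : ∀ i, ∃ (μ : E → ℝ) (r : E → E), ContDiffAt ℝ ∞ μ u₀ ∧ ContDiffAt ℝ ∞ r u₀ ∧
      μ u₀ = lam i u₀ ∧ r u₀ ≠ 0 ∧ ∀ᶠ u in 𝓝 u₀, A u (r u) = μ u • r u := by
    intro i
    obtain ⟨v, hv⟩ := (hev i).exists_hasEigenvector
    obtain ⟨μ, r, h1, h2, h3, h4, h5⟩ := hA.exists_eigenpair (μ₀ := lam i u₀) hv.2
      hv.apply_eq_smul (fun d c h => hv.simple hN hmono.injective hev h)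
    exact ⟨μ, r, h1, h2, h3, h4 ▸ hv.2, h5⟩
  choose μ ρ hμ hρ hμ0 hρ0 heig using hex
  have hcont : ∀ i, ContinuousAt (μ i) u₀ := fun i => (hμ i).continuousAt
  have hmonoμ : ∀ᶠ u in 𝓝 u₀, StrictMono (fun i => μ i u) := by
    have : ∀ᶠ u in 𝓝 u₀, ∀ i k, i < k → μ i u < μ k u := by
      simp only [eventually_all]
      intro i k hik
      refine (hcont i).eventually_lt (hcont k) ?_
      rw [hμ0, hμ0]
      exact hmono hik
    exact this.mono fun u hu i k hik => hu i k hik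
  have heq : ∀ᶠ u in 𝓝 u₀, ∀ i, lam i u = μ i u := by
    filter_upwards [hyp, hmonoμ, eventually_all.2 heig,
      eventually_all.2 fun i => (hρ i).continuousAt.eventually_ne (hρ0 i)] with u h1 h2 h3 h4
    have := StrictMono.eq_of_hasEigenvalue hN h1.1 h2 h1.2 (fun i =>
      Module.End.hasEigenvalue_of_hasEigenvector (x := ρ i u)
        (Module.End.hasEigenvector_iff.2 ⟨Module.End.mem_eigenspace_iff.2 (h3 i), h4 i⟩))
    exact fun i => congrFun this i
  have hlam : ContDiffAt ℝ ∞ (lam j) u₀ :=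
    (hμ j).congr_of_eventuallyEq (heq.mono fun u hu => hu j)
  refine ⟨hlam, fun u => (fderiv ℝ (lam j) u (ρ j u))⁻¹ • ρ j u, ?_, ?_⟩
  all_goals
    have hne : fderiv ℝ (lam j) u₀ (ρ j u₀) ≠ 0 := by
      refine gnl j _ (Module.End.hasEigenvector_iff.2 ⟨Module.End.mem_eigenspace_iff.2 ?_, hρ0 j⟩)
      rw [← hμ0]
      exact (heig j).self_of_nhds
    have hd : ContDiffAt ℝ ∞ (fun u => fderiv ℝ (lam j) u (ρ j u)) u₀ :=
      (hlam.fderiv_right (by norm_num)).clm_apply (hρ j)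
  · exact (hd.inv hne).smul (hρ j)
  · filter_upwards [hd.continuousAt.eventually_ne hne, heig j, heq] with u h1 h2 h3
    refine ⟨?_, by simp [h1]⟩
    rw [map_smul, h2, h3, smul_comm]

end SimpleSpectrum

section WaveCurve

variable {E : Type*} [NormedAddCommGroup E] [NormedSpace ℝ E]

theorem HasStrictFDerivAt.piecewise_fst_neg {F : Type*} [NormedAddCommGroup F] [NormedSpace ℝ F]
    {T₁ T₂ : ℝ × E → F} {T' : ℝ × E →L[ℝ] F} {u₀ : E} (h₁ : HasStrictFDerivAt T₁ T' (0, u₀))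
    (h₂ : HasStrictFDerivAt T₂ T' (0, u₀)) (h : ∀ᶠ u in 𝓝 u₀, T₁ (0, u) = T₂ (0, u)) :
    HasStrictFDerivAt (fun p => open Classical in if p.1 < 0 then T₁ p else T₂ p) T' (0, u₀) := by
  rw [hasStrictFDerivAt_iff_isLittleO, Asymptotics.isLittleO_iff] at *
  intro c hc
  have hc2 : 0 < c / 2 := by positivity
  have hswap : Tendsto (Prod.swap : (ℝ × E) × (ℝ × E) → _) (𝓝 ((0, u₀), (0, u₀)))
      (𝓝 ((0, u₀), (0, u₀))) := continuous_swap.tendsto' _ _ rfl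
  have hmid1 : Tendsto (fun x : (ℝ × E) × (ℝ × E) => (x.1, ((0 : ℝ), x.1.2)))
      (𝓝 ((0, u₀), (0, u₀))) (𝓝 ((0, u₀), (0, u₀))) := Continuous.tendsto' (by fun_prop) _ _ rfl
  have hmid2 : Tendsto (fun x : (ℝ × E) × (ℝ × E) => (((0 : ℝ), x.1.2), x.2))
      (𝓝 ((0, u₀), (0, u₀))) (𝓝 ((0, u₀), (0, u₀))) := Continuous.tendsto' (by fun_prop) _ _ rfl
  have hu : Tendsto (fun x : (ℝ × E) × (ℝ × E) => x.1.2) (𝓝 ((0, u₀), (0, u₀))) (𝓝 u₀) :=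
    Continuous.tendsto' (by fun_prop) _ _ rfl
  have hcross : ∀ᶠ x : (ℝ × E) × (ℝ × E) in 𝓝 ((0, u₀), (0, u₀)), x.1.1 < 0 → 0 ≤ x.2.1 →
      ‖T₁ x.1 - T₂ x.2 - T' (x.1 - x.2)‖ ≤ c * ‖x.1 - x.2‖ := by
    filter_upwards [hmid1.eventually (h₁ hc2), hmid2.eventually (h₂ hc2), hu.eventually h]
      with x hx1 hx2 hx3 hneg hpos
    have e1 : ‖x.1 - (0, x.1.2)‖ ≤ ‖x.1 - x.2‖ := by
      have : ‖x.1 - (0, x.1.2)‖ = |x.1.1| := by simp [Prod.norm_def]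
      rw [this]
      refine le_trans ?_ (norm_fst_le (x.1 - x.2))
      rw [Prod.fst_sub, Real.norm_eq_abs, _root_.abs_of_neg hneg, _root_.abs_of_neg (by linarith)]
      linarith
    have e2 : ‖(0, x.1.2) - x.2‖ ≤ ‖x.1 - x.2‖ := by
      rw [Prod.norm_def]
      refine max_le (le_trans ?_ (norm_fst_le (x.1 - x.2))) (norm_snd_le (x.1 - x.2))
      simp only [Prod.fst_sub, Real.norm_eq_abs, zero_sub, abs_neg]
      rw [abs_of_nonneg hpos, _root_.abs_of_neg (by linarith)]
      linarith
    have key : T₁ x.1 - T₂ x.2 - T' (x.1 - x.2) = (T₁ x.1 - T₁ (0, x.1.2) - T' (x.1 - (0, x.1.2)))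
        + (T₂ (0, x.1.2) - T₂ x.2 - T' ((0, x.1.2) - x.2)) := by
      rw [hx3, show x.1 - x.2 = (x.1 - (0, x.1.2)) + ((0, x.1.2) - x.2) by abel, map_add]
      abel
    rw [key]
    refine (norm_add_le _ _).trans ((add_le_add hx1 hx2).trans ?_)
    have := mul_le_mul_of_nonneg_left e1 hc2.le
    have := mul_le_mul_of_nonneg_left e2 hc2.le
    linarith
  filter_upwards [h₁ hc, h₂ hc, hcross, hswap.eventually hcross] with x hx1 hx2 hx3 hx4
  by_cases ha : x.1.1 < 0 <;> by_cases hb : x.2.1 < 0 <;> simp only [ha, hb, if_true, if_false]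
  · exact hx1
  · exact hx3 ha (not_lt.1 hb)
  · have h5 := hx4 hb (not_lt.1 ha)
    simp only [Prod.fst_swap, Prod.snd_swap] at h5
    rw [norm_sub_rev x.2 x.1, ← norm_neg] at h5
    refine le_of_eq_of_le (congrArg _ ?_) h5
    rw [show x.2 - x.1 = -(x.1 - x.2) by abel, map_neg]
    abel
  · exact hx2

/-- `T` is the wave curve of the characteristic field `r` with speed `lam` near `u₀`:
rarefaction waves for nonnegative strength, and the discontinuities in the relation `shock`
satisfying Lax inequalities, with speed `s`, for negative strength. -/
structure IsWaveCurve (lam : E → ℝ) (r : E → E) (shock : ℝ → E → E → Prop) (u₀ : E)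
    (T : ℝ × E → E) (s : ℝ × E → ℝ) : Prop where
  strict : HasStrictFDerivAt T
    ((ContinuousLinearMap.fst ℝ ℝ E).smulRight (r u₀) + ContinuousLinearMap.snd ℝ ℝ E) (0, u₀)
  zero : ∀ᶠ u in 𝓝 u₀, T (0, u) = u
  hasDerivWithinAt : ∀ᶠ p in 𝓝 (0, u₀), 0 ≤ p.1 →
    HasDerivWithinAt (fun ε => T (ε, p.2)) (r (T p)) (Ici 0) p.1
  speed : ∀ᶠ p in 𝓝 (0, u₀), 0 ≤ p.1 → lam (T p) = lam p.2 + p.1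
  shock_of_neg : ∀ᶠ p in 𝓝 (0, u₀), p.1 < 0 → shock (s p) p.2 (T p) ∧ lam (T p) < s p ∧ s p < lam p.2
  exists_of_shock : ∀ᶠ q : E × E in 𝓝 (u₀, u₀), ∀ σ : ℝ, shock σ q.1 q.2 → lam q.2 < σ →
    σ < lam q.1 → ∃ ε < 0, q.2 = T (ε, q.1) ∧ σ = s (ε, q.1) ∧ ε = fderiv ℝ lam u₀ (q.2 - q.1)

theorem eventually_speed_flow {lam : E → ℝ} {r : E → E} {u₀ : E} {T : ℝ × E → E}
    {T' : ℝ × E →L[ℝ] E} (hT : HasStrictFDerivAt T T' (0, u₀))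
    (hzero : ∀ᶠ u in 𝓝 u₀, T (0, u) = u)
    (hflow : ∀ᶠ p : ℝ × E in 𝓝 (0, u₀), HasDerivAt (fun ε => T (ε, p.2)) (r (T p)) p.1)
    (hlam : ∀ᶠ u in 𝓝 u₀, DifferentiableAt ℝ lam u ∧ fderiv ℝ lam u (r u) = 1) :
    ∀ᶠ p in 𝓝 (0, u₀), lam (T p) = lam p.2 + p.1 := by
  have hT0 : Tendsto T (𝓝 (0, u₀)) (𝓝 u₀) := by
    have := hT.continuousAt.tendsto
    rwa [hzero.self_of_nhds] at this
  have hu : Tendsto (fun p : ℝ × E => p.2) (𝓝 (0, u₀)) (𝓝 u₀) := continuous_snd.tendsto' _ _ rfl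
  obtain ⟨δ, hδ, hball⟩ := Metric.eventually_nhds_iff_ball.1
    ((hflow.and (hT0.eventually hlam)).and (hu.eventually hzero))
  filter_upwards [Metric.ball_mem_nhds ((0 : ℝ), u₀) hδ] with p hp
  obtain ⟨ε, u⟩ := p
  rw [← ball_prod_same, mem_prod] at hp
  have h0 : (0 : ℝ) ∈ Metric.ball (0 : ℝ) δ := Metric.mem_ball_self hδ
  have hder : ∀ t ∈ Metric.ball (0 : ℝ) δ, HasDerivAt (fun t => lam (T (t, u)) - t) 0 t := by
    intro t ht
    obtain ⟨⟨h1, h2, h3⟩, -⟩ := hball (t, u) (by rw [← ball_prod_same]; exact ⟨ht, hp.2⟩)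
    have h4 := (h2.hasFDerivAt.comp_hasDerivAt t h1).sub (hasDerivAt_id t)
    rw [h3, sub_self] at h4
    exact h4
  have h1 := (convex_ball (0 : ℝ) δ).norm_image_sub_le_of_norm_hasDerivWithin_le
    (f := fun t => lam (T (t, u)) - t) (f' := fun _ => 0) (C := 0) (x := 0) (y := ε)
    (fun t ht => (hder t ht).hasDerivWithinAt) (fun t _ => by simp) h0 hp.1
  have h2 : T (0, u) = u := (hball (0, u) (by rw [← ball_prod_same]; exact ⟨h0, hp.2⟩)).2
  rw [zero_mul, norm_le_zero_iff, h2] at h1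
  simp only
  linarith

theorem CharacteristicField.exists_isWaveCurve [FiniteDimensional ℝ E] {G Z : E → E} {lam : E → ℝ}
    {r : E → E} {u₀ : E} {χ : E × ℝ → E} {K : ℝ} (h : CharacteristicField G Z lam r u₀)
    (hχ : IsDissipationTerm χ u₀ K) (hr : ContDiffAt ℝ 1 r u₀)
    (hlam : ∀ᶠ u in 𝓝 u₀, DifferentiableAt ℝ lam u ∧ fderiv ℝ lam u (r u) = 1) :
    ∃ T s, IsWaveCurve lam r
      (fun σ a b => G b - G a - σ • (Z b - Z a) = χ (a, σ - lam a)) u₀ T s := by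
  classical
  have : CompleteSpace E := FiniteDimensional.complete ℝ E
  obtain ⟨T₂, h2a, h2b, h2c⟩ := hr.exists_strictFlow
  obtain ⟨T₁, s, h1a, h1b, h1c, h1d, h1e⟩ := h.exists_shockCurve hχ
  have hT : ∀ p : ℝ × E, p.1 < 0 → (if p.1 < 0 then T₁ p else T₂ p) = T₁ p :=
    fun p hp => if_pos hp
  have hT' : ∀ p : ℝ × E, 0 ≤ p.1 → (if p.1 < 0 then T₁ p else T₂ p) = T₂ p :=
    fun p hp => if_neg (not_lt.2 hp)
  refine ⟨fun p => if p.1 < 0 then T₁ p else T₂ p, s, ?_, ?_, ?_, ?_, ?_, ?_⟩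
  · have := h1a.piecewise_fst_neg h2a (h2b.mono fun u hu => by rw [h1b, hu])
    convert! this
  · filter_upwards [h2b] with u hu
    simpa using hu
  · filter_upwards [h2c] with p hp hpos
    rw [hT' _ hpos]
    exact hp.hasDerivWithinAt.congr_of_mem (fun ε hε => hT' (ε, p.2) hε) hpos
  · filter_upwards [eventually_speed_flow h2a h2b h2c hlam] with p hp hpos
    rw [hT' _ hpos, hp]
  · filter_upwards [h1c, h1d] with p hp hp' hneg
    rw [hT _ hneg]
    exact ⟨hp, hp' hneg⟩
  · filter_upwards [h1e] with q hq σ hσ h1 h2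
    obtain ⟨e1, e2, e3⟩ := hq σ h1 h2 hσ
    exact ⟨_, e1, e2.trans (hT _ e1).symm, e3, rfl⟩

/-- Integral curves of `r` that stay near `u₀` follow the wave curve. -/
theorem IsWaveCurve.eventually_eq_of_integralCurve {lam : E → ℝ} {r : E → E}
    {shock : ℝ → E → E → Prop} {u₀ : E} {T : ℝ × E → E} {s : ℝ × E → ℝ}
    (hT : IsWaveCurve lam r shock u₀ T s) (hr : ContDiffAt ℝ 1 r u₀) :
    ∃ η > 0, ∃ O ∈ 𝓝 u₀, ∀ (a b : ℝ) (w : ℝ → E), b - a < η → ContinuousOn w (Icc a b) →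
      (∀ ξ ∈ Ico a b, HasDerivWithinAt w (r (w ξ)) (Ici ξ) ξ) → MapsTo w (Icc a b) O →
      ∀ ξ ∈ Icc a b, w ξ = T (ξ - a, w a) := by
  obtain ⟨K, O₁, hO₁, hK⟩ := hr.exists_lipschitzOnWith
  have hT0 : Tendsto T (𝓝 (0, u₀)) (𝓝 u₀) := by
    have := hT.strict.continuousAt.tendsto
    rwa [hT.zero.self_of_nhds] at this
  obtain ⟨δ, hδ, hball⟩ := Metric.eventually_nhds_iff_ball.1
    (hT.hasDerivWithinAt.and (hT0.eventually hO₁))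
  refine ⟨δ, hδ, O₁ ∩ Metric.ball u₀ δ ∩ {u | T (0, u) = u},
    inter_mem (inter_mem hO₁ (Metric.ball_mem_nhds _ hδ)) hT.zero, ?_⟩
  intro a b w hab hw hw' hmaps
  rcases lt_or_ge b a with hba | hba
  · simp [Icc_eq_empty_of_lt hba]
  have ha : a ∈ Icc a b := ⟨le_rfl, hba⟩
  have hin : ∀ t ∈ Icc a b, (0 ≤ t - a → HasDerivWithinAt (fun ε => T (ε, w a))
      (r (T (t - a, w a))) (Ici 0) (t - a)) ∧ T (t - a, w a) ∈ O₁ := fun t ht =>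
    hball (t - a, w a) (by
      rw [← ball_prod_same]
      refine ⟨?_, (hmaps ha).1.2⟩
      rw [Metric.mem_ball, dist_zero_right, Real.norm_eq_abs, abs_of_nonneg (by linarith [ht.1])]
      linarith [ht.2])
  have hder : ∀ t ∈ Icc a b, HasDerivWithinAt (fun t => T (t - a, w a)) (r (T (t - a, w a)))
      (Ici a) t := by
    intro t ht
    have h1 := (hin t ht).1 (by linarith [ht.1])
    have h2 := HasDerivWithinAt.scomp t (s := Ici a) (t' := Ici (0 : ℝ)) h1
      ((hasDerivWithinAt_id t (Ici a)).sub_const a) (fun x hx => by simpa using hx)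
    simpa [Function.comp_def] using h2
  exact ODE_solution_unique_of_mem_Icc_right (v := fun _ => r) (s := fun _ => O₁) (K := K)
    (fun t _ => hK) hw hw' (fun t ht => (hmaps (Ico_subset_Icc_self ht)).1.1)
    (fun t ht => ((hder t ht).mono Icc_subset_Ici_self).continuousWithinAt)
    (fun t ht => (hder t (Ico_subset_Icc_self ht)).mono (Ici_subset_Ici.2 ht.1))
    (fun t ht => (hin t (Ico_subset_Icc_self ht)).2)
    (by simpa using ((hmaps ha).2 : T (0, w a) = w a).symm)

end WaveCurve

section FanState

variable {E : Type*} {N : ℕ}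

/-- The state reached from `u` by the first `k` waves, of strengths `ε`. -/
noncomputable def fanState (T : Fin N → ℝ × E → E) (ε : Fin N → ℝ) (u : E) : ℕ → E
  | 0 => u
  | k + 1 => if h : k < N then T ⟨k, h⟩ (ε ⟨k, h⟩, fanState T ε u k) else fanState T ε u k

variable {T : Fin N → ℝ × E → E}

theorem fanState_succ (ε : Fin N → ℝ) (u : E) (j : Fin N) :
    fanState T ε u (j + 1) = T j (ε j, fanState T ε u j) := by
  rw [fanState, dif_pos j.2]

theorem fanState_congr {ε ε' : Fin N → ℝ} {u : E} {k : ℕ} (h : ∀ i : Fin N, (i : ℕ) < k → ε i = ε' i) :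
    fanState T ε u k = fanState T ε' u k := by
  induction k with
  | zero => rfl
  | succ k ih =>
    rw [fanState, fanState, ih fun i hi => h i (by omega)]
    by_cases hk : k < N
    · rw [dif_pos hk, dif_pos hk, h ⟨k, hk⟩ (by simp)]
    · rw [dif_neg hk, dif_neg hk]

theorem fanState_eq_of_zero {ε : Fin N → ℝ} {u : E} {k n : ℕ} (hkn : k ≤ n)
    (hε : ∀ i : Fin N, k ≤ i → ε i = 0) (hT : ∀ i, T i (0, fanState T ε u k) = fanState T ε u k) :
    fanState T ε u n = fanState T ε u k := by
  induction n, hkn using Nat.le_induction with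
  | base => rfl
  | succ n hn ih =>
    rw [fanState, ih]
    split_ifs with h
    · rw [hε ⟨n, h⟩ hn, hT]
    · rfl

theorem fanState_single {e ε : Fin N → ℝ} {u : E} (j : Fin N) (hlt : ∀ i < j, e i = ε i)
    (hgt : ∀ i, j < i → e i = 0)
    (hT : ∀ i, T i (0, T j (e j, fanState T ε u j)) = T j (e j, fanState T ε u j)) :
    fanState T e u N = T j (e j, fanState T ε u j) := by
  have h1 : fanState T e u (j + 1) = T j (e j, fanState T ε u j) := by
    rw [fanState_succ, fanState_congr (ε' := ε) fun i hi => hlt i hi]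
  rw [← h1] at hT ⊢
  exact fanState_eq_of_zero (by omega) (fun i hi => hgt i (by exact Fin.lt_def.2 (by omega))) hT

variable [NormedAddCommGroup E] [NormedSpace ℝ E]

/-- The derivative of the state after `k` waves. -/
noncomputable def fanDeriv (r : Fin N → E) (k : ℕ) : (Fin N → ℝ) × E →L[ℝ] E :=
  ContinuousLinearMap.snd ℝ (Fin N → ℝ) E + ∑ i : Fin N, if (i : ℕ) < k then
    ((ContinuousLinearMap.proj i).comp (ContinuousLinearMap.fst ℝ (Fin N → ℝ) E)).smulRight (r i)
    else 0

theorem fanDeriv_apply (r : Fin N → E) (k : ℕ) (q : (Fin N → ℝ) × E) :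
    fanDeriv r k q = q.2 + ∑ i : Fin N, if (i : ℕ) < k then q.1 i • r i else 0 := by
  simp only [fanDeriv, add_apply, ContinuousLinearMap.coe_snd', sum_apply]
  congr 1
  refine Finset.sum_congr rfl fun i _ => ?_
  split_ifs <;> simp

theorem fanState_zero_strength {u : E} (h : ∀ j, T j (0, u) = u) (k : ℕ) :
    fanState T 0 u k = u :=
  fanState_eq_of_zero (k := 0) (Nat.zero_le k) (fun _ _ => rfl) h

theorem hasStrictFDerivAt_fanState {u₀ : E} {r : Fin N → E} (h0 : ∀ j, T j (0, u₀) = u₀)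
    (hT : ∀ j, HasStrictFDerivAt (T j)
      ((ContinuousLinearMap.fst ℝ ℝ E).smulRight (r j) + ContinuousLinearMap.snd ℝ ℝ E) (0, u₀))
    (k : ℕ) :
    HasStrictFDerivAt (fun q : (Fin N → ℝ) × E => fanState T q.1 q.2 k) (fanDeriv r k) (0, u₀) := by
  induction k with
  | zero =>
    have : fanDeriv r 0 = ContinuousLinearMap.snd ℝ (Fin N → ℝ) E := by simp [fanDeriv]
    rw [this]
    exact hasStrictFDerivAt_snd
  | succ k ih =>
    by_cases hk : k < N
    · simp only [fanState, dif_pos hk]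
      have h1 : HasStrictFDerivAt (fun q : (Fin N → ℝ) × E => (q.1 ⟨k, hk⟩, fanState T q.1 q.2 k))
          (((ContinuousLinearMap.proj (R := ℝ) (φ := fun _ : Fin N => ℝ) ⟨k, hk⟩).comp
            (ContinuousLinearMap.fst ℝ (Fin N → ℝ) E)).prod (fanDeriv r k)) (0, u₀) :=
        (((ContinuousLinearMap.proj (R := ℝ) (φ := fun _ : Fin N => ℝ) ⟨k, hk⟩).comp
            (ContinuousLinearMap.fst ℝ (Fin N → ℝ) E)).hasStrictFDerivAt).prodMk ih
      have h2 := HasStrictFDerivAt.comp (x := ((0 : Fin N → ℝ), u₀)) (g := T ⟨k, hk⟩)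
        (f := fun q : (Fin N → ℝ) × E => (q.1 ⟨k, hk⟩, fanState T q.1 q.2 k))
        (by simpa only [fanState_zero_strength h0, Pi.zero_apply] using hT ⟨k, hk⟩) h1
      refine h2.congr_fderiv ?_
      refine ContinuousLinearMap.ext fun q => ?_
      simp only [ContinuousLinearMap.comp_apply, ContinuousLinearMap.prod_apply, add_apply,
        ContinuousLinearMap.smulRight_apply, ContinuousLinearMap.coe_fst',
        ContinuousLinearMap.coe_snd', ContinuousLinearMap.proj_apply, fanDeriv_apply]
      have h3 : ∀ i : Fin N, (if (i : ℕ) < k + 1 then q.1 i • r i else 0)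
          = (if (i : ℕ) < k then q.1 i • r i else 0) + if i = ⟨k, hk⟩ then q.1 i • r i else 0 := by
        intro i
        rcases lt_trichotomy (i : ℕ) k with h | h | h
        · rw [if_pos (by omega), if_pos h, if_neg (by rintro rfl; simp at h), add_zero]
        · rw [if_pos (by omega), if_neg (by omega), if_pos (Fin.ext h), zero_add]
        · rw [if_neg (by omega), if_neg (by omega), if_neg (by rintro rfl; simp at h), add_zero]
      simp_rw [h3, Finset.sum_add_distrib]
      simp [add_comm, add_left_comm]
    · simp only [fanState, dif_neg hk]
      refine ih.congr_fderiv ?_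
      have h3 : ∀ i : Fin N, (i : ℕ) < k + 1 ↔ (i : ℕ) < k := fun i => by have := i.2; omega
      simp only [fanDeriv, h3]

theorem exists_fan_inverse {u₀ : E} {r : Fin N → E} (h0 : ∀ j, T j (0, u₀) = u₀)
    [FiniteDimensional ℝ E] (b : Module.Basis (Fin N) ℝ E) (hb : ∀ j, b j = r j)
    (hT : ∀ j, HasStrictFDerivAt (T j)
      ((ContinuousLinearMap.fst ℝ ℝ E).smulRight (r j) + ContinuousLinearMap.snd ℝ ℝ E) (0, u₀)) :
    (∃ O ∈ 𝓝 ((0 : Fin N → ℝ), u₀), ∀ ε ε' u, (ε, u) ∈ O → (ε', u) ∈ O →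
      fanState T ε u N = fanState T ε' u N → ε = ε') ∧
    ∀ O ∈ 𝓝 ((0 : Fin N → ℝ), u₀), ∀ᶠ q : E × E in 𝓝 (u₀, u₀),
      ∃ ε, (ε, q.1) ∈ O ∧ fanState T ε q.1 N = q.2 := by
  have : CompleteSpace E := FiniteDimensional.complete ℝ E
  let L₀ : (Fin N → ℝ) × E →L[ℝ] E × E :=
    (ContinuousLinearMap.snd ℝ (Fin N → ℝ) E).prod (fanDeriv r N)
  have hL₀ : ∀ q, L₀ q = (q.2, q.2 + ∑ i, q.1 i • b i) := by
    intro q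
    simp [L₀, fanDeriv_apply, hb]
  have hbij : Function.Bijective L₀ := by
    constructor
    · rw [injective_iff_map_eq_zero]
      rintro ⟨ε, u⟩ h
      rw [hL₀, Prod.mk_eq_zero] at h
      obtain ⟨h1, h2⟩ := h
      simp only at h1 h2
      rw [h1, zero_add] at h2
      have h3 := Fintype.linearIndependent_iff.1 b.linearIndependent ε h2
      rw [h1, Prod.mk_eq_zero]
      exact ⟨funext h3, rfl⟩
    · rintro ⟨u, v⟩
      refine ⟨(b.repr (v - u), u), ?_⟩
      rw [hL₀]
      simp only [b.sum_repr]
      simp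
  let Le : ((Fin N → ℝ) × E) ≃L[ℝ] E × E :=
    (LinearEquiv.ofBijective (L₀ : (Fin N → ℝ) × E →ₗ[ℝ] E × E) hbij).toContinuousLinearEquiv
  have hLe : (Le : (Fin N → ℝ) × E →L[ℝ] E × E) = L₀ := by ext1 <;> rfl
  have hs : HasStrictFDerivAt (fun q : (Fin N → ℝ) × E => (q.2, fanState T q.1 q.2 N))
      (Le : (Fin N → ℝ) × E →L[ℝ] E × E) (0, u₀) := by
    rw [hLe]
    exact hasStrictFDerivAt_snd.prodMk (hasStrictFDerivAt_fanState h0 hT N)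
  constructor
  · set φ := hs.toOpenPartialHomeomorph _ with hφ
    refine ⟨φ.source, φ.open_source.mem_nhds hs.mem_toOpenPartialHomeomorph_source, ?_⟩
    intro ε ε' u h1 h2 h3
    have := φ.injOn h1 h2 (Prod.ext rfl h3)
    exact congrArg Prod.fst this
  · intro O hO
    have h1 := hs.map_nhds_eq_of_equiv
    simp only [fanState_zero_strength h0] at h1
    have h2 : (fun q : (Fin N → ℝ) × E => (q.2, fanState T q.1 q.2 N)) '' O ∈ 𝓝 (u₀, u₀) := by
      rw [← h1]
      exact image_mem_map hO
    filter_upwards [h2] with q hq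
    obtain ⟨⟨ε, u⟩, h3, rfl⟩ := hq
    exact ⟨ε, h3, rfl⟩

end FanState

section FanDomain

variable {E : Type*} [NormedAddCommGroup E] [NormedSpace ℝ E] {N : ℕ}

/-- On the neighbourhood `O`, the wave curves `T j` are defined for all strengths less than `η`,
and contain all `j`-waves in `O`. The speeds of the `j`-th field stay in `(c j, c (j + 1))`. -/
structure IsFanDomain (lam : Fin N → E → ℝ) (r : Fin N → E → E) (shock : ℝ → E → E → Prop)
    (T : Fin N → ℝ × E → E) (s : Fin N → ℝ × E → ℝ) (c : ℕ → ℝ) (κ η : ℝ) (O : Set E) : Prop where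
  zero : ∀ j, ∀ u ∈ O, T j (0, u) = u
  hasDerivWithinAt : ∀ j, ∀ u ∈ O, ∀ ε, 0 ≤ ε → ε < η →
    HasDerivWithinAt (fun ε => T j (ε, u)) (r j (T j (ε, u))) (Ici 0) ε
  speed : ∀ j, ∀ u ∈ O, ∀ ε, 0 ≤ ε → ε < η → lam j (T j (ε, u)) = lam j u + ε
  shock_of_neg : ∀ j, ∀ u ∈ O, ∀ ε, -η < ε → ε < 0 →
    shock (s j (ε, u)) u (T j (ε, u)) ∧ lam j (T j (ε, u)) < s j (ε, u) ∧ s j (ε, u) < lam j u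
  exists_of_shock : ∀ j, ∀ a ∈ O, ∀ b ∈ O, ∀ σ, shock σ a b → lam j b < σ → σ < lam j a →
    ∃ ε, -η < ε ∧ ε < 0 ∧ b = T j (ε, a) ∧ σ = s j (ε, a)
  eq_of_integralCurve : ∀ j a b w, b - a < η → ContinuousOn w (Icc a b) →
    (∀ ξ ∈ Ico a b, HasDerivWithinAt w (r j (w ξ)) (Ici ξ) ξ) → MapsTo w (Icc a b) O →
    ∀ ξ ∈ Icc a b, w ξ = T j (ξ - a, w a)
  strictMono : StrictMono c
  κ_pos : 0 < κ
  η_pos : 0 < η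
  lt_speed : ∀ j : Fin N, ∀ u ∈ O, c j + κ < lam j u
  speed_lt : ∀ j : Fin N, ∀ u ∈ O, lam j u < c (j + 1) - κ
  oscillation : ∀ j, ∀ u ∈ O, ∀ u' ∈ O, lam j u - lam j u' < η
  continuousAt_speed : ∀ j, ∀ u ∈ O, ContinuousAt (lam j) u
  continuousAt_field : ∀ j, ∀ u ∈ O, ContinuousAt (r j) u

theorem StrictMono.exists_strictMono_separating {x : Fin N → ℝ} (hx : StrictMono x) :
    ∃ c : ℕ → ℝ, StrictMono c ∧ ∃ κ > 0, ∀ j : Fin N, c j + κ < x j ∧ x j < c (j + 1) - κ := by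
  obtain ⟨M, hM⟩ : ∃ M : ℝ, ∀ j, x j < M := by
    obtain ⟨M, hM⟩ := (Set.finite_range x).bddAbove
    exact ⟨M + 1, fun j => by linarith [hM ⟨j, rfl⟩]⟩
  let X : ℕ → ℝ := fun k => if h : k < N then x ⟨k, h⟩ else M + k
  have hX : StrictMono X := by
    refine strictMono_nat_of_lt_succ fun k => ?_
    simp only [X]
    split_ifs with h1 h2
    · exact hx (Fin.mk_lt_mk.2 (Nat.lt_succ_self k))
    · have := hM ⟨k, h1⟩
      have : (0 : ℝ) ≤ ((k + 1 : ℕ) : ℝ) := Nat.cast_nonneg _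
      linarith
    · omega
    · push_cast
      linarith
  have hXj : ∀ j : Fin N, X j = x j := fun j => by simp [X]
  let c : ℕ → ℝ := fun k => if k = 0 then X 0 - 1 else (X (k - 1) + X k) / 2
  have hc1 : ∀ k, c k < X k := by
    intro k
    rcases k with _ | k
    · simp [c]
    · have := hX (Nat.lt_succ_self k)
      simp only [c, Nat.succ_ne_zero, if_false, Nat.add_sub_cancel]
      simp only [Nat.succ_eq_add_one] at this
      linarith
  have hc2 : ∀ k, X k < c (k + 1) := by
    intro k
    have := hX (Nat.lt_succ_self k)
    simp only [c, Nat.succ_ne_zero, if_false, Nat.add_sub_cancel]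
    simp only [Nat.succ_eq_add_one] at this
    linarith
  refine ⟨c, strictMono_nat_of_lt_succ fun k => (hc1 k).trans (hc2 k), ?_⟩
  have h : ∀ᶠ κ in 𝓝[>] (0 : ℝ), ∀ j : Fin N, c j + κ < x j ∧ x j < c (j + 1) - κ := by
    rw [eventually_all]
    intro j
    have h1 := hc1 j
    have h2 := hc2 j
    rw [hXj] at h1 h2
    have h3 : ∀ᶠ κ in 𝓝 (0 : ℝ), κ < x j - c j := eventually_lt_nhds (by linarith)
    have h4 : ∀ᶠ κ in 𝓝 (0 : ℝ), κ < c (j + 1) - x j := eventually_lt_nhds (by linarith)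
    filter_upwards [nhdsWithin_le_nhds h3, nhdsWithin_le_nhds h4] with κ h5 h6
    exact ⟨by linarith, by linarith⟩
  obtain ⟨κ, h1, h2⟩ := (h.and self_mem_nhdsWithin).exists
  exact ⟨κ, h2, h1⟩

theorem exists_isFanDomain {lam : Fin N → E → ℝ} {r : Fin N → E → E} {shock : ℝ → E → E → Prop}
    {T : Fin N → ℝ × E → E} {s : Fin N → ℝ × E → ℝ} {u₀ : E}
    (hmono : StrictMono fun j => lam j u₀)
    (hT : ∀ j, IsWaveCurve (lam j) (r j) shock u₀ (T j) (s j))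
    (hr : ∀ j, ContDiffAt ℝ 1 (r j) u₀) (hlam : ∀ j, ContDiffAt ℝ 1 (lam j) u₀)
    {B : Set ((Fin N → ℝ) × E)} (hB : B ∈ 𝓝 ((0 : Fin N → ℝ), u₀)) :
    ∃ c κ η, ∃ O ∈ 𝓝 u₀, IsFanDomain lam r shock T s c κ η O ∧
      ∀ ε u, (∀ j, |ε j| < η) → u ∈ O → (ε, u) ∈ B := by
  obtain ⟨c, hc, κ, hκ, hsep⟩ := hmono.exists_strictMono_separating
  have hint := fun j => (hT j).eventually_eq_of_integralCurve (hr j)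
  choose η₁ hη₁ O₁ hO₁ hint using hint
  have hprod := (eventually_all.2 fun j => (hT j).hasDerivWithinAt).and
    ((eventually_all.2 fun j => (hT j).speed).and (eventually_all.2 fun j => (hT j).shock_of_neg))
  rw [nhds_prod_eq, eventually_prod_iff] at hprod
  obtain ⟨p₁, hp₁, q₁, hq₁, hprod⟩ := hprod
  rw [nhds_prod_eq, mem_prod_iff] at hB
  obtain ⟨B₁, hB₁, B₂, hB₂, hB⟩ := hB
  obtain ⟨ηp, hηp, hp₁⟩ := Metric.eventually_nhds_iff.1 hp₁
  obtain ⟨ηB, hηB, hB₁⟩ := Metric.mem_nhds_iff.1 hB₁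
  obtain ⟨η, ⟨hηlt, hηp', hηB'⟩, hη⟩ : ∃ η : ℝ, ((∀ j, η < η₁ j) ∧ η < ηp ∧ η < ηB) ∧ 0 < η := by
    have h1 : ∀ᶠ η : ℝ in 𝓝[>] 0, (∀ j, η < η₁ j) ∧ η < ηp ∧ η < ηB :=
      nhdsWithin_le_nhds ((eventually_all.2 fun j => eventually_lt_nhds (hη₁ j)).and
        ((eventually_lt_nhds hηp).and (eventually_lt_nhds hηB)))
    exact (h1.and self_mem_nhdsWithin).exists
  have hsh : ∀ᶠ q : E × E in 𝓝 (u₀, u₀), ∀ j, ∀ σ : ℝ, shock σ q.1 q.2 → lam j q.2 < σ →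
      σ < lam j q.1 → ∃ ε, -η < ε ∧ ε < 0 ∧ q.2 = T j (ε, q.1) ∧ σ = s j (ε, q.1) := by
    rw [eventually_all]
    intro j
    have hL : Tendsto (fun q : E × E => fderiv ℝ (lam j) u₀ (q.2 - q.1)) (𝓝 (u₀, u₀)) (𝓝 0) :=
      Continuous.tendsto' (by fun_prop) _ _ (by simp)
    filter_upwards [(hT j).exists_of_shock, hL.eventually (eventually_gt_nhds (neg_lt_zero.2 hη))]
      with q h1 h2 σ h3 h4 h5
    obtain ⟨ε, h6, h7, h8, h9⟩ := h1 σ h3 h4 h5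
    exact ⟨ε, h9 ▸ h2, h6, h7, h8⟩
  rw [nhds_prod_eq] at hsh
  obtain ⟨O₂, hO₂, hsh⟩ := mem_prod_same_iff.1 hsh
  have hcont : ∀ᶠ u in 𝓝 u₀, ∀ j, ContinuousAt (lam j) u ∧ ContinuousAt (r j) u := by
    rw [eventually_all]
    intro j
    filter_upwards [(hlam j).eventually (by simp), (hr j).eventually (by simp)] with u h1 h2
    exact ⟨h1.continuousAt, h2.continuousAt⟩
  have hspeed : ∀ᶠ u in 𝓝 u₀, ∀ j : Fin N, c j + κ < lam j u ∧ lam j u < c (j + 1) - κ ∧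
      |lam j u - lam j u₀| < η / 2 := by
    rw [eventually_all]
    intro j
    have h1 := (hlam j).continuousAt
    filter_upwards [h1.eventually_const_lt (hsep j).1, h1.eventually_lt_const (hsep j).2,
      h1.eventually (Metric.ball_mem_nhds _ (half_pos hη))] with u h2 h3 h4
    exact ⟨h2, h3, h4⟩
  have hev := hq₁.and ((eventually_all.2 fun j => (hT j).zero).and (hcont.and hspeed))
  have habs : ∀ {ε : ℝ}, |ε| < η → p₁ ε := fun {ε} h => hp₁ (by
    rw [Real.dist_eq, sub_zero]; linarith)
  refine ⟨c, κ, η, {u | (q₁ u ∧ (∀ j, T j (0, u) = u) ∧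
    (∀ j, ContinuousAt (lam j) u ∧ ContinuousAt (r j) u) ∧ ∀ j : Fin N, c j + κ < lam j u ∧
      lam j u < c (j + 1) - κ ∧ |lam j u - lam j u₀| < η / 2)} ∩ (⋂ j, O₁ j) ∩ O₂ ∩ B₂,
    inter_mem (inter_mem (inter_mem hev (iInter_mem.2 hO₁)) hO₂) hB₂, ?_, ?_⟩
  · refine ⟨?_, ?_, ?_, ?_, ?_, ?_, hc, hκ, hη, ?_, ?_, ?_, ?_, ?_⟩
    · exact fun j u hu => hu.1.1.1.2.1 j
    · exact fun j u hu ε h0 h1 => (hprod (habs (by rwa [abs_of_nonneg h0])) hu.1.1.1.1).1 j h0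
    · exact fun j u hu ε h0 h1 => (hprod (habs (by rwa [abs_of_nonneg h0])) hu.1.1.1.1).2.1 j h0
    · exact fun j u hu ε h0 h1 => (hprod (habs (abs_lt.2 ⟨h0, by linarith⟩)) hu.1.1.1.1).2.2 j h1
    · exact fun j a ha b hb σ => hsh (mk_mem_prod ha.1.2 hb.1.2) j σ
    · exact fun j a b w hab hw hd hm => hint j a b w (hab.trans (hηlt j)) hw hd
        fun ξ hξ => mem_iInter.1 (hm hξ).1.1.2 j
    · exact fun j u hu => (hu.1.1.1.2.2.2 j).1
    · exact fun j u hu => (hu.1.1.1.2.2.2 j).2.1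
    · intro j u hu u' hu'
      have h1 := (abs_lt.1 (hu.1.1.1.2.2.2 j).2.2).2
      have h2 := (abs_lt.1 (hu'.1.1.1.2.2.2 j).2.2).1
      linarith
    · exact fun j u hu => (hu.1.1.1.2.2.1 j).1
    · exact fun j u hu => (hu.1.1.1.2.2.1 j).2
  · intro ε u hε hu
    refine hB ⟨hB₁ ?_, hu.2⟩
    rw [mem_ball_zero_iff, pi_norm_lt_iff hηB]
    exact fun j => (hε j).trans hηB'

end FanDomain

section WaveStrength

/-- The part of a wave of strength `ε` that is slower than `ξ`: a rarefaction wave starting with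
the speed `ℓ`, or a shock with the speed `σ`. -/
noncomputable def waveStrength (ε ℓ σ ξ : ℝ) : ℝ :=
  if ε < 0 then (if ξ < σ then 0 else ε) else max 0 (min (ξ - ℓ) ε)

/-- The slowest speed in a wave. -/
noncomputable def waveStart (ε ℓ σ : ℝ) : ℝ := if ε < 0 then σ else ℓ

/-- The fastest speed in a wave. -/
noncomputable def waveEnd (ε ℓ σ : ℝ) : ℝ := if ε < 0 then σ else ℓ + ε

variable {ε ℓ σ ξ : ℝ}

theorem waveStart_le_waveEnd : waveStart ε ℓ σ ≤ waveEnd ε ℓ σ := by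
  unfold waveStart waveEnd
  split_ifs <;> linarith

theorem waveStrength_of_lt (h : ξ < waveStart ε ℓ σ) : waveStrength ε ℓ σ ξ = 0 := by
  unfold waveStart at h
  unfold waveStrength
  split_ifs at h ⊢
  · rfl
  · exact max_eq_left ((min_le_left _ _).trans (by linarith))

theorem waveStrength_of_gt (h : waveEnd ε ℓ σ < ξ) : waveStrength ε ℓ σ ξ = ε := by
  unfold waveEnd at h
  unfold waveStrength
  split_ifs at h ⊢ with h1 h2
  · linarith
  · rfl
  · rw [min_eq_right (by linarith), max_eq_right (by linarith)]

theorem waveStrength_of_mem (h : ξ ∈ Ioo (waveStart ε ℓ σ) (waveEnd ε ℓ σ)) :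
    waveStrength ε ℓ σ ξ = ξ - ℓ := by
  obtain ⟨h1, h2⟩ := h
  unfold waveEnd at h2
  unfold waveStart at h1
  unfold waveStrength
  split_ifs at h1 h2 ⊢
  · linarith
  · linarith
  · rw [min_eq_left (by linarith), max_eq_right (by linarith)]

theorem abs_waveStrength_le : |waveStrength ε ℓ σ ξ| ≤ |ε| := by
  unfold waveStrength
  split_ifs with h1 h2
  · simp
  · exact le_rfl
  · rw [abs_of_nonneg (le_max_left _ _), abs_of_nonneg (not_lt.1 h1)]
    exact max_le (not_lt.1 h1) (min_le_right _ _)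

end WaveStrength

section FanProfile

variable {E : Type*} {N : ℕ}

/-- The self-similar solution consisting of waves of strengths `ε`, as a function of `x / t`. -/
noncomputable def fanProfile (lam : Fin N → E → ℝ) (T : Fin N → ℝ × E → E) (s : Fin N → ℝ × E → ℝ)
    (ε : Fin N → ℝ) (u : E) (ξ : ℝ) : E :=
  fanState T (fun j => waveStrength (ε j) (lam j (fanState T ε u j))
    (s j (ε j, fanState T ε u j)) ξ) u N

variable [NormedAddCommGroup E] [NormedSpace ℝ E]

/-- `w` is a self-similar solution, as a function of `x / t`, with finitely many rays `P`. -/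
structure IsWaveProfile (lam : Fin N → E → ℝ) (r : Fin N → E → E) (shock : ℝ → E → E → Prop)
    (P : Finset ℝ) (w : ℝ → E) : Prop where
  gap : ∀ J : Set ℝ, IsOpen J → J.OrdConnected → Disjoint J (P : Set ℝ) →
    (∃ c, ∀ ξ ∈ J, w ξ = c) ∨ ∃ j, ∀ ξ ∈ J, lam j (w ξ) = ξ ∧ HasDerivAt w (r j (w ξ)) ξ
  ray : ∀ s ∈ P, ∃ a b, Tendsto w (𝓝[<] s) (𝓝 a) ∧ Tendsto w (𝓝[>] s) (𝓝 b) ∧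
    (a = b ∨ (shock s a b ∧ ∃ j, lam j b < s ∧ s < lam j a))

variable {lam : Fin N → E → ℝ} {r : Fin N → E → E} {shock : ℝ → E → E → Prop}
  {T : Fin N → ℝ × E → E} {s : Fin N → ℝ × E → ℝ} {c : ℕ → ℝ} {κ η : ℝ} {O : Set E}
  {ε : Fin N → ℝ} {u : E}

namespace IsFanDomain

variable (hD : IsFanDomain lam r shock T s c κ η O)
include hD

theorem lt_waveStart {j : Fin N} {e : ℝ} {a : E} (ha : a ∈ O) (hb : T j (e, a) ∈ O) (he : -η < e) :
    c j + κ < waveStart e (lam j a) (s j (e, a)) := by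
  unfold waveStart
  split_ifs with h
  · exact (hD.lt_speed j _ hb).trans (hD.shock_of_neg j a ha e he h).2.1
  · exact hD.lt_speed j a ha

theorem waveEnd_lt {j : Fin N} {e : ℝ} {a : E} (ha : a ∈ O) (hb : T j (e, a) ∈ O) (he : |e| < η) :
    waveEnd e (lam j a) (s j (e, a)) < c (j + 1) - κ := by
  unfold waveEnd
  split_ifs with h
  · exact (hD.shock_of_neg j a ha e (abs_lt.1 he).1 h).2.2.trans (hD.speed_lt j _ ha)
  · rw [← hD.speed j a ha e (not_lt.1 h) (abs_lt.1 he).2]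
    exact hD.speed_lt j _ hb

end IsFanDomain

theorem fanProfile_eq_of_waveStrength {j : Fin N} {ξ : ℝ}
    (hlt : ∀ i < j, waveEnd (ε i) (lam i (fanState T ε u i)) (s i (ε i, fanState T ε u i)) < ξ)
    (hgt : ∀ i, j < i → ξ < waveStart (ε i) (lam i (fanState T ε u i))
      (s i (ε i, fanState T ε u i)))
    (hT : ∀ i, T i (0, T j (waveStrength (ε j) (lam j (fanState T ε u j))
      (s j (ε j, fanState T ε u j)) ξ, fanState T ε u j)) =
      T j (waveStrength (ε j) (lam j (fanState T ε u j))
        (s j (ε j, fanState T ε u j)) ξ, fanState T ε u j)) :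
    fanProfile lam T s ε u ξ = T j (waveStrength (ε j) (lam j (fanState T ε u j))
      (s j (ε j, fanState T ε u j)) ξ, fanState T ε u j) :=
  fanState_single (ε := ε) j (fun i hi => waveStrength_of_gt (hlt i hi))
    (fun i hi => waveStrength_of_lt (hgt i hi)) hT

variable (hD : IsFanDomain lam r shock T s c κ η O) (hst : ∀ k, fanState T ε u k ∈ O)
  (hε : ∀ j, |ε j| < η)
include hD hst hε

theorem fanState_waveSpeeds (j : Fin N) :
    c j + κ < waveStart (ε j) (lam j (fanState T ε u j)) (s j (ε j, fanState T ε u j)) ∧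
    waveEnd (ε j) (lam j (fanState T ε u j)) (s j (ε j, fanState T ε u j)) < c (j + 1) - κ := by
  have h1 := hst j
  have h2 := hst (j + 1)
  rw [fanState_succ] at h2
  exact ⟨hD.lt_waveStart h1 h2 (abs_lt.1 (hε j)).1, hD.waveEnd_lt h1 h2 (hε j)⟩

theorem waveEnd_lt_of_lt {i j : Fin N} {ξ : ℝ} (hξ : c j ≤ ξ) (hi : i < j) :
    waveEnd (ε i) (lam i (fanState T ε u i)) (s i (ε i, fanState T ε u i)) < ξ := by
  have hκ := hD.κ_pos
  have h1 := (fanState_waveSpeeds hD hst hε i).2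
  have h2 : c (i + 1) ≤ c j := hD.strictMono.monotone (Fin.lt_def.1 hi)
  linarith

theorem lt_waveStart_of_lt {i j : Fin N} {ξ : ℝ} (hξ : ξ ≤ c (j + 1)) (hi : j < i) :
    ξ < waveStart (ε i) (lam i (fanState T ε u i)) (s i (ε i, fanState T ε u i)) := by
  have hκ := hD.κ_pos
  have h1 := (fanState_waveSpeeds hD hst hε i).1
  have h2 : c (j + 1) ≤ c i := hD.strictMono.monotone (Fin.lt_def.1 hi)
  linarith

theorem fanProfile_eq_of_mem {j : Fin N} {ξ : ℝ} (hξ : ξ ∈ Icc (c j) (c (j + 1)))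
    (hmem : T j (waveStrength (ε j) (lam j (fanState T ε u j))
      (s j (ε j, fanState T ε u j)) ξ, fanState T ε u j) ∈ O) :
    fanProfile lam T s ε u ξ = T j (waveStrength (ε j) (lam j (fanState T ε u j))
      (s j (ε j, fanState T ε u j)) ξ, fanState T ε u j) :=
  fanProfile_eq_of_waveStrength (fun _ => waveEnd_lt_of_lt hD hst hε hξ.1)
    (fun _ => lt_waveStart_of_lt hD hst hε hξ.2) fun i => hD.zero i _ hmem

theorem fanProfile_of_le {ξ : ℝ} (hξ : ξ ≤ c 0) : fanProfile lam T s ε u ξ = u := by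
  have hκ := hD.κ_pos
  refine fanState_eq_of_zero (k := 0) (Nat.zero_le N) (fun i _ => waveStrength_of_lt ?_)
    fun i => hD.zero i _ (hst 0)
  have h1 := (fanState_waveSpeeds hD hst hε i).1
  have h2 : c 0 ≤ c i := hD.strictMono.monotone (Nat.zero_le i)
  linarith

theorem fanProfile_of_ge {ξ : ℝ} (hξ : c N ≤ ξ) :
    fanProfile lam T s ε u ξ = fanState T ε u N := by
  have hκ := hD.κ_pos
  refine fanState_congr fun i _ => waveStrength_of_gt ?_
  have h1 := (fanState_waveSpeeds hD hst hε i).2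
  have h2 : c (i + 1) ≤ c N := hD.strictMono.monotone i.2
  linarith

omit hst in
theorem isWaveProfile_fanProfile
    (hfan : ∀ e : Fin N → ℝ, (∀ j, |e j| ≤ |ε j|) → ∀ k, fanState T e u k ∈ O) :
    ∃ P, IsWaveProfile lam r shock P (fanProfile lam T s ε u) := by
  have hκ := hD.κ_pos
  set st : ℕ → E := fanState T ε u with hst'
  have hstO : ∀ k, st k ∈ O := hfan ε fun _ => le_rfl
  let p : Fin N → ℝ := fun j => waveStart (ε j) (lam j (st j)) (s j (ε j, st j))
  let q : Fin N → ℝ := fun j => waveEnd (ε j) (lam j (st j)) (s j (ε j, st j))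
  have hpq : ∀ j, p j ≤ q j := fun j => waveStart_le_waveEnd
  have hspeeds : ∀ j : Fin N, c j + κ < p j ∧ q j < c (j + 1) - κ := fanState_waveSpeeds hD hstO hε
  have hprof : ∀ (j : Fin N) (ξ : ℝ), ξ ∈ Icc (c j) (c (j + 1)) → fanProfile lam T s ε u ξ
      = T j (waveStrength (ε j) (lam j (st j)) (s j (ε j, st j)) ξ, st j) := by
    intro j ξ hξ
    refine fanProfile_eq_of_mem hD hstO hε hξ ?_
    have h2 := hfan (fun j => waveStrength (ε j) (lam j (st j)) (s j (ε j, st j)) ξ)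
      (fun j => abs_waveStrength_le) (j + 1)
    rwa [fanState_succ, fanState_congr (ε' := ε) fun i hi =>
      waveStrength_of_gt (waveEnd_lt_of_lt hD hstO hε hξ.1 (Fin.lt_def.2 hi))] at h2
  refine ⟨Finset.univ.image p ∪ Finset.univ.image q, ?_, ?_⟩
  · intro J hJ hJc hJP
    have hp : ∀ j, p j ∉ J := fun j h => disjoint_left.1 hJP h (by simp)
    have hq : ∀ j, q j ∉ J := fun j h => disjoint_left.1 hJP h (by simp)
    by_cases hmid : ∃ ξ₀ ∈ J, ∃ j, ξ₀ ∈ Ioo (p j) (q j)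
    · obtain ⟨ξ₀, hξ₀, j, h1, h2⟩ := hmid
      right
      have hsub : J ⊆ Ioo (p j) (q j) := by
        intro ξ hξ
        constructor
        · by_contra h
          exact hp j (hJc.out hξ hξ₀ ⟨not_lt.1 h, h1.le⟩)
        · by_contra h
          exact hq j (hJc.out hξ₀ hξ ⟨h2.le, not_lt.1 h⟩)
      have hεj : 0 ≤ ε j := by
        by_contra h
        have h3 := h1.trans h2
        simp only [p, q, waveStart, waveEnd, if_pos (not_le.1 h), lt_irrefl] at h3
      have hp' : p j = lam j (st j) := if_neg (not_lt.2 hεj)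
      have hq' : q j = lam j (st j) + ε j := if_neg (not_lt.2 hεj)
      have hEq : ∀ ξ ∈ J, fanProfile lam T s ε u ξ = T j (ξ - lam j (st j), st j) := by
        intro ξ hξ
        rw [hprof j ξ ⟨by linarith [(hsub hξ).1, (hspeeds j).1],
          by linarith [(hsub hξ).2, (hspeeds j).2]⟩, waveStrength_of_mem (hsub hξ)]
      refine ⟨j, fun ξ hξ => ?_⟩
      have h3 := hsub hξ
      rw [hp', hq'] at h3
      have h4 : ξ - lam j (st j) < η := by linarith [h3.2, (abs_lt.1 (hε j)).2]
      have h5 : 0 < ξ - lam j (st j) := by linarith [h3.1]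
      rw [hEq ξ hξ]
      constructor
      · rw [hD.speed j _ (hstO j) _ h5.le h4]
        ring
      · have h6 := (hD.hasDerivWithinAt j _ (hstO j) _ h5.le h4).hasDerivAt (Ici_mem_nhds h5)
        have h7 := h6.comp_sub_const ξ (lam j (st j))
        refine h7.congr_of_eventuallyEq ?_
        filter_upwards [hJ.mem_nhds hξ] with x hx using hEq x hx
    · left
      push Not at hmid
      rcases J.eq_empty_or_nonempty with rfl | ⟨ξ₀, hξ₀⟩
      · exact ⟨u, by simp⟩
      refine ⟨fanProfile lam T s ε u ξ₀, fun ξ hξ => fanState_congr fun i _ => ?_⟩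
      have hside : ∀ x ∈ J, x < p i ∨ q i < x := by
        intro x hx
        by_contra! h
        rcases h.1.lt_or_eq with h1 | h1
        · rcases h.2.lt_or_eq with h2 | h2
          · exact hmid x hx i ⟨h1, h2⟩
          · exact hq i (h2 ▸ hx)
        · exact hp i (h1 ▸ hx)
      rcases hside ξ hξ with h1 | h1 <;> rcases hside ξ₀ hξ₀ with h2 | h2
      · exact (waveStrength_of_lt h1).trans (waveStrength_of_lt h2).symm
      · exact absurd (hJc.out hξ hξ₀ ⟨h1.le, (hpq i).trans h2.le⟩) (hp i)
      · exact absurd (hJc.out hξ₀ hξ ⟨h2.le, (hpq i).trans h1.le⟩) (hp i)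
      · exact (waveStrength_of_gt h1).trans (waveStrength_of_gt h2).symm
  · intro σ hσ
    obtain ⟨j, hj⟩ : ∃ j, σ = p j ∨ σ = q j := by
      simp only [Finset.mem_union, Finset.mem_image, Finset.mem_univ, true_and] at hσ
      rcases hσ with ⟨j, h⟩ | ⟨j, h⟩
      · exact ⟨j, Or.inl h.symm⟩
      · exact ⟨j, Or.inr h.symm⟩
    have hσ1 : c j < σ := by rcases hj with rfl | rfl <;> linarith [(hspeeds j).1, hpq j]
    have hσ2 : σ < c (j + 1) := by rcases hj with rfl | rfl <;> linarith [(hspeeds j).2, hpq j]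
    have hnear : fanProfile lam T s ε u =ᶠ[𝓝 σ] fun ξ =>
        T j (waveStrength (ε j) (lam j (st j)) (s j (ε j, st j)) ξ, st j) := by
      filter_upwards [Icc_mem_nhds hσ1 hσ2] with ξ hξ using hprof j ξ hξ
    by_cases hεj : ε j < 0
    · have hp' : p j = s j (ε j, st j) := if_pos hεj
      have hq' : q j = s j (ε j, st j) := if_pos hεj
      have hσ' : σ = s j (ε j, st j) := by rcases hj with h | h <;> simp [h, hp', hq']
      refine ⟨st j, T j (ε j, st j), ?_, ?_, Or.inr ?_⟩
      · refine tendsto_const_nhds.congr' ?_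
        filter_upwards [nhdsWithin_le_nhds hnear, self_mem_nhdsWithin] with ξ h1 h2
        have h2 : ξ < p j := by rw [hp', ← hσ']; exact h2
        rw [h1, waveStrength_of_lt h2, hD.zero j _ (hstO j)]
      · refine tendsto_const_nhds.congr' ?_
        filter_upwards [nhdsWithin_le_nhds hnear, self_mem_nhdsWithin] with ξ h1 h2
        have h2 : q j < ξ := by rw [hq', ← hσ']; exact h2
        rw [h1, waveStrength_of_gt h2]
      · rw [hσ']
        obtain ⟨h1, h2⟩ := hD.shock_of_neg j _ (hstO j) _ (abs_lt.1 (hε j)).1 hεj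
        exact ⟨h1, j, h2⟩
    · have hcont : ContinuousAt (fun ξ =>
          T j (waveStrength (ε j) (lam j (st j)) (s j (ε j, st j)) ξ, st j)) σ := by
        simp only [waveStrength, if_neg hεj]
        have h0 : ∀ ξ, 0 ≤ max 0 (min (ξ - lam j (st j)) (ε j)) := fun ξ => le_max_left _ _
        have h1 : max 0 (min (σ - lam j (st j)) (ε j)) < η :=
          max_lt hD.η_pos ((min_le_right _ _).trans_lt (abs_lt.1 (hε j)).2)
        have h2 := (hD.hasDerivWithinAt j _ (hstO j) _ (h0 σ) h1).continuousWithinAt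
        have h3 : Tendsto (fun ξ => max 0 (min (ξ - lam j (st j)) (ε j))) (𝓝 σ)
            (𝓝[Ici 0] (max 0 (min (σ - lam j (st j)) (ε j)))) :=
          tendsto_nhdsWithin_iff.2 ⟨Continuous.tendsto (by fun_prop) σ,
            Eventually.of_forall h0⟩
        exact h2.tendsto.comp h3
      have h4 := hcont.tendsto.congr' hnear.symm
      exact ⟨_, _, h4.mono_left nhdsWithin_le_nhds, h4.mono_left nhdsWithin_le_nhds, Or.inl rfl⟩

end FanProfile

theorem forall_mem_Icc_of_propagate_right {Q : ℝ → Prop} {a b : ℝ}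
    (h : ∀ m ∈ Icc a b, (∀ x ∈ Ico a m, Q x) → Q m ∧ ∀ᶠ x in 𝓝[>] m, Q x) :
    ∀ x ∈ Icc a b, Q x := by
  by_contra! hcon
  obtain ⟨x₀, hx₀, hQ⟩ := hcon
  set B := {x ∈ Icc a b | ¬ Q x} with hB
  have hne : B.Nonempty := ⟨x₀, hx₀, hQ⟩
  have hbdd : BddBelow B := ⟨a, fun x hx => hx.1.1⟩
  set m := sInf B with hm
  have ham : a ≤ m := le_csInf hne fun x hx => hx.1.1
  have hmb : m ≤ b := (csInf_le hbdd ⟨hx₀, hQ⟩).trans hx₀.2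
  have hbelow : ∀ x ∈ Ico a m, Q x := by
    intro x hx
    by_contra hxQ
    exact absurd (csInf_le hbdd ⟨⟨hx.1, hx.2.le.trans hmb⟩, hxQ⟩) (not_le.2 hx.2)
  obtain ⟨h1, h2⟩ := h m ⟨ham, hmb⟩ hbelow
  obtain ⟨d, hd, h3⟩ := mem_nhdsGT_iff_exists_Ioo_subset.1 h2
  obtain ⟨x, hxB, hxd⟩ := exists_lt_of_csInf_lt hne (show sInf B < d from hd)
  rcases (csInf_le hbdd hxB).lt_or_eq with h4 | h4
  · exact hxB.2 (h3 ⟨h4, hxd⟩)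
  · exact hxB.2 (h4 ▸ h1)

theorem forall_mem_Icc_of_propagate_left {Q : ℝ → Prop} {a b : ℝ}
    (h : ∀ m ∈ Icc a b, (∀ x ∈ Ioc m b, Q x) → Q m ∧ ∀ᶠ x in 𝓝[<] m, Q x) :
    ∀ x ∈ Icc a b, Q x := by
  have key := forall_mem_Icc_of_propagate_right (Q := fun x => Q (-x)) (a := -b) (b := -a) ?_
  · intro x hx
    simpa using key (-x) ⟨by linarith [hx.2], by linarith [hx.1]⟩
  · intro m hm hQ
    obtain ⟨h1, h2⟩ := h (-m) ⟨by linarith [hm.2], by linarith [hm.1]⟩ fun x hx => by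
      simpa using hQ (-x) ⟨by linarith [hx.2], by linarith [hx.1]⟩
    exact ⟨h1, (tendsto_neg_nhdsGT (a := m)).eventually h2⟩

theorem Finset.eventually_nhdsNE_notMem (P : Finset ℝ) (ξ : ℝ) : ∀ᶠ x in 𝓝[≠] ξ, x ∉ P := by
  have h1 : ((P : Set ℝ) \ {ξ})ᶜ ∈ 𝓝 ξ :=
    (P.finite_toSet.subset fun _ h => h.1 : ((P : Set ℝ) \ {ξ}).Finite).isClosed.isOpen_compl.mem_nhds (by simp)
  filter_upwards [nhdsWithin_le_nhds h1, self_mem_nhdsWithin] with x h2 h3 h4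
  exact h2 ⟨h4, h3⟩

theorem Finset.eventually_nhdsGT_notMem (P : Finset ℝ) (ξ : ℝ) : ∀ᶠ x in 𝓝[>] ξ, x ∉ P :=
  (P.eventually_nhdsNE_notMem ξ).filter_mono (nhdsWithin_mono _ fun _ h => ne_of_gt h)

theorem Finset.eventually_nhdsLT_notMem (P : Finset ℝ) (ξ : ℝ) : ∀ᶠ x in 𝓝[<] ξ, x ∉ P :=
  (P.eventually_nhdsNE_notMem ξ).filter_mono (nhdsWithin_mono _ fun _ h => ne_of_lt h)

theorem Finset.exists_mem_Ioo_notMem (P : Finset ℝ) {a b : ℝ} (h : a < b) : ∃ x ∈ Set.Ioo a b, x ∉ P := by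
  have h0 : ∀ᶠ x in 𝓝[>] a, x ∈ Set.Ioo a b := Ioo_mem_nhdsGT h
  obtain ⟨x, h1, h2⟩ := (h0.and (P.eventually_nhdsGT_notMem a)).exists
  exact ⟨x, h1, h2⟩

section SimpleProfile

variable {E : Type*} [NormedAddCommGroup E] [NormedSpace ℝ E]

/-- In the interval `I` of speeds, the self-similar solution `w` consists of waves of a single
characteristic field. -/
structure IsSimpleProfile (lam : E → ℝ) (r : E → E) (shock : ℝ → E → E → Prop) (C : Set E)
    (P : Finset ℝ) (I : Set ℝ) (w : ℝ → E) : Prop where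
  limit : ∀ ξ ∈ I, ∃ a ∈ C, ∃ b ∈ C, Tendsto w (𝓝[<] ξ) (𝓝 a) ∧ Tendsto w (𝓝[>] ξ) (𝓝 b) ∧
    (a = b ∨ (shock ξ a b ∧ lam b < ξ ∧ ξ < lam a)) ∧ (ξ ∉ P → a = w ξ ∧ b = w ξ)
  right : ∀ ξ ∈ I, (∃ c, ∀ᶠ x in 𝓝[>] ξ, w x = c) ∨
    ∀ᶠ x in 𝓝[>] ξ, lam (w x) = x ∧ HasDerivAt w (r (w x)) x
  left : ∀ ξ ∈ I, (∃ c, ∀ᶠ x in 𝓝[<] ξ, w x = c) ∨ ∀ᶠ x in 𝓝[<] ξ, lam (w x) = x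

variable {lam : E → ℝ} {r : E → E} {shock : ℝ → E → E → Prop} {C : Set E} {P : Finset ℝ}
  {I : Set ℝ} {w : ℝ → E}

namespace IsSimpleProfile

variable (hw : IsSimpleProfile lam r shock C P I w)
  (hlam : ∀ u ∈ C, ContinuousAt lam u)
include hw hlam

theorem eq_of_speed_lt (hI : I.OrdConnected) {ξ₀ ξ₁ : ℝ} (h₀ : ξ₀ ∈ I) (h₁ : ξ₁ ∈ I)
    (hP₀ : ξ₀ ∉ P) (hP₁ : ξ₁ ∉ P) (hle : ξ₀ ≤ ξ₁) (hlt : lam (w ξ₀) < ξ₀) : w ξ₁ = w ξ₀ := by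
  refine forall_mem_Icc_of_propagate_right (Q := fun x => x ∉ P → w x = w ξ₀) ?_ ξ₁
    ⟨hle, le_rfl⟩ hP₁
  intro m hm hQ
  have hmI : m ∈ I := hI.out h₀ h₁ hm
  obtain ⟨a, haC, b, hbC, hla, hlb, hab, hmP⟩ := hw.limit m hmI
  have ha : a = w ξ₀ := by
    rcases hm.1.lt_or_eq with h | h
    · refine tendsto_nhds_unique hla (tendsto_const_nhds.congr' ?_)
      filter_upwards [Ioo_mem_nhdsLT h, P.eventually_nhdsLT_notMem m] with x hx hxP
      exact (hQ x ⟨hx.1.le, hx.2⟩ hxP).symm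
    · subst h
      exact (hmP hP₀).1
  have hb : b = w ξ₀ := by
    rcases hab with h | h
    · rw [← h, ha]
    · rw [ha] at h
      linarith [h.2.2, hm.1]
  rw [hb] at hlb hbC
  refine ⟨fun h => by rw [← (hmP h).1, ha], ?_⟩
  rcases hw.right m hmI with ⟨c, hc⟩ | hc
  · have : c = w ξ₀ := tendsto_nhds_unique (tendsto_const_nhds.congr' (hc.mono fun _ h => h.symm)) hlb
    filter_upwards [hc] with x hx _
    rw [hx, this]
  · have h2 : Tendsto (fun x => lam (w x)) (𝓝[>] m) (𝓝 m) :=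
      (tendsto_id.mono_left nhdsWithin_le_nhds).congr' (hc.mono fun x h => h.1.symm)
    have h3 := tendsto_nhds_unique ((hlam _ hbC).tendsto.comp hlb) h2
    linarith [hm.1]

theorem eq_of_lt_speed (hI : I.OrdConnected) {ξ₀ ξ₁ : ℝ} (h₀ : ξ₀ ∈ I) (h₁ : ξ₁ ∈ I)
    (hP₀ : ξ₀ ∉ P) (hP₁ : ξ₁ ∉ P) (hle : ξ₀ ≤ ξ₁) (hlt : ξ₁ < lam (w ξ₁)) : w ξ₀ = w ξ₁ := by
  refine forall_mem_Icc_of_propagate_left (Q := fun x => x ∉ P → w x = w ξ₁) ?_ ξ₀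
    ⟨le_rfl, hle⟩ hP₀
  intro m hm hQ
  have hmI : m ∈ I := hI.out h₀ h₁ hm
  obtain ⟨a, haC, b, hbC, hla, hlb, hab, hmP⟩ := hw.limit m hmI
  have hb : b = w ξ₁ := by
    rcases hm.2.lt_or_eq with h | h
    · refine tendsto_nhds_unique hlb (tendsto_const_nhds.congr' ?_)
      filter_upwards [Ioo_mem_nhdsGT h, P.eventually_nhdsGT_notMem m] with x hx hxP
      exact (hQ x ⟨hx.1, hx.2.le⟩ hxP).symm
    · subst h
      exact (hmP hP₁).2
  have ha : a = w ξ₁ := by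
    rcases hab with h | h
    · rw [h, hb]
    · rw [hb] at h
      linarith [h.2.1, hm.2]
  rw [ha] at hla haC
  refine ⟨fun h => by rw [← (hmP h).2, hb], ?_⟩
  rcases hw.left m hmI with ⟨c, hc⟩ | hc
  · have : c = w ξ₁ := tendsto_nhds_unique (tendsto_const_nhds.congr' (hc.mono fun _ h => h.symm)) hla
    filter_upwards [hc] with x hx _
    rw [hx, this]
  · have h2 : Tendsto (fun x => lam (w x)) (𝓝[<] m) (𝓝 m) :=
      (tendsto_id.mono_left nhdsWithin_le_nhds).congr' (hc.mono fun x h => h.symm)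
    have h3 := tendsto_nhds_unique ((hlam _ haC).tendsto.comp hla) h2
    linarith [hm.2]

/-- The profile is constant, with the speed equal to `ξ` in an interval in between. -/
theorem exists_phases (hI : I.OrdConnected) {a b : ℝ} (ha : a ∈ I) (hb : b ∈ I)
    (haP : a ∉ P) (hbP : b ∉ P) (hla : a < lam (w a)) (hlb : lam (w b) < b) :
    ∃ x ∈ I, ∃ y ∈ I, x ≤ y ∧ (∀ ξ ∈ I, ξ ∉ P → ξ < x → w ξ = w a) ∧
      (∀ ξ ∈ I, ξ ∉ P → y < ξ → w ξ = w b) ∧ ∀ ξ ∈ Ioo x y, ξ ∉ P → lam (w ξ) = ξ := by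
  have hab : a < b := by
    by_contra! h
    have := hw.eq_of_speed_lt hlam hI hb ha hbP haP h hlb
    rw [this] at hla
    linarith
  set X := {ξ ∈ I | ξ ∉ P ∧ ξ < lam (w ξ)} with hX
  set Y := {ξ ∈ I | ξ ∉ P ∧ lam (w ξ) < ξ} with hY
  have hXY : ∀ x ∈ X, ∀ y ∈ Y, x < y := by
    intro x hx y hy
    by_contra! h
    have h1 := hw.eq_of_speed_lt hlam hI hy.1 hx.1 hy.2.1 hx.2.1 h hy.2.2
    have h2 := hx.2.2
    rw [h1] at h2
    linarith [hy.2.2]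
  have haX : a ∈ X := ⟨ha, haP, hla⟩
  have hbY : b ∈ Y := ⟨hb, hbP, hlb⟩
  have hXb : BddAbove X := ⟨b, fun x hx => (hXY x hx b hbY).le⟩
  have hYb : BddBelow Y := ⟨a, fun y hy => (hXY a haX y hy).le⟩
  have hxy : sSup X ≤ sInf Y := csSup_le ⟨a, haX⟩ fun x hx => le_csInf ⟨b, hbY⟩ fun y hy =>
    (hXY x hx y hy).le
  have hax : a ≤ sSup X := le_csSup hXb haX
  have hyb : sInf Y ≤ b := csInf_le hYb hbY
  refine ⟨sSup X, hI.out ha hb ⟨hax, hxy.trans hyb⟩, sInf Y, hI.out ha hb ⟨hax.trans hxy, hyb⟩, hxy,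
    ?_, ?_, ?_⟩
  · intro ξ hξ hξP hlt
    obtain ⟨x, hx, hlt'⟩ := exists_lt_of_lt_csSup ⟨a, haX⟩ hlt
    have h1 := hw.eq_of_lt_speed hlam hI hξ hx.1 hξP hx.2.1 hlt'.le hx.2.2
    rcases le_total a x with h2 | h2
    · rw [h1, hw.eq_of_lt_speed hlam hI ha hx.1 haP hx.2.1 h2 hx.2.2]
    · rw [h1, hw.eq_of_lt_speed hlam hI hx.1 ha hx.2.1 haP h2 hla]
  · intro ξ hξ hξP hlt
    obtain ⟨y, hy, hlt'⟩ := exists_lt_of_csInf_lt ⟨b, hbY⟩ hlt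
    have h1 := hw.eq_of_speed_lt hlam hI hy.1 hξ hy.2.1 hξP hlt'.le hy.2.2
    rcases le_total y b with h2 | h2
    · rw [h1, hw.eq_of_speed_lt hlam hI hy.1 hb hy.2.1 hbP h2 hy.2.2]
    · rw [h1, hw.eq_of_speed_lt hlam hI hb hy.1 hbP hy.2.1 h2 hlb]
  · intro ξ hξ hξP
    have hξI : ξ ∈ I := hI.out ha hb ⟨hax.trans hξ.1.le, hξ.2.le.trans hyb⟩
    by_contra hne
    rcases lt_or_gt_of_ne hne with h | h
    · exact absurd (csInf_le hYb ⟨hξI, hξP, h⟩) (not_le.2 hξ.2)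
    · exact absurd (le_csSup hXb ⟨hξI, hξP, h⟩) (not_le.2 hξ.1)

end IsSimpleProfile

end SimpleProfile

section OneFamily

variable {E : Type*} [NormedAddCommGroup E] [NormedSpace ℝ E]

theorem IsSimpleProfile.exists_rarefaction {lam : E → ℝ} {r : E → E} {shock : ℝ → E → E → Prop}
    {C : Set E} {P : Finset ℝ} {I : Set ℝ} {w : ℝ → E} (hw : IsSimpleProfile lam r shock C P I w)
    (hlam : ∀ u ∈ C, ContinuousAt lam u) (hr : ∀ u ∈ C, ContinuousAt r u) (hIo : IsOpen I)
    {x y : ℝ} (hxy : x < y) (hI : Icc x y ⊆ I) (hmid : ∀ ξ ∈ Ioo x y, ξ ∉ P → lam (w ξ) = ξ) :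
    ∃ W : ℝ → E, ContinuousOn W (Icc x y) ∧ MapsTo W (Icc x y) C ∧
      (∀ ξ ∈ Ico x y, HasDerivWithinAt W (r (W ξ)) (Ici ξ) ξ) ∧
      ∀ ξ ∈ Icc x y, lam (W ξ) = ξ ∧ Tendsto w (𝓝[≠] ξ) (𝓝 (W ξ)) ∧ (ξ ∉ P → w ξ = W ξ) := by
  have : Nonempty E := ⟨w 0⟩
  choose! A hAC B hBC hAl hBr hAB hP using hw.limit
  have hBlam : ∀ ξ ∈ Ico x y, lam (B ξ) = ξ := by
    intro ξ hξ
    have hξI := hI ⟨hξ.1, hξ.2.le⟩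
    refine tendsto_nhds_unique ((hlam _ (hBC ξ hξI)).tendsto.comp (hBr ξ hξI))
      ((tendsto_id.mono_left nhdsWithin_le_nhds).congr' ?_)
    filter_upwards [Ioo_mem_nhdsGT hξ.2, P.eventually_nhdsGT_notMem ξ] with z hz hzP
    exact (hmid z ⟨hξ.1.trans_lt hz.1, hz.2⟩ hzP).symm
  have hAlam : ∀ ξ ∈ Ioc x y, lam (A ξ) = ξ := by
    intro ξ hξ
    have hξI := hI ⟨hξ.1.le, hξ.2⟩
    refine tendsto_nhds_unique ((hlam _ (hAC ξ hξI)).tendsto.comp (hAl ξ hξI))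
      ((tendsto_id.mono_left nhdsWithin_le_nhds).congr' ?_)
    filter_upwards [Ioo_mem_nhdsLT hξ.1, P.eventually_nhdsLT_notMem ξ] with z hz hzP
    exact (hmid z ⟨hz.1, hz.2.trans_le hξ.2⟩ hzP).symm
  have hEq : ∀ ξ ∈ Icc x y, A ξ = B ξ := by
    intro ξ hξ
    rcases hAB ξ (hI hξ) with h | ⟨-, h1, h2⟩
    · exact h
    · rcases hξ.1.lt_or_eq with h | h
      · linarith [hAlam ξ ⟨h, hξ.2⟩]
      · linarith [hBlam ξ ⟨hξ.1, h ▸ hxy⟩]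
  have hlamA : ∀ ξ ∈ Icc x y, lam (A ξ) = ξ := by
    intro ξ hξ
    rcases hξ.1.lt_or_eq with h | h
    · exact hAlam ξ ⟨h, hξ.2⟩
    · rw [hEq ξ hξ]
      exact hBlam ξ ⟨hξ.1, h ▸ hxy⟩
  have htend : ∀ ξ ∈ Icc x y, Tendsto w (𝓝[≠] ξ) (𝓝 (A ξ)) := by
    intro ξ hξ
    rw [← nhdsLT_sup_nhdsGT]
    refine (hAl ξ (hI hξ)).sup ?_
    rw [hEq ξ hξ]
    exact hBr ξ (hI hξ)
  have hAw : ∀ ξ ∈ I, ∀ᶠ z in 𝓝[≠] ξ, w z = A z := by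
    intro ξ hξ
    filter_upwards [nhdsWithin_le_nhds (hIo.mem_nhds hξ), P.eventually_nhdsNE_notMem ξ]
      with z h1 h2 using (hP z h1 h2).1.symm
  have hcont : ∀ ξ ∈ Icc x y, ContinuousAt A ξ := fun ξ hξ =>
    continuousAt_iff_punctured_nhds.2 ((htend ξ hξ).congr' (hAw ξ (hI hξ)))
  refine ⟨A, fun ξ hξ => (hcont ξ hξ).continuousWithinAt, fun ξ hξ => hAC ξ (hI hξ), ?_,
    fun ξ hξ => ⟨hlamA ξ hξ, htend ξ hξ, fun h => (hP ξ (hI hξ) h).1.symm⟩⟩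
  intro ξ hξ
  have hξ' : ξ ∈ Icc x y := ⟨hξ.1, hξ.2.le⟩
  have hgap : ∀ᶠ z in 𝓝[>] ξ, lam (w z) = z ∧ HasDerivAt w (r (w z)) z := by
    rcases hw.right ξ (hI hξ') with ⟨c, hc⟩ | h
    · exfalso
      have h0 : ∀ᶠ z in 𝓝[>] ξ, w z = c ∧ lam (w z) = z := by
        filter_upwards [hc, Ioo_mem_nhdsGT hξ.2, P.eventually_nhdsGT_notMem ξ] with z h1 hz hzP
        exact ⟨h1, hmid z ⟨hξ.1.trans_lt hz.1, hz.2⟩ hzP⟩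
      obtain ⟨d, hd, hsub⟩ := mem_nhdsGT_iff_exists_Ioo_subset.1 h0
      have hd : ξ < d := hd
      have h1 := hsub (show ξ + (d - ξ) / 2 ∈ Ioo ξ d from ⟨by linarith, by linarith⟩)
      have h2 := hsub (show ξ + (d - ξ) / 3 ∈ Ioo ξ d from ⟨by linarith, by linarith⟩)
      have h3 := h1.2
      have h4 := h2.2
      rw [h1.1] at h3
      rw [h2.1] at h4
      linarith
    · exact h
  have hgap' : ∀ᶠ z in 𝓝[>] ξ, HasDerivAt A (r (A z)) z := by
    obtain ⟨d, hd, hsub⟩ := mem_nhdsGT_iff_exists_Ioo_subset.1 (inter_mem hgap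
      (inter_mem (P.eventually_nhdsGT_notMem ξ) (nhdsWithin_le_nhds (hIo.mem_nhds (hI hξ')))))
    refine mem_nhdsGT_iff_exists_Ioo_subset.2 ⟨d, hd, fun z hz => ?_⟩
    have hAz : ∀ z ∈ Ioo ξ d, A z = w z := fun z hz => (hP z (hsub hz).2.2 (hsub hz).2.1).1
    show HasDerivAt A (r (A z)) z
    rw [hAz z hz]
    refine (hsub hz).1.2.congr_of_eventuallyEq ?_
    filter_upwards [Ioo_mem_nhds hz.1 hz.2] using hAz
  obtain ⟨d, hd, hsub⟩ := mem_nhdsGT_iff_exists_Ioo_subset.1 hgap'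
  refine hasDerivWithinAt_Ici_of_tendsto_deriv (s := Ioo ξ d)
    (fun z hz => (hsub hz).differentiableAt.differentiableWithinAt)
    (hcont ξ hξ').continuousWithinAt (Ioo_mem_nhdsGT hd) ?_
  have h1 : Tendsto (fun z => r (A z)) (𝓝[>] ξ) (𝓝 (r (A ξ))) :=
    ((hr _ (hAC ξ (hI hξ'))).tendsto.comp (hcont ξ hξ').tendsto).mono_left nhdsWithin_le_nhds
  exact h1.congr' (hgap'.mono fun z hz => hz.deriv.symm)

variable {N : ℕ} {lam : Fin N → E → ℝ} {r : Fin N → E → E} {shock : ℝ → E → E → Prop}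
  {T : Fin N → ℝ × E → E} {s : Fin N → ℝ × E → ℝ} {c : ℕ → ℝ} {κ η : ℝ} {O C : Set E}
  {P : Finset ℝ} {I : Set ℝ} {w : ℝ → E}

theorem IsSimpleProfile.exists_strength (hD : IsFanDomain lam r shock T s c κ η O) {j : Fin N}
    (hw : IsSimpleProfile (lam j) (r j) shock C P I w) (hCO : C ⊆ O) (hIo : IsOpen I)
    (hI : I.OrdConnected) (hwC : ∀ ξ, w ξ ∈ C) {a b : ℝ} (ha : a ∈ I) (hb : b ∈ I) (haP : a ∉ P)
    (hbP : b ∉ P) (hla : a < lam j (w a)) (hlb : lam j (w b) < b) :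
    ∃ ε, |ε| < η ∧ w b = T j (ε, w a) ∧ ∀ ξ ∈ I, ξ ∉ P →
      w ξ = T j (waveStrength ε (lam j (w a)) (s j (ε, w a)) ξ, w a) := by
  have hlam : ∀ u ∈ C, ContinuousAt (lam j) u := fun u hu => hD.continuousAt_speed j u (hCO hu)
  have hr : ∀ u ∈ C, ContinuousAt (r j) u := fun u hu => hD.continuousAt_field j u (hCO hu)
  have hz : T j (0, w a) = w a := hD.zero j _ (hCO (hwC a))
  obtain ⟨x, hx, y, hy, hxy, hleft, hright, hmid⟩ := hw.exists_phases hlam hI ha hb haP hbP hla hlb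
  have hl : Tendsto w (𝓝[<] x) (𝓝 (w a)) := by
    refine tendsto_const_nhds.congr' ?_
    filter_upwards [nhdsWithin_le_nhds (hIo.mem_nhds hx), P.eventually_nhdsLT_notMem x,
      self_mem_nhdsWithin] with ξ h1 h2 h3 using (hleft ξ h1 h2 h3).symm
  have hr' : Tendsto w (𝓝[>] y) (𝓝 (w b)) := by
    refine tendsto_const_nhds.congr' ?_
    filter_upwards [nhdsWithin_le_nhds (hIo.mem_nhds hy), P.eventually_nhdsGT_notMem y,
      self_mem_nhdsWithin] with ξ h1 h2 h3 using (hright ξ h1 h2 h3).symm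
  rcases hxy.lt_or_eq with hlt | rfl
  · have hsub : Icc x y ⊆ I := hI.out hx hy
    obtain ⟨W, hWc, hWC, hWd, hW⟩ := hw.exists_rarefaction hlam hr hIo hlt hsub hmid
    have hWx : W x = w a := tendsto_nhds_unique
      ((hW x ⟨le_rfl, hxy⟩).2.1.mono_left (nhdsLT_le_nhdsNE x)) hl
    have hWy : W y = w b := tendsto_nhds_unique
      ((hW y ⟨hxy, le_rfl⟩).2.1.mono_left (nhdsGT_le_nhdsNE y)) hr'
    have hlx : lam j (w a) = x := hWx ▸ (hW x ⟨le_rfl, hxy⟩).1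
    have hly : lam j (w b) = y := hWy ▸ (hW y ⟨hxy, le_rfl⟩).1
    have hη : y - x < η := by
      have := hD.oscillation j _ (hCO (hwC b)) _ (hCO (hwC a))
      rwa [hlx, hly] at this
    have hint := hD.eq_of_integralCurve j x y W hη hWc hWd fun ξ hξ => hCO (hWC hξ)
    rw [hWx] at hint
    have hwb : w b = T j (y - x, w a) := by
      rw [← hWy]
      exact hint y ⟨hxy, le_rfl⟩
    have h0 : ¬ y - x < 0 := by linarith
    refine ⟨y - x, by rwa [abs_of_nonneg (by linarith)], hwb, ?_⟩
    intro ξ hξ hξP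
    rcases lt_or_ge ξ x with h1 | h1
    · rw [waveStrength_of_lt (by rwa [waveStart, if_neg h0, hlx]), hz]
      exact hleft ξ hξ hξP h1
    rcases lt_or_ge y ξ with h2 | h2
    · rw [waveStrength_of_gt (by rw [waveEnd, if_neg h0, hlx]; linarith), ← hwb]
      exact hright ξ hξ hξP h2
    · rw [(hW ξ ⟨h1, h2⟩).2.2 hξP, hint ξ ⟨h1, h2⟩, waveStrength, if_neg h0, hlx,
        min_eq_left (by linarith), max_eq_right (by linarith)]
  · obtain ⟨A, hAC, B, hBC, hA, hB, hAB, hP⟩ := hw.limit x hx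
    have hA' : A = w a := tendsto_nhds_unique hA hl
    have hB' : B = w b := tendsto_nhds_unique hB hr'
    subst hA' hB'
    rcases hAB with h | ⟨h1, h2, h3⟩
    · refine ⟨0, by simpa using hD.η_pos, by rw [hz, h], ?_⟩
      intro ξ hξ hξP
      have h4 : waveStrength 0 (lam j (w a)) (s j (0, w a)) ξ = 0 := by simp [waveStrength]
      rw [h4, hz]
      rcases lt_trichotomy ξ x with h5 | rfl | h5
      · exact hleft ξ hξ hξP h5
      · exact (hP hξP).1.symm
      · rw [h]
        exact hright ξ hξ hξP h5
    · obtain ⟨ε, h4, h5, h6, h7⟩ := hD.exists_of_shock j _ (hCO hAC) _ (hCO hBC) x h1 h2 h3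
      refine ⟨ε, abs_lt.2 ⟨h4, h5.trans hD.η_pos⟩, h6, ?_⟩
      intro ξ hξ hξP
      rw [waveStrength, if_pos h5, ← h7]
      split_ifs with h8
      · rw [hz]
        exact hleft ξ hξ hξP h8
      · rw [← h6]
        rcases (not_lt.1 h8).lt_or_eq with h9 | rfl
        · exact hright ξ hξ hξP h9
        · exact (hP hξP).2.symm

/-- In a region of speeds that are attained by at most one field, the profile is simple. -/
theorem IsWaveProfile.isSimpleProfile (hw : IsWaveProfile lam r shock P w) (hC : IsClosed C)
    (hwC : ∀ ξ, w ξ ∈ C) (hIo : IsOpen I) {lam' : E → ℝ} {r' : E → E}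
    (h : ∀ i, ∀ ξ ∈ I, ∀ a ∈ C, ∀ b ∈ C, lam i b ≤ ξ → ξ ≤ lam i a → lam i = lam' ∧ r i = r') :
    IsSimpleProfile lam' r' shock C P I w := by
  have hgap : ∀ J : Set ℝ, IsOpen J → J.OrdConnected → Disjoint J (P : Set ℝ) → J ⊆ I →
      (∃ c, ∀ ξ ∈ J, w ξ = c) ∨ ∀ ξ ∈ J, lam' (w ξ) = ξ ∧ HasDerivAt w (r' (w ξ)) ξ := by
    intro J hJ hJc hJP hJI
    rcases hw.gap J hJ hJc hJP with h1 | ⟨i, hi⟩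
    · exact Or.inl h1
    · refine Or.inr fun ξ hξ => ?_
      obtain ⟨h1, h2⟩ := h i ξ (hJI hξ) _ (hwC ξ) _ (hwC ξ) (hi ξ hξ).1.le (hi ξ hξ).1.ge
      rw [← h1, ← h2]
      exact hi ξ hξ
  refine ⟨fun ξ hξ => ?_, fun ξ hξ => ?_, fun ξ hξ => ?_⟩
  · by_cases hξP : ξ ∈ P
    · obtain ⟨a, b, ha, hb, hab⟩ := hw.ray ξ hξP
      have haC : a ∈ C := hC.mem_of_tendsto ha (Eventually.of_forall hwC)
      have hbC : b ∈ C := hC.mem_of_tendsto hb (Eventually.of_forall hwC)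
      refine ⟨a, haC, b, hbC, ha, hb, ?_, fun h => absurd hξP h⟩
      rcases hab with h1 | ⟨h1, i, h2, h3⟩
      · exact Or.inl h1
      · refine Or.inr ⟨h1, ?_⟩
        rw [← (h i ξ hξ a haC b hbC h2.le h3.le).1]
        exact ⟨h2, h3⟩
    · have hnhds : I \ (P : Set ℝ) ∈ 𝓝 ξ :=
        (hIo.sdiff P.finite_toSet.isClosed).mem_nhds ⟨hξ, hξP⟩
      obtain ⟨l, u, hlu, hsub⟩ := mem_nhds_iff_exists_Ioo_subset.1 hnhds
      have hcont : ContinuousAt w ξ := by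
        rcases hgap (Ioo l u) isOpen_Ioo ordConnected_Ioo
          (disjoint_left.2 fun x hx => (hsub hx).2) fun x hx => (hsub hx).1 with ⟨c, hc⟩ | h1
        · have : w =ᶠ[𝓝 ξ] fun _ => c := by
            filter_upwards [Ioo_mem_nhds hlu.1 hlu.2] using hc
          exact continuousAt_const.congr this.symm
        · exact (h1 ξ hlu).2.continuousAt
      exact ⟨w ξ, hwC ξ, w ξ, hwC ξ, hcont.mono_left nhdsWithin_le_nhds,
        hcont.mono_left nhdsWithin_le_nhds, Or.inl rfl, fun _ => ⟨rfl, rfl⟩⟩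
  · obtain ⟨d, hd, hsub⟩ := mem_nhdsGT_iff_exists_Ioo_subset.1 (inter_mem
      (nhdsWithin_le_nhds (hIo.mem_nhds hξ)) (P.eventually_nhdsGT_notMem ξ))
    rcases hgap (Ioo ξ d) isOpen_Ioo ordConnected_Ioo
      (disjoint_left.2 fun x hx => (hsub hx).2) fun x hx => (hsub hx).1 with ⟨c, hc⟩ | h1
    · exact Or.inl ⟨c, by filter_upwards [Ioo_mem_nhdsGT hd] using hc⟩
    · exact Or.inr (by filter_upwards [Ioo_mem_nhdsGT hd] using h1)
  · obtain ⟨d, hd, hsub⟩ := mem_nhdsLT_iff_exists_Ioo_subset.1 (inter_mem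
      (nhdsWithin_le_nhds (hIo.mem_nhds hξ)) (P.eventually_nhdsLT_notMem ξ))
    rcases hgap (Ioo d ξ) isOpen_Ioo ordConnected_Ioo
      (disjoint_left.2 fun x hx => (hsub hx).2) fun x hx => (hsub hx).1 with ⟨c, hc⟩ | h1
    · exact Or.inl ⟨c, by filter_upwards [Ioo_mem_nhdsLT hd] using hc⟩
    · exact Or.inr (by filter_upwards [Ioo_mem_nhdsLT hd] with x hx using (h1 x hx).1)

end OneFamily

section FanUniqueness

variable {E : Type*} [NormedAddCommGroup E] [NormedSpace ℝ E] {N : ℕ} {lam : Fin N → E → ℝ}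
  {r : Fin N → E → E} {shock : ℝ → E → E → Prop} {T : Fin N → ℝ × E → E} {s : Fin N → ℝ × E → ℝ}
  {c : ℕ → ℝ} {κ η : ℝ} {O C : Set E} {P : Finset ℝ} {w : ℝ → E}

theorem IsWaveProfile.exists_eq_fanProfile (hD : IsFanDomain lam r shock T s c κ η O)
    (hw : IsWaveProfile lam r shock P w) (hC : IsClosed C) (hCO : C ⊆ O) (hwC : ∀ ξ, w ξ ∈ C)
    {ul ur : E} (hl : Tendsto w atBot (𝓝 ul)) (hr : Tendsto w atTop (𝓝 ur)) :
    ∃ ε : Fin N → ℝ, (∀ j, |ε j| < η) ∧ fanState T ε ul N = ur ∧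
      ∀ ξ, ξ ∉ P → w ξ = fanProfile lam T s ε ul ξ := by
  have hκ := hD.κ_pos
  choose β hβ hβP using fun k : ℕ =>
    P.exists_mem_Ioo_notMem (show c k - κ < c k + κ by linarith)
  have hPbot : ∀ᶠ ξ in atBot, ξ ∉ P := by
    obtain ⟨M, hM⟩ := P.bddBelow
    filter_upwards [eventually_lt_atBot M] with ξ h1 h2
    exact absurd (hM h2) (not_le.2 h1)
  have hPtop : ∀ᶠ ξ in atTop, ξ ∉ P := by
    obtain ⟨M, hM⟩ := P.bddAbove
    filter_upwards [eventually_gt_atTop M] with ξ h1 h2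
    exact absurd (hM h2) (not_le.2 h1)
  have hleft : ∀ ξ < c 0 + κ, ξ ∉ P → w ξ = w (β 0) := by
    have hs : IsSimpleProfile (fun _ => c 0 + κ) 0 shock C P (Iio (c 0 + κ)) w := by
      refine hw.isSimpleProfile hC hwC isOpen_Iio fun i ξ hξ a _ b hb h1 _ => ?_
      have h3 := hD.lt_speed i b (hCO hb)
      have h4 : c 0 ≤ c i := hD.strictMono.monotone (Nat.zero_le _)
      have h5 : ξ < c 0 + κ := hξ
      linarith
    intro ξ hξ hξP
    rcases le_total ξ (β 0) with h | h
    · exact hs.eq_of_lt_speed (fun _ _ => continuousAt_const) ordConnected_Iio hξ (hβ 0).2 hξP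
        (hβP 0) h (hβ 0).2
    · exact (hs.eq_of_lt_speed (fun _ _ => continuousAt_const) ordConnected_Iio (hβ 0).2 hξ (hβP 0)
        hξP h hξ).symm
  have hright : ∀ ξ, c N - κ < ξ → ξ ∉ P → w ξ = w (β N) := by
    have hs : IsSimpleProfile (fun _ => c N - κ) 0 shock C P (Ioi (c N - κ)) w := by
      refine hw.isSimpleProfile hC hwC isOpen_Ioi fun i ξ hξ a ha b hb _ h2 => ?_
      have h3 := hD.speed_lt i a (hCO ha)
      have h4 : c (i + 1) ≤ c N := hD.strictMono.monotone i.2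
      have h5 : c N - κ < ξ := hξ
      linarith
    intro ξ hξ hξP
    rcases le_total ξ (β N) with h | h
    · exact (hs.eq_of_speed_lt (fun _ _ => continuousAt_const) ordConnected_Ioi hξ (hβ N).1 hξP
        (hβP N) h hξ).symm
    · exact hs.eq_of_speed_lt (fun _ _ => continuousAt_const) ordConnected_Ioi (hβ N).1 hξ (hβP N)
        hξP h (hβ N).1
  have hul : w (β 0) = ul := by
    refine tendsto_nhds_unique (tendsto_const_nhds.congr' ?_) hl
    filter_upwards [hPbot, eventually_lt_atBot (c 0 + κ)] with ξ h1 h2 using (hleft ξ h2 h1).symm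
  have hur : w (β N) = ur := by
    refine tendsto_nhds_unique (tendsto_const_nhds.congr' ?_) hr
    filter_upwards [hPtop, eventually_gt_atTop (c N - κ)] with ξ h1 h2 using (hright ξ h2 h1).symm
  have hfam : ∀ j : Fin N, ∃ ε, |ε| < η ∧ w (β (j + 1)) = T j (ε, w (β j)) ∧
      ∀ ξ ∈ Ioo (c j - κ) (c (j + 1) + κ), ξ ∉ P →
        w ξ = T j (waveStrength ε (lam j (w (β j))) (s j (ε, w (β j))) ξ, w (β j)) := by
    intro j
    have hcj : c j < c (j + 1) := hD.strictMono (Nat.lt_succ_self _)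
    have h0 := hD.lt_speed j _ (hCO (hwC (β j)))
    have h1 := hD.speed_lt j _ (hCO (hwC (β (j + 1))))
    have hs : IsSimpleProfile (lam j) (r j) shock C P (Ioo (c j - κ) (c (j + 1) + κ)) w := by
      refine hw.isSimpleProfile hC hwC isOpen_Ioo fun i ξ hξ a ha b hb h2 h3 => ?_
      have h4 := hD.lt_speed i b (hCO hb)
      have h5 := hD.speed_lt i a (hCO ha)
      rcases lt_trichotomy i j with h | rfl | h
      · have h6 : c (i + 1) ≤ c j := hD.strictMono.monotone (Fin.lt_def.1 h)
        linarith [hξ.1]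
      · exact ⟨rfl, rfl⟩
      · have h6 : c (j + 1) ≤ c i := hD.strictMono.monotone (Fin.lt_def.1 h)
        linarith [hξ.2]
    exact hs.exists_strength hD hCO isOpen_Ioo ordConnected_Ioo hwC
      ⟨(hβ j).1, by linarith [(hβ j).2]⟩ ⟨by linarith [(hβ (j + 1)).1], (hβ (j + 1)).2⟩ (hβP _) (hβP _)
      (by linarith [(hβ j).2]) (by linarith [(hβ (j + 1)).1])
  choose ε hε hstep hwave using hfam
  have hst : ∀ k ≤ N, fanState T ε ul k = w (β k) := by
    intro k
    induction k with
    | zero => exact fun _ => hul.symm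
    | succ k ih =>
      intro hk
      have h1 := fanState_succ (T := T) ε ul ⟨k, hk⟩
      simp only at h1
      rw [h1, ih (by omega), hstep ⟨k, hk⟩]
  have hstO : ∀ k, fanState T ε ul k ∈ O := by
    intro k
    rcases le_total k N with h | h
    · rw [hst k h]
      exact hCO (hwC _)
    · induction k, h using Nat.le_induction with
      | base =>
        rw [hst N le_rfl]
        exact hCO (hwC _)
      | succ k hk ih => rwa [fanState, dif_neg (by omega)]
  refine ⟨ε, hε, by rw [hst N le_rfl, hur], fun ξ hξ => ?_⟩
  rcases le_total ξ (c 0) with h0 | h0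
  · rw [fanProfile_of_le hD hstO hε h0, hleft ξ (by linarith) hξ, hul]
  rcases le_or_gt (c N) ξ with hN | hN
  · rw [fanProfile_of_ge hD hstO hε hN, hright ξ (by linarith) hξ, hst N le_rfl]
  obtain ⟨j, hj⟩ : ∃ j : Fin N, ξ ∈ Icc (c j) (c (j + 1)) := by
    by_contra! hcon
    have : ∀ k ≤ N, c k ≤ ξ := by
      intro k
      induction k with
      | zero => exact fun _ => h0
      | succ k ih =>
        intro hk
        by_contra! h
        exact hcon ⟨k, hk⟩ ⟨ih (by omega), h.le⟩
    exact absurd (this N le_rfl) (not_le.2 hN)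
  have h1 := hwave j ξ ⟨by linarith [hj.1], by linarith [hj.2]⟩ hξ
  rw [← hst j j.2.le] at h1
  rw [fanProfile_eq_of_mem hD hstO hε hj (h1 ▸ hCO (hwC ξ)), h1]

end FanUniqueness

namespace NonconservativeSystem

theorem contDiffOn_ratio : ContDiffOn ℝ 1 (fun z : ℝ × ℝ => z.2 / z.1) {z | 0 < z.1} :=
  contDiffOn_snd.div contDiffOn_fst fun _ h => ne_of_gt h

theorem isOpen_sector {J : Set ℝ} (hJ : IsOpen J) : IsOpen (sector J) :=
  contDiffOn_ratio.continuousOn.isOpen_inter_preimage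
    (isOpen_lt continuous_const continuous_fst) hJ

theorem mem_sector_one {J : Set ℝ} {ξ : ℝ} : ((1 : ℝ), ξ) ∈ sector J ↔ ξ ∈ J := by
  simp [sector]

/-- The derivative of `x / t` at a point `(t, x)`. -/
noncomputable def ratioDeriv (z : ℝ × ℝ) : ℝ × ℝ →L[ℝ] ℝ :=
  z.1⁻¹ • (ContinuousLinearMap.snd ℝ ℝ ℝ - (z.2 / z.1) • ContinuousLinearMap.fst ℝ ℝ ℝ)

theorem hasFDerivAt_ratio {z : ℝ × ℝ} (hz : 0 < z.1) :
    HasFDerivAt (fun z : ℝ × ℝ => z.2 / z.1) (ratioDeriv z) z := by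
  have h1 := (hasDerivAt_inv hz.ne').comp_hasFDerivAt z (hasFDerivAt_fst (𝕜 := ℝ) (p := z))
  have h := (hasFDerivAt_snd (𝕜 := ℝ) (p := z)).mul h1
  simp only [Function.comp_def] at h
  refine h.congr_fderiv (ContinuousLinearMap.ext fun d => ?_)
  have := hz.ne'
  simp [ratioDeriv]
  field_simp
  ring

theorem hasFDerivAt_comp_ratio {E : Type*} [NormedAddCommGroup E] [NormedSpace ℝ E] {W : ℝ → E}
    {W' : E} {z : ℝ × ℝ} (hz : 0 < z.1) (hW : HasDerivAt W W' (z.2 / z.1)) :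
    HasFDerivAt (fun z : ℝ × ℝ => W (z.2 / z.1)) ((ratioDeriv z).smulRight W') z := by
  refine (hW.hasFDerivAt.comp z (hasFDerivAt_ratio hz)).congr_fderiv
    (ContinuousLinearMap.ext fun d => ?_)
  simp

variable {m p : ℕ} {S : NonconservativeSystem m p} {Ω : Set (PhaseState m p)}

theorem isClassicalSolutionOn_of_quasilinear (hS : S.IsSmoothOn Ω) (hΩ : IsOpen Ω) {D : Set (ℝ × ℝ)}
    {u : ℝ × ℝ → PhaseState m p} (hD : IsOpen D) (hu : ContDiffOn ℝ 1 u D) (hmaps : MapsTo u D Ω)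
    (heq : ∀ z ∈ D, dTime u z + S.A (u z) (dSpace u z) = 0) : S.IsClassicalSolutionOn D u := by
  have hdu : ∀ z ∈ D, HasFDerivAt u (fderiv ℝ u z) z := fun z hz =>
    ((hu.contDiffAt (hD.mem_nhds hz)).differentiableAt one_ne_zero).hasFDerivAt
  refine ⟨hu, fun z hz => ?_, fun z hz => ?_⟩
  · have hg : HasFDerivAt S.g (fderiv ℝ S.g (u z)) (u z) :=
      ((hS.smooth_g.contDiffAt (hΩ.mem_nhds (hmaps hz))).differentiableAt (by simp)).hasFDerivAt
    have h1 := (hdu z hz).fst.fderiv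
    have h2 := (hg.comp z (hdu z hz)).fderiv
    have h3 := congrArg Prod.fst (heq z hz)
    simp only [Function.comp_def] at h2
    simp only [dTime, dSpace, h1, h2]
    exact h3
  · have h1 := (hdu z hz).fst.fderiv
    have h2 := (hdu z hz).snd.fderiv
    have h3 := congrArg Prod.snd (heq z hz)
    simp only [dTime, dSpace, h1, h2]
    rw [add_assoc]
    exact h3

theorem isClassicalSolutionOn_sector (hS : S.IsSmoothOn Ω) (hΩ : IsOpen Ω) {J : Set ℝ} (hJ : IsOpen J)
    {u : ℝ × ℝ → PhaseState m p} {W : ℝ → PhaseState m p}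
    (huW : ∀ z ∈ sector J, u z = W (z.2 / z.1)) (hW : ContDiffOn ℝ 1 W J) (hmaps : MapsTo W J Ω)
    (heq : ∀ ξ ∈ J, S.A (W ξ) (deriv W ξ) = ξ • deriv W ξ) :
    S.IsClassicalSolutionOn (sector J) u := by
  have hc : ContDiffOn ℝ 1 (fun z : ℝ × ℝ => W (z.2 / z.1)) (sector J) :=
    hW.comp (contDiffOn_ratio.mono fun z hz => hz.1) fun z hz => hz.2
  refine isClassicalSolutionOn_of_quasilinear hS hΩ (isOpen_sector hJ) (hc.congr huW)
    (fun z hz => by rw [huW z hz]; exact hmaps hz.2) fun z hz => ?_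
  have h1 : HasDerivAt W (deriv W (z.2 / z.1)) (z.2 / z.1) :=
    ((hW.contDiffAt (hJ.mem_nhds hz.2)).differentiableAt one_ne_zero).hasDerivAt
  have h2 : HasFDerivAt u ((ratioDeriv z).smulRight (deriv W (z.2 / z.1))) z := by
    refine (hasFDerivAt_comp_ratio hz.1 h1).congr_of_eventuallyEq ?_
    filter_upwards [(isOpen_sector hJ).mem_nhds hz] with y hy using huW y hy
  rw [dTime, dSpace, h2.fderiv, huW z hz, ContinuousLinearMap.smulRight_apply,
    ContinuousLinearMap.smulRight_apply, map_smul, heq _ hz.2, smul_smul, ← add_smul]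
  have h3 : ratioDeriv z (1, 0) + ratioDeriv z (0, 1) * (z.2 / z.1) = 0 := by
    simp [ratioDeriv]
  rw [h3, zero_smul]

/-- The matrix of the quasilinear form as a continuous linear map. -/
noncomputable def ACLM (S : NonconservativeSystem m p) (u : PhaseState m p) :
    PhaseState m p →L[ℝ] PhaseState m p :=
  LinearMap.toContinuousLinearMap (S.A u)

theorem contDiffOn_ACLM (hS : S.IsSmoothOn Ω) (hΩ : IsOpen Ω) : ContDiffOn ℝ ∞ S.ACLM Ω := by
  rw [contDiffOn_clm_apply]
  intro y
  have h1 : ContDiffOn ℝ ∞ (fun u => fderiv ℝ S.g u y) Ω :=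
    (hS.smooth_g.fderiv_of_isOpen hΩ (by simp)).clm_apply contDiffOn_const
  have h2 : ContDiffOn ℝ ∞ (fun u => (S.B u).mulVec y.1) Ω := by
    rw [contDiffOn_pi]
    intro i
    simp only [Matrix.mulVec, dotProduct]
    exact ContDiffOn.sum fun k _ => (hS.smooth_B i k).mul contDiffOn_const
  have h3 : ContDiffOn ℝ ∞ (fun u => (S.C u).mulVec y.2) Ω := by
    rw [contDiffOn_pi]
    intro i
    simp only [Matrix.mulVec, dotProduct]
    exact ContDiffOn.sum fun k _ => (hS.smooth_C i k).mul contDiffOn_const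
  exact h1.prodMk (h2.add h3)

/-- Centered rarefaction waves turn the entropy balance into a relation for the gradients. -/
theorem IsEntropyPair.fderiv_flux_of_flow {U F : PhaseState m p → ℝ} (hUF : S.IsEntropyPair Ω U F)
    (hS : S.IsSmoothOn Ω) (hΩ : IsOpen Ω) {γ : ℝ → PhaseState m p} {r : PhaseState m p → PhaseState m p}
    {ξ₀ : ℝ} (hmem : γ ξ₀ ∈ Ω) (hγ : ∀ᶠ ξ in 𝓝 ξ₀, HasDerivAt γ (r (γ ξ)) ξ ∧ ContinuousAt r (γ ξ) ∧
      S.A (γ ξ) (r (γ ξ)) = ξ • r (γ ξ)) :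
    fderiv ℝ F (γ ξ₀) (r (γ ξ₀)) = ξ₀ * fderiv ℝ U (γ ξ₀) (r (γ ξ₀)) := by
  have hmem' : ∀ᶠ ξ in 𝓝 ξ₀, γ ξ ∈ Ω :=
    hγ.self_of_nhds.1.continuousAt.eventually (hΩ.mem_nhds hmem)
  obtain ⟨J, hJsub, hJ, hξJ⟩ := mem_nhds_iff.1 (hγ.and hmem')
  have hcont : ContinuousOn γ J := fun ξ hξ => (hJsub hξ).1.1.continuousAt.continuousWithinAt
  have hC1 : ContDiffOn ℝ 1 γ J := by
    rw [contDiffOn_one_iff_derivWithin hJ.uniqueDiffOn]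
    refine ⟨fun ξ hξ => (hJsub hξ).1.1.differentiableAt.differentiableWithinAt, ?_⟩
    have h1 : ContinuousOn (fun ξ => r (γ ξ)) J := fun ξ hξ =>
      (ContinuousAt.comp (hJsub hξ).1.2.1 (hJsub hξ).1.1.continuousAt).continuousWithinAt
    refine h1.congr fun ξ hξ => ?_
    rw [derivWithin_of_isOpen hJ hξ, (hJsub hξ).1.1.deriv]
  have hsol : S.IsClassicalSolutionOn (sector J) fun z => γ (z.2 / z.1) := by
    refine isClassicalSolutionOn_sector hS hΩ hJ (fun _ _ => rfl) hC1 (fun ξ hξ => (hJsub hξ).2) ?_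
    intro ξ hξ
    rw [(hJsub hξ).1.1.deriv]
    exact (hJsub hξ).1.2.2
  have hz : ((1 : ℝ), ξ₀) ∈ sector J := mem_sector_one.2 hξJ
  have hbal := hUF.balance _ _ (isOpen_sector hJ) (fun z hz => (hJsub hz.2).2) hsol _ hz
  have hder : ∀ V : PhaseState m p → ℝ, DifferentiableAt ℝ V (γ ξ₀) →
      HasFDerivAt (fun z : ℝ × ℝ => V (γ (z.2 / z.1)))
        ((ratioDeriv (1, ξ₀)).smulRight (fderiv ℝ V (γ ξ₀) (r (γ ξ₀)))) (1, ξ₀) := by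
    intro V hV
    have h0 : ((1 : ℝ), ξ₀).2 / ((1 : ℝ), ξ₀).1 = ξ₀ := by simp
    have h1 : HasDerivAt (fun ξ => V (γ ξ)) (fderiv ℝ V (γ ξ₀) (r (γ ξ₀))) ξ₀ :=
      hV.hasFDerivAt.comp_hasDerivAt ξ₀ (hJsub hξJ).1.1
    exact hasFDerivAt_comp_ratio (z := (1, ξ₀)) one_pos (by rwa [h0])
  have hU := hder U ((hUF.smooth_entropy.contDiffAt (hΩ.mem_nhds hmem)).differentiableAt (by simp))
  have hF := hder F ((hUF.smooth_flux.contDiffAt (hΩ.mem_nhds hmem)).differentiableAt (by simp))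
  rw [dTime, dSpace, hU.fderiv, hF.fderiv] at hbal
  simp [ratioDeriv] at hbal
  linarith

end NonconservativeSystem

namespace NonconservativeSystem

variable {m p : ℕ} {S : NonconservativeSystem m p} {Ω : Set (PhaseState m p)}
  {U F : Fin p → PhaseState m p → ℝ} {lam : Fin (m + p) → PhaseState m p → ℝ}
  {uStar : PhaseState m p}

/-- The densities of the conservative equations and of the entropy balances. -/
def density (U : Fin p → PhaseState m p → ℝ) (u : PhaseState m p) : PhaseState m p :=
  (u.1, fun k => U k u)

/-- The fluxes of the conservative equations and of the entropy balances. -/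
def flux (S : NonconservativeSystem m p) (F : Fin p → PhaseState m p → ℝ) (u : PhaseState m p) :
    PhaseState m p :=
  (S.g u, fun k => F k u)

theorem fderiv_density {u : PhaseState m p} (hU : ∀ k, DifferentiableAt ℝ (U k) u)
    (d : PhaseState m p) : fderiv ℝ (density U) u d = (d.1, fun k => fderiv ℝ (U k) u d) := by
  have h : HasFDerivAt (density U) ((ContinuousLinearMap.fst ℝ (Fin m → ℝ) (Fin p → ℝ)).prod
      (ContinuousLinearMap.pi fun k => fderiv ℝ (U k) u)) u :=
    hasFDerivAt_fst.prodMk (hasFDerivAt_pi.2 fun k => (hU k).hasFDerivAt)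
  rw [h.fderiv]
  rfl

theorem fderiv_flux {u : PhaseState m p} (hg : DifferentiableAt ℝ S.g u)
    (hF : ∀ k, DifferentiableAt ℝ (F k) u) (d : PhaseState m p) :
    fderiv ℝ (S.flux F) u d = (fderiv ℝ S.g u d, fun k => fderiv ℝ (F k) u d) := by
  have h : HasFDerivAt (S.flux F) ((fderiv ℝ S.g u).prod
      (ContinuousLinearMap.pi fun k => fderiv ℝ (F k) u)) u :=
    hg.hasFDerivAt.prodMk (hasFDerivAt_pi.2 fun k => (hF k).hasFDerivAt)
  rw [h.fderiv]
  rfl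

theorem fderiv_density_injective {u : PhaseState m p} (hU : ∀ k, DifferentiableAt ℝ (U k) u)
    (hdet : (gradW U u).det ≠ 0) : Function.Injective (fderiv ℝ (density U) u) := by
  rw [injective_iff_map_eq_zero]
  intro d hd
  rw [fderiv_density hU, Prod.mk_eq_zero] at hd
  obtain ⟨h1, h2⟩ := hd
  have hd' : d = (0, d.2) := Prod.ext h1 rfl
  have h3 : Matrix.vecMul d.2 (gradW U u) = 0 := by
    funext k
    have h4 : fderiv ℝ (U k) u (0, d.2) = 0 := by
      rw [← hd']
      exact congrFun h2 k
    have h5 : ((0 : Fin m → ℝ), d.2) = ∑ i, d.2 i • ((0 : Fin m → ℝ), Pi.single (M := fun _ => ℝ) i 1) := by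
      refine Prod.ext ?_ ?_
      · simp [Prod.fst_sum]
      · simp only [Prod.snd_sum, Prod.smul_mk]
        exact (pi_eq_sum_univ' d.2)
    rw [h5, map_sum] at h4
    simp only [map_smul, smul_eq_mul] at h4
    simpa [Matrix.vecMul, dotProduct, gradW] using h4
  rw [hd', Matrix.eq_zero_of_vecMul_eq_zero hdet h3]
  rfl

theorem finrank_phaseState : Module.finrank ℝ (PhaseState m p) = m + p := by
  simp

theorem IsEntropyPair.eventually_fderiv_flux {V H : PhaseState m p → ℝ} {l : PhaseState m p → ℝ}
    {r : PhaseState m p → PhaseState m p} (hVH : S.IsEntropyPair Ω V H) (hS : S.IsSmoothOn Ω)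
    (hΩ : IsOpen Ω) (hu : uStar ∈ Ω) (hl : ContDiffAt ℝ 1 l uStar) (hr : ContDiffAt ℝ 1 r uStar)
    (hev : ∀ᶠ u in 𝓝 uStar, S.A u (r u) = l u • r u ∧ fderiv ℝ l u (r u) = 1) :
    ∀ᶠ u in 𝓝 uStar, fderiv ℝ H u (r u) = l u * fderiv ℝ V u (r u) := by
  obtain ⟨T, hT, hT0, hTf⟩ := hr.exists_strictFlow
  have hldiff : ∀ᶠ u in 𝓝 uStar, DifferentiableAt ℝ l u ∧ fderiv ℝ l u (r u) = 1 := by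
    filter_upwards [hl.eventually (by simp), hev] with u h1 h2
    exact ⟨h1.differentiableAt one_ne_zero, h2.2⟩
  have hspeed := eventually_speed_flow hT hT0 hTf hldiff
  have hrcont : ∀ᶠ u in 𝓝 uStar, ContinuousAt r u := by
    filter_upwards [hr.eventually (by simp)] with u h using h.continuousAt
  have hTt : Tendsto T (𝓝 (0, uStar)) (𝓝 uStar) := by
    have := hT.continuousAt.tendsto
    rwa [hT0.self_of_nhds] at this
  have hQ := ((hTf.and hspeed).and (hTt.eventually (hev.and hrcont))).eventually_nhds
  have hincl : Tendsto (fun u : PhaseState m p => ((0 : ℝ), u)) (𝓝 uStar) (𝓝 (0, uStar)) :=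
    Continuous.tendsto' (by fun_prop) _ _ rfl
  filter_upwards [hincl.eventually hQ, hT0, hΩ.mem_nhds hu] with u h1 h2 h3
  have hsh : Tendsto (fun ξ => (ξ - l u, u)) (𝓝 (l u)) (𝓝 (0, u)) :=
    Continuous.tendsto' (by fun_prop) _ _ (by simp)
  have h4 := hVH.fderiv_flux_of_flow hS hΩ (γ := fun ξ => T (ξ - l u, u)) (r := r) (ξ₀ := l u)
    (by simpa [h2] using h3) (by
      filter_upwards [hsh.eventually h1] with ξ hξ
      obtain ⟨⟨h5, h6⟩, h7, h8⟩ := hξ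
      refine ⟨h5.comp_sub_const ξ (l u), h8, ?_⟩
      rw [h7.1, h6, add_sub_cancel])
  simpa [h2] using h4

/-- The characteristic fields of the system are those of the equivalent system of balance laws. -/
theorem exists_characteristicField (hΩ : IsOpen Ω) (hS : S.IsSmoothOn Ω)
    (hUF : S.HasFullSetOfEntropies Ω U F) (hyp : S.IsStrictlyHyperbolicOn Ω lam)
    (gnl : S.IsGenuinelyNonlinearOn Ω lam) (huStar : uStar ∈ Ω) :
    ∃ r : Fin (m + p) → PhaseState m p → PhaseState m p,
      (∀ j, ContDiffAt ℝ ∞ (lam j) uStar ∧ ContDiffAt ℝ ∞ (r j) uStar) ∧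
      (∀ᶠ u in 𝓝 uStar, ∀ j, S.A u (r j u) = lam j u • r j u ∧ fderiv ℝ (lam j) u (r j u) = 1) ∧
      ∀ j, CharacteristicField (S.flux F) (density U) (lam j) (r j) uStar := by
  have hA : ContDiffAt ℝ ∞ S.ACLM uStar := (contDiffOn_ACLM hS hΩ).contDiffAt (hΩ.mem_nhds huStar)
  have hnf := fun j => exists_normalized_eigenvector hA finrank_phaseState
    (by filter_upwards [hΩ.mem_nhds huStar] with u hu using hyp u hu) (gnl uStar huStar) j
  choose hlam r hr hev using hnf
  have hU : ∀ k, ∀ u ∈ Ω, ContDiffAt ℝ ∞ (U k) u := fun k u hu =>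
    (hUF.entropyPair k).smooth_entropy.contDiffAt (hΩ.mem_nhds hu)
  have hF : ∀ k, ∀ u ∈ Ω, ContDiffAt ℝ ∞ (F k) u := fun k u hu =>
    (hUF.entropyPair k).smooth_flux.contDiffAt (hΩ.mem_nhds hu)
  have hg : ∀ u ∈ Ω, ContDiffAt ℝ ∞ S.g u := fun u hu => hS.smooth_g.contDiffAt (hΩ.mem_nhds hu)
  have hUd : ∀ u ∈ Ω, ∀ k, DifferentiableAt ℝ (U k) u := fun u hu k =>
    (hU k u hu).differentiableAt (by simp)
  have hFd : ∀ u ∈ Ω, ∀ k, DifferentiableAt ℝ (F k) u := fun u hu k =>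
    (hF k u hu).differentiableAt (by simp)
  have hgd : ∀ u ∈ Ω, DifferentiableAt ℝ S.g u := fun u hu => (hg u hu).differentiableAt (by simp)
  have hle : (1 : ℕ∞ω) ≤ ∞ := by simp
  have hle2 : (2 : ℕ∞ω) ≤ ∞ := ENat.LEInfty.out
  have hev' : ∀ j, ∀ᶠ u in 𝓝 uStar, S.A u (r j u) = lam j u • r j u ∧
      fderiv ℝ (lam j) u (r j u) = 1 := hev
  have hent : ∀ᶠ u in 𝓝 uStar, ∀ j k,
      fderiv ℝ (F k) u (r j u) = lam j u * fderiv ℝ (U k) u (r j u) :=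
    eventually_all.2 fun j => eventually_all.2 fun k =>
      (hUF.entropyPair k).eventually_fderiv_flux hS hΩ huStar ((hlam j).of_le hle)
        ((hr j).of_le hle) (hev' j)
  have hnz : ∀ j, (S.A uStar).HasEigenvector (lam j uStar) (r j uStar) := by
    intro j
    obtain ⟨h1, h2⟩ := (hev' j).self_of_nhds
    refine ⟨Module.End.mem_eigenspace_iff.2 h1, fun h => ?_⟩
    rw [h, map_zero] at h2
    exact zero_ne_one h2
  obtain ⟨hmono, heig⟩ := hyp uStar huStar
  obtain ⟨b, hb⟩ := exists_basis_of_eigenvectors finrank_phaseState hmono.injective hnz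
  have hcomp : ∀ d, fderiv ℝ (density U) uStar (S.A uStar d) = fderiv ℝ (S.flux F) uStar d := by
    intro d
    have h1 : ((fderiv ℝ (density U) uStar : PhaseState m p →ₗ[ℝ] PhaseState m p) ∘ₗ S.A uStar)
        = (fderiv ℝ (S.flux F) uStar : PhaseState m p →ₗ[ℝ] PhaseState m p) := by
      refine b.ext fun j => ?_
      rw [hb]
      simp only [LinearMap.comp_apply, ContinuousLinearMap.coe_coe]
      rw [fderiv_flux (hgd _ huStar) (hFd _ huStar), fderiv_density (hUd _ huStar)]
      refine Prod.ext rfl (funext fun k => ?_)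
      simp only
      rw [(hev' j).self_of_nhds.1, map_smul, smul_eq_mul, hent.self_of_nhds j k]
    exact congrArg (fun l : PhaseState m p →ₗ[ℝ] PhaseState m p => l d) h1
  refine ⟨r, fun j => ⟨hlam j, hr j⟩, eventually_all.2 hev', fun j => ⟨?_, ?_, ?_, ?_, ?_, ?_, ?_⟩⟩
  · exact ((hg _ huStar).prodMk (contDiffAt_pi.2 fun k => hF k _ huStar)).of_le hle2
  · exact (contDiffAt_fst.prodMk (contDiffAt_pi.2 fun k => hU k _ huStar)).of_le hle2
  · exact (hlam j).hasStrictFDerivAt (by simp)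
  · exact (hr j).continuousAt
  · filter_upwards [hent, hev' j, hΩ.mem_nhds huStar] with u h1 h2 h3
    rw [fderiv_flux (hgd _ h3) (hFd _ h3), fderiv_density (hUd _ h3), Prod.smul_mk]
    have h4 : fderiv ℝ S.g u (r j u) = lam j u • (r j u).1 := congrArg Prod.fst h2.1
    exact Prod.ext h4 (funext fun k => h1 j k)
  · exact (hev' j).self_of_nhds.2
  · intro d c h
    refine (hnz j).simple finrank_phaseState hmono.injective heig (d := d) (c := c) ?_
    rw [← sub_eq_zero]
    refine fderiv_density_injective (hUd _ huStar) (hUF.nondegenerate _ huStar) ?_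
    rw [map_zero, map_sub, map_sub, map_smul, map_smul, hcomp, h, sub_self]

end NonconservativeSystem

namespace NonconservativeSystem

variable {m p : ℕ} {Ω : Set (PhaseState m p)} {lam : Fin (m + p) → PhaseState m p → ℝ}
  {uStar : PhaseState m p} {Φ : Fin p → PhaseState m p → ℝ → ℝ}

theorem isOpen_kineticDomain (hΩ : IsOpen Ω) (δ : ℝ) :
    IsOpen {q : PhaseState m p × ℝ | q.1 ∈ Ω ∧ ∃ j, |q.2 - lam j uStar| < δ} := by
  have h : {q : PhaseState m p × ℝ | ∃ j, |q.2 - lam j uStar| < δ}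
      = ⋃ j, {q | |q.2 - lam j uStar| < δ} := by
    ext
    simp
  refine (hΩ.preimage continuous_fst).inter (?_ : IsOpen {q : PhaseState m p × ℝ | ∃ j, |q.2 - lam j uStar| < δ})
  rw [h]
  exact isOpen_iUnion fun j => isOpen_lt (by fun_prop) continuous_const

theorem differentiableAt_kinetic (hΩ : IsOpen Ω) {δ : ℝ} {i : Fin p}
    (hC : ContDiffOn ℝ 1 (fun q : PhaseState m p × ℝ => Φ i q.1 q.2)
      {q | q.1 ∈ Ω ∧ ∃ j, |q.2 - lam j uStar| < δ}) {u : PhaseState m p} (hu : u ∈ Ω)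
    {j : Fin (m + p)} {Λ : ℝ} (hΛ : |Λ - lam j uStar| < δ) : DifferentiableAt ℝ (Φ i u) Λ := by
  have h1 := hC.contDiffAt ((isOpen_kineticDomain hΩ δ).mem_nhds (x := (u, Λ)) ⟨hu, j, hΛ⟩)
  exact DifferentiableAt.comp (g := fun q : PhaseState m p × ℝ => Φ i q.1 q.2) Λ (h1.differentiableAt one_ne_zero)
    ((differentiableAt_const u).prodMk differentiableAt_id)

theorem convex_abs_sub_lt (c δ : ℝ) : Convex ℝ {x : ℝ | |x - c| < δ} := by
  have : {x : ℝ | |x - c| < δ} = Metric.ball c δ := by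
    ext x
    simp [Real.dist_eq]
  rw [this]
  exact convex_ball c δ

/-- Below the characteristic speed, the kinetic function prescribes entropy dissipation. -/
theorem IsKineticFunction.exists_nonpos (hΩ : IsOpen Ω) (hΦ : IsKineticFunction lam Ω uStar Φ) :
    ∃ δ > 0, ∀ u ∈ Ω, ∀ j Λ, |lam j u - lam j uStar| < δ → |Λ - lam j uStar| < δ → Λ ≤ lam j u →
      ∀ i, Φ i u Λ ≤ 0 := by
  obtain ⟨δ, hδ, K, hC, hK⟩ := hΦ
  refine ⟨δ, hδ, fun u hu j Λ h1 h2 h3 i => ?_⟩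
  obtain ⟨h4, h5⟩ := hK i j u hu
  have hmono : MonotoneOn (Φ i u) {x | |x - lam j uStar| < δ} := by
    refine monotoneOn_of_deriv_nonneg (convex_abs_sub_lt _ _) ?_ ?_ ?_
    · exact fun x hx => (differentiableAt_kinetic hΩ (hC i) hu hx).continuousAt.continuousWithinAt
    · exact fun x hx => (differentiableAt_kinetic hΩ (hC i) hu
        (interior_subset hx : x ∈ {x | |x - lam j uStar| < δ})).differentiableWithinAt
    · exact fun x hx => (h5 x (interior_subset hx : x ∈ {x | |x - lam j uStar| < δ})).1
  rw [← h4 h1]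
  exact hmono h2 h1 h3

theorem IsKineticFunction.exists_isDissipationTerm (hΩ : IsOpen Ω) (huStar : uStar ∈ Ω)
    (hΦ : IsKineticFunction lam Ω uStar Φ) {j : Fin (m + p)} (hlam : ContDiffAt ℝ 1 (lam j) uStar) :
    ∃ K, IsDissipationTerm (fun q : PhaseState m p × ℝ =>
      ((0 : Fin m → ℝ), fun i => Φ i q.1 (lam j q.1 + q.2))) uStar K := by
  obtain ⟨δ, hδ, K, hC, hK⟩ := hΦ
  have hdom : ∀ᶠ u in 𝓝 uStar, u ∈ Ω ∧ |lam j u - lam j uStar| < δ / 2 := by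
    filter_upwards [hΩ.mem_nhds huStar,
      hlam.continuousAt.eventually (Metric.ball_mem_nhds _ (half_pos hδ))] with u h1 h2
    exact ⟨h1, h2⟩
  have hzero : ∀ᶠ u in 𝓝 uStar, ∀ i, Φ i u (lam j u) = 0 := by
    filter_upwards [hdom] with u h i
    exact (hK i j u h.1).1 (by linarith [h.2])
  refine ⟨|K| + 1, by positivity, ?_, ?_, ?_⟩
  · filter_upwards [hzero] with u h
    simp only [add_zero, h]
    rfl
  · suffices key : ∀ i, HasStrictFDerivAt (fun q : PhaseState m p × ℝ => Φ i q.1 (lam j q.1 + q.2))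
        (0 : PhaseState m p × ℝ →L[ℝ] ℝ) (uStar, 0) by
      refine ((hasStrictFDerivAt_const (𝕜 := ℝ) (0 : Fin m → ℝ)
        ((uStar, 0) : PhaseState m p × ℝ)).prodMk (hasStrictFDerivAt_pi.2 key)).congr_fderiv ?_
      exact ContinuousLinearMap.ext fun _ => rfl
    intro i
    have hq : HasStrictFDerivAt (fun q : PhaseState m p × ℝ => Φ i q.1 (lam j q.1 + q.2))
        (fderiv ℝ (fun q : PhaseState m p × ℝ => Φ i q.1 (lam j q.1 + q.2)) (uStar, 0))
        (uStar, 0) := by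
      refine ContDiffAt.hasStrictFDerivAt (n := 1) ?_ one_ne_zero
      have h1 : ContDiffAt ℝ 1 (fun q : PhaseState m p × ℝ => Φ i q.1 q.2)
          (uStar, lam j uStar + 0) :=
        (hC i).contDiffAt ((isOpen_kineticDomain hΩ δ).mem_nhds ⟨huStar, j, by simpa using hδ⟩)
      have h2 : ContDiffAt ℝ 1 (fun q : PhaseState m p × ℝ => (q.1, lam j q.1 + q.2)) (uStar, 0) :=
        contDiffAt_fst.prodMk ((hlam.comp (uStar, (0 : ℝ)) contDiffAt_fst).add contDiffAt_snd)
      exact ContDiffAt.comp (g := fun q : PhaseState m p × ℝ => Φ i q.1 q.2) (uStar, (0 : ℝ)) h1 h2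
    refine hq.congr_fderiv (ContinuousLinearMap.ext fun d => ?_)
    have hf := hq.hasFDerivAt
    have e1 : fderiv ℝ (fun q : PhaseState m p × ℝ => Φ i q.1 (lam j q.1 + q.2)) (uStar, 0)
        (d.1, 0) = 0 := by
      have h1 := hf.comp uStar
        ((hasFDerivAt_id (𝕜 := ℝ) uStar).prodMk (hasFDerivAt_const (0 : ℝ) uStar))
      have h2 : HasFDerivAt (fun _ : PhaseState m p => (0 : ℝ))
          (0 : PhaseState m p →L[ℝ] ℝ) uStar := hasFDerivAt_const _ _
      have h3 : ((fun q : PhaseState m p × ℝ => Φ i q.1 (lam j q.1 + q.2)) ∘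
          fun u => (id u, (0 : ℝ))) =ᶠ[𝓝 uStar] fun _ => 0 := by
        filter_upwards [hzero] with u hu
        simp [hu i]
      have h4 := h1.unique (h2.congr_of_eventuallyEq h3)
      exact congrArg (fun l : PhaseState m p →L[ℝ] ℝ => l d.1) h4
    have e2 : fderiv ℝ (fun q : PhaseState m p × ℝ => Φ i q.1 (lam j q.1 + q.2)) (uStar, 0)
        (0, 1) = 0 := by
      have h1 := hf.comp_hasDerivAt (0 : ℝ)
        ((hasDerivAt_const (0 : ℝ) uStar).prodMk (hasDerivAt_id (0 : ℝ)))
      have h5 := (hK i j uStar huStar).2 (lam j uStar) (by simpa using hδ)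
      have h2 : HasDerivAt (Φ i uStar) 0 (lam j uStar + 0) := by
        have h6 : deriv (Φ i uStar) (lam j uStar) = 0 :=
          le_antisymm (by simpa using h5.2) h5.1
        rw [add_zero, ← h6]
        exact (differentiableAt_kinetic hΩ (hC i) huStar (j := j) (by simpa using hδ)).hasDerivAt
      exact h1.unique (h2.comp_const_add (lam j uStar) 0)
    have hd : d = (d.1, 0) + d.2 • ((0 : PhaseState m p), (1 : ℝ)) := by
      refine Prod.ext ?_ ?_ <;> simp
    rw [hd, map_add, map_smul, e1, e2]
    simp
  · have h1 : ∀ᶠ q : PhaseState m p × ℝ × ℝ in 𝓝 (uStar, 0, 0), |q.2.1| < δ / 2 ∧ |q.2.2| < δ / 2 :=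
      (Continuous.tendsto' (f := fun q : PhaseState m p × ℝ × ℝ => |q.2.1|) (by fun_prop)
        (uStar, 0, 0) 0 (by simp)).eventually (eventually_lt_nhds (half_pos hδ)) |>.and
      ((Continuous.tendsto' (f := fun q : PhaseState m p × ℝ × ℝ => |q.2.2|) (by fun_prop)
        (uStar, 0, 0) 0 (by simp)).eventually (eventually_lt_nhds (half_pos hδ)))
    have h2 : Tendsto (fun q : PhaseState m p × ℝ × ℝ => q.1) (𝓝 (uStar, 0, 0)) (𝓝 uStar) :=
      continuous_fst.tendsto' _ _ rfl
    filter_upwards [h1, h2.eventually hdom] with q hq hq'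
    obtain ⟨u, a, b⟩ := q
    simp only at hq hq' ⊢
    rw [Prod.mk_sub_mk, sub_self, Prod.norm_mk, norm_zero]
    refine max_le (by positivity) ((pi_norm_le_iff_of_nonneg (by positivity)).2 fun i => ?_)
    simp only [Pi.sub_apply]
    have hsub : ∀ x ∈ uIcc b a, |lam j u + x - lam j uStar| < δ ∧ |x| ≤ max |a| |b| := by
      intro x hx
      have h3 : |x| ≤ max |a| |b| := by
        rw [max_comm]
        exact abs_le_max_abs_abs hx.1 hx.2 |>.trans (by
          rcases le_total b a with h | h <;> simp [h, max_comm])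
      refine ⟨?_, h3⟩
      have h4 : |x| < δ / 2 := h3.trans_lt (max_lt hq.1 hq.2)
      have := abs_add_le (lam j u - lam j uStar) x
      rw [show lam j u + x - lam j uStar = lam j u - lam j uStar + x by ring]
      linarith [hq'.2]
    have hder : ∀ x ∈ uIcc b a, HasDerivWithinAt (fun x => Φ i u (lam j u + x))
        (deriv (Φ i u) (lam j u + x)) (uIcc b a) x := fun x hx =>
      ((differentiableAt_kinetic hΩ (hC i) hq'.1 (hsub x hx).1).hasDerivAt.comp_const_add
        (lam j u) x).hasDerivWithinAt
    refine (convex_uIcc b a).norm_image_sub_le_of_norm_hasDerivWithin_le hder (fun x hx => ?_)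
      left_mem_uIcc right_mem_uIcc
    obtain ⟨h5, h6⟩ := (hK i j u hq'.1).2 _ (hsub x hx).1
    rw [add_sub_cancel_left] at h6
    rw [Real.norm_of_nonneg h5]
    refine h6.trans (mul_le_mul (by linarith [le_abs_self K]) ?_ (sq_nonneg _) (by positivity))
    rw [← sq_abs]
    exact pow_le_pow_left₀ (abs_nonneg x) (hsub x hx).2 2

end NonconservativeSystem

namespace NonconservativeSystem

variable {m p : ℕ} {S : NonconservativeSystem m p} {Ω : Set (PhaseState m p)}
  {U F : Fin p → PhaseState m p → ℝ} {lam : Fin (m + p) → PhaseState m p → ℝ}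
  {Φ : Fin p → PhaseState m p → ℝ → ℝ}

/-- The jump relations and the kinetic relations, as a single vector equation. -/
def ShockRelation (S : NonconservativeSystem m p) (U F : Fin p → PhaseState m p → ℝ)
    (Φ : Fin p → PhaseState m p → ℝ → ℝ) (σ : ℝ) (a b : PhaseState m p) : Prop :=
  S.flux F b - S.flux F a - σ • (density U b - density U a) = (0, fun i => Φ i a σ)

theorem isAdmissibleShock_iff {σ : ℝ} {a b : PhaseState m p} :
    S.IsAdmissibleShock U F lam Φ σ a b ↔
      S.ShockRelation U F Φ σ a b ∧ (∀ i, Φ i a σ ≤ 0) ∧ ∃ j, lam j b < σ ∧ σ < lam j a := by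
  have h : S.ShockRelation U F Φ σ a b ↔ -σ • (b.1 - a.1) + S.g b - S.g a = 0 ∧
      ∀ i, entropyDissipation (U i) (F i) σ a b = Φ i a σ := by
    rw [ShockRelation, Prod.ext_iff]
    refine and_congr ?_ ?_
    · simp only [flux, density, Prod.fst_sub, Prod.smul_fst]
      rw [show S.g b - S.g a - σ • (b.1 - a.1) = -σ • (b.1 - a.1) + S.g b - S.g a by
        rw [neg_smul]; abel]
    · simp only [flux, density, Prod.snd_sub, Prod.smul_snd, funext_iff, Pi.sub_apply, Pi.smul_apply,
        smul_eq_mul, entropyDissipation]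
      refine forall_congr' fun i => ?_
      rw [show F i b - F i a - σ * (U i b - U i a) = -σ * (U i b - U i a) + F i b - F i a by ring]
  constructor
  · rintro ⟨h1, h2, h3⟩
    exact ⟨h.2 ⟨h1, fun i => (h2 i).1⟩, fun i => (h2 i).2, h3⟩
  · rintro ⟨h1, h2, h3⟩
    exact ⟨(h.1 h1).1, fun i => ⟨(h.1 h1).2 i, h2 i⟩, h3⟩

/-- The states in `O` have normalized eigenvectors `r j`, and Lax shocks between states in `O`
dissipate entropy. -/
structure IsRegularDomain (S : NonconservativeSystem m p) (Ω : Set (PhaseState m p))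
    (lam : Fin (m + p) → PhaseState m p → ℝ)
    (r : Fin (m + p) → PhaseState m p → PhaseState m p) (Φ : Fin p → PhaseState m p → ℝ → ℝ)
    (O : Set (PhaseState m p)) : Prop where
  subset : O ⊆ Ω
  eigen : ∀ u ∈ O, ∀ j, S.A u (r j u) = lam j u • r j u ∧ fderiv ℝ (lam j) u (r j u) = 1
  differentiableAt : ∀ u ∈ O, ∀ j, DifferentiableAt ℝ (lam j) u
  continuousAt : ∀ u ∈ O, ∀ j, ContinuousAt (r j) u
  nonpos : ∀ a ∈ O, ∀ b ∈ O, ∀ j σ, lam j b < σ → σ < lam j a → ∀ i, Φ i a σ ≤ 0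

variable {r : Fin (m + p) → PhaseState m p → PhaseState m p} {O : Set (PhaseState m p)}

theorem IsRegularDomain.hasEigenvector (hO : S.IsRegularDomain Ω lam r Φ O) {u : PhaseState m p}
    (hu : u ∈ O) (j : Fin (m + p)) : (S.A u).HasEigenvector (lam j u) (r j u) := by
  obtain ⟨h1, h2⟩ := hO.eigen u hu j
  refine ⟨Module.End.mem_eigenspace_iff.2 h1, fun h => ?_⟩
  rw [h, map_zero] at h2
  exact zero_ne_one h2

theorem IsRiemannSolution.exists_isWaveProfile (hO : S.IsRegularDomain Ω lam r Φ O)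
    (hyp : S.IsStrictlyHyperbolicOn Ω lam) {V : Set (PhaseState m p)} (hV : V ⊆ O)
    {ul ur : PhaseState m p} {u : ℝ × ℝ → PhaseState m p}
    (hu : S.IsRiemannSolution U F lam Φ V ul ur u) :
    ∃ P : Finset ℝ, IsWaveProfile lam r (S.ShockRelation U F Φ) P (fun ξ => u (1, ξ)) ∧
      (∀ z : ℝ × ℝ, 0 < z.1 → z.2 / z.1 ∉ P → u z = u (1, z.2 / z.1)) ∧
      Tendsto (fun ξ => u (1, ξ)) atBot (𝓝 ul) ∧ Tendsto (fun ξ => u (1, ξ)) atTop (𝓝 ur) := by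
  obtain ⟨P, hgap, hray⟩ := hu.waves
  have hself : ∀ z : ℝ × ℝ, 0 < z.1 → z.2 / z.1 ∉ P → u z = u (1, z.2 / z.1) := by
    intro z hz hzP
    have hnhds : (P : Set ℝ)ᶜ ∈ 𝓝 (z.2 / z.1) := P.finite_toSet.isClosed.isOpen_compl.mem_nhds hzP
    obtain ⟨l, v, hlv, hsub⟩ := mem_nhds_iff_exists_Ioo_subset.1 hnhds
    have h1 : ((1 : ℝ), z.2 / z.1) ∈ sector (Ioo l v) := mem_sector_one.2 hlv
    rcases (hgap (Ioo l v) isOpen_Ioo ordConnected_Ioo (disjoint_left.2 hsub)).2 with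
      ⟨c, hc⟩ | ⟨j, R, hR, -⟩
    · rw [hc z ⟨hz, hlv⟩, hc _ h1]
    · rw [hR z ⟨hz, hlv⟩, hR _ h1]
      simp
  refine ⟨P, ⟨?_, ?_⟩, hself, ?_, ?_⟩
  · intro J hJ hJc hJP
    rcases (hgap J hJ hJc hJP).2 with ⟨c, hc⟩ | ⟨j, R, hR, hRC, hRe⟩
    · exact Or.inl ⟨c, fun ξ hξ => hc _ (mem_sector_one.2 hξ)⟩
    · refine Or.inr ⟨j, fun ξ hξ => ?_⟩
      have hw : ∀ ξ ∈ J, u (1, ξ) = R ξ := fun ξ hξ => by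
        have := hR _ (mem_sector_one.2 hξ)
        simpa using this
      have hRO : R ξ ∈ O := by
        rw [← hw ξ hξ]
        exact hV (hu.mem _ one_pos)
      have hder : HasDerivAt R (deriv R ξ) ξ :=
        ((hRC.contDiffAt (hJ.mem_nhds hξ)).differentiableAt one_ne_zero).hasDerivAt
      have hspeed : fderiv ℝ (lam j) (R ξ) (deriv R ξ) = 1 := by
        have h1 := (hO.differentiableAt _ hRO j).hasFDerivAt.comp_hasDerivAt ξ hder
        refine h1.unique ((hasDerivAt_id ξ).congr_of_eventuallyEq ?_)
        filter_upwards [hJ.mem_nhds hξ] with x hx using (hRe x hx).1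
      obtain ⟨hmono, heig⟩ := hyp _ (hO.subset hRO)
      obtain ⟨-, a, ha⟩ := (hO.hasEigenvector hRO j).simple finrank_phaseState hmono.injective heig
        (d := deriv R ξ) (c := 0) (by rw [(hRe ξ hξ).2.apply_eq_smul, sub_self, zero_smul])
      rw [ha, map_smul, (hO.eigen _ hRO j).2, smul_eq_mul, mul_one] at hspeed
      rw [hspeed, one_smul] at ha
      rw [hw ξ hξ, ← ha]
      refine ⟨(hRe ξ hξ).1, hder.congr_of_eventuallyEq ?_⟩
      filter_upwards [hJ.mem_nhds hξ] with x hx using hw x hx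
  · intro s hs
    obtain ⟨a, b, hlim, hab⟩ := hray s hs
    obtain ⟨h1, h2⟩ := hlim 1 one_pos
    rw [mul_one] at h1 h2
    have hsec : ∀ I : Set ℝ, Tendsto (fun ξ : ℝ => ((1 : ℝ), ξ)) (𝓝[I] s)
        (𝓝[sector I] (1, s)) := by
      intro I
      refine tendsto_nhdsWithin_iff.2 ⟨?_, ?_⟩
      · exact (Continuous.tendsto (by fun_prop) s).mono_left nhdsWithin_le_nhds
      · filter_upwards [self_mem_nhdsWithin] with ξ hξ using mem_sector_one.2 hξ
    refine ⟨a, b, h1.comp (hsec _), h2.comp (hsec _), ?_⟩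
    rcases hab with h | h
    · exact Or.inl h
    · obtain ⟨h3, -, h4⟩ := isAdmissibleShock_iff.1 h
      exact Or.inr ⟨h3, h4⟩
  · have h1 : Tendsto (fun ξ : ℝ => (-ξ)⁻¹) atBot (𝓝[>] 0) :=
      tendsto_inv_atTop_nhdsGT_zero.comp tendsto_neg_atBot_atTop
    refine ((hu.initial_left (-1) (by norm_num)).comp h1).congr' ?_
    obtain ⟨M, hM⟩ := P.bddBelow
    filter_upwards [eventually_lt_atBot M, eventually_lt_atBot 0] with ξ h2 h3
    have h4 : 0 < (-ξ)⁻¹ := inv_pos.2 (by linarith)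
    have h5 : -1 / (-ξ)⁻¹ = ξ := by simp
    have h6 := hself ((-ξ)⁻¹, -1) h4 (by
      simp only [h5]
      exact fun h => absurd (hM h) (not_le.2 h2))
    simp only [h5] at h6
    exact h6
  · have h1 : Tendsto (fun ξ : ℝ => ξ⁻¹) atTop (𝓝[>] 0) := tendsto_inv_atTop_nhdsGT_zero
    refine ((hu.initial_right 1 one_pos).comp h1).congr' ?_
    obtain ⟨M, hM⟩ := P.bddAbove
    filter_upwards [eventually_gt_atTop M, eventually_gt_atTop 0] with ξ h2 h3
    have h5 : 1 / ξ⁻¹ = ξ := by simp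
    have h6 := hself (ξ⁻¹, 1) (inv_pos.2 h3) (by
      simp only [h5]
      exact fun h => absurd (hM h) (not_le.2 h2))
    simp only [h5] at h6
    exact h6

theorem isRiemannSolution_of_isWaveProfile (hO : S.IsRegularDomain Ω lam r Φ O)
    (hS : S.IsSmoothOn Ω) (hΩ : IsOpen Ω) {C V : Set (PhaseState m p)} (hC : IsClosed C)
    (hCO : C ⊆ O) (hVC : V ⊆ C) {P : Finset ℝ} {w : ℝ → PhaseState m p}
    (hw : IsWaveProfile lam r (S.ShockRelation U F Φ) P w) (hwV : ∀ ξ, w ξ ∈ V)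
    {ul ur : PhaseState m p} (hl : Tendsto w atBot (𝓝 ul)) (hr : Tendsto w atTop (𝓝 ur)) :
    S.IsRiemannSolution U F lam Φ V ul ur fun z => w (z.2 / z.1) := by
  have hwO : ∀ ξ, w ξ ∈ O := fun ξ => hCO (hVC (hwV ξ))
  refine ⟨fun z _ => hwV _, fun x hx => ?_, fun x hx => ?_, P, fun J hJ hJc hJP => ?_, ?_⟩
  · refine hl.comp ?_
    simp only [div_eq_mul_inv]
    exact tendsto_inv_nhdsGT_zero.const_mul_atTop_of_neg hx
  · refine hr.comp ?_
    simp only [div_eq_mul_inv]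
    exact tendsto_inv_nhdsGT_zero.const_mul_atTop hx
  · rcases hw.gap J hJ hJc hJP with ⟨c, hc⟩ | ⟨j, hj⟩
    · have h1 : ∀ z ∈ sector J, w (z.2 / z.1) = c := fun z hz => hc _ hz.2
      refine ⟨?_, Or.inl ⟨c, h1⟩⟩
      rcases J.eq_empty_or_nonempty with rfl | ⟨ξ₀, hξ₀⟩
      · have h2 : sector ∅ = ∅ := by simp [sector]
        rw [h2]
        exact ⟨contDiffOn_empty, fun z hz => absurd hz (notMem_empty z),
          fun z hz => absurd hz (notMem_empty z)⟩
      · have hcΩ : c ∈ Ω := by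
          rw [← hc ξ₀ hξ₀]
          exact hO.subset (hwO ξ₀)
        exact isClassicalSolutionOn_sector hS hΩ hJ (W := fun _ => c) h1 contDiffOn_const
          (fun _ _ => hcΩ) fun ξ _ => by simp
    · have hcont : ContinuousOn w J := fun ξ hξ => (hj ξ hξ).2.continuousAt.continuousWithinAt
      have hC1 : ContDiffOn ℝ 1 w J := by
        rw [contDiffOn_one_iff_derivWithin hJ.uniqueDiffOn]
        refine ⟨fun ξ hξ => (hj ξ hξ).2.differentiableAt.differentiableWithinAt, ?_⟩
        have h1 : ContinuousOn (fun ξ => r j (w ξ)) J := fun ξ hξ =>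
          (ContinuousAt.comp (hO.continuousAt _ (hwO ξ) j)
            (hj ξ hξ).2.continuousAt).continuousWithinAt
        refine h1.congr fun ξ hξ => ?_
        rw [derivWithin_of_isOpen hJ hξ, (hj ξ hξ).2.deriv]
      refine ⟨isClassicalSolutionOn_sector hS hΩ hJ (fun _ _ => rfl) hC1
        (fun ξ _ => hO.subset (hwO ξ)) fun ξ hξ => ?_, Or.inr ⟨j, w, fun _ _ => rfl, hC1, ?_⟩⟩
      · rw [(hj ξ hξ).2.deriv, (hO.eigen _ (hwO ξ) j).1, (hj ξ hξ).1]
      · intro ξ hξ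
        rw [(hj ξ hξ).2.deriv]
        exact ⟨(hj ξ hξ).1, hO.hasEigenvector (hwO ξ) j⟩
  · intro s hs
    obtain ⟨a, b, ha, hb, hab⟩ := hw.ray s hs
    have hsec : ∀ t > 0, ∀ I : Set ℝ, Tendsto (fun z : ℝ × ℝ => z.2 / z.1)
        (𝓝[sector I] (t, s * t)) (𝓝[I] s) := by
      intro t ht I
      refine tendsto_nhdsWithin_iff.2 ⟨?_, ?_⟩
      · have h1 := (hasFDerivAt_ratio (z := (t, s * t)) ht).continuousAt.tendsto
        simp only [mul_div_cancel_right₀ s (ne_of_gt ht)] at h1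
        exact h1.mono_left nhdsWithin_le_nhds
      · filter_upwards [self_mem_nhdsWithin] with z hz using hz.2
    refine ⟨a, b, fun t ht => ⟨ha.comp (hsec t ht _), hb.comp (hsec t ht _)⟩, ?_⟩
    rcases hab with h | ⟨h1, j, h2, h3⟩
    · exact Or.inl h
    · refine Or.inr (isAdmissibleShock_iff.2 ⟨h1, ?_, j, h2, h3⟩)
      exact hO.nonpos a (hCO (hC.mem_of_tendsto ha (Eventually.of_forall fun ξ => hVC (hwV ξ))))
        b (hCO (hC.mem_of_tendsto hb (Eventually.of_forall fun ξ => hVC (hwV ξ)))) j s h2 h3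

/-- The union of finitely many rays is a null set. -/
theorem ae_ratio_notMem (P : Finset ℝ) :
    ∀ᵐ z : ℝ × ℝ ∂volume.restrict {z : ℝ × ℝ | 0 < z.1}, z.2 / z.1 ∉ P := by
  have hline : ∀ s : ℝ, volume {z : ℝ × ℝ | z.2 = s * z.1} = 0 := by
    intro s
    have h := Measure.addHaar_submodule (volume : Measure (ℝ × ℝ))
      (LinearMap.ker (LinearMap.snd ℝ ℝ ℝ - s • LinearMap.fst ℝ ℝ ℝ)) (by
        intro h
        have h1 : ((0 : ℝ), (1 : ℝ)) ∈ LinearMap.ker (LinearMap.snd ℝ ℝ ℝ - s • LinearMap.fst ℝ ℝ ℝ) := by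
          rw [h]
          trivial
        simp at h1)
    refine measure_mono_null (fun z hz => ?_) h
    have hz : z.2 = s * z.1 := hz
    simp [hz]
  have h1 : ∀ᵐ z : ℝ × ℝ ∂volume.restrict {z : ℝ × ℝ | 0 < z.1}, ∀ s ∈ P, z.2 ≠ s * z.1 := by
    refine ae_restrict_of_ae ?_
    exact (ae_ball_iff (Finset.countable_toSet P)).2 fun s _ => measure_mono_null (fun z hz => not_not.1 hz) (hline s)
  have h2 : MeasurableSet {z : ℝ × ℝ | 0 < z.1} := measurableSet_lt measurable_const measurable_fst
  filter_upwards [h1, ae_restrict_mem h2] with z h3 h4 h5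
  have h4 : 0 < z.1 := h4
  exact h3 _ h5 (by field_simp)

end NonconservativeSystem

theorem eventually_fanState_mem {E : Type*} [NormedAddCommGroup E] [NormedSpace ℝ E] {N : ℕ}
    {T : Fin N → ℝ × E → E} {u₀ : E} {r : Fin N → E} (h0 : ∀ j, T j (0, u₀) = u₀)
    (hT : ∀ j, HasStrictFDerivAt (T j)
      ((ContinuousLinearMap.fst ℝ ℝ E).smulRight (r j) + ContinuousLinearMap.snd ℝ ℝ E) (0, u₀))
    {V : Set E} (hV : V ∈ 𝓝 u₀) :
    ∀ᶠ q : (Fin N → ℝ) × E in 𝓝 (0, u₀), ∀ k, fanState T q.1 q.2 k ∈ V := by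
  have h1 : ∀ k, ∀ᶠ q : (Fin N → ℝ) × E in 𝓝 (0, u₀), fanState T q.1 q.2 k ∈ V := by
    intro k
    have h2 := (hasStrictFDerivAt_fanState h0 hT k).continuousAt.tendsto
    simp only [fanState_zero_strength h0] at h2
    exact h2.eventually hV
  filter_upwards [(eventually_all_finset (Finset.range (N + 1))).2 fun k _ => h1 k] with q hq k
  rcases le_total k N with h | h
  · exact hq k (by simpa using Nat.lt_succ_of_le h)
  · induction k, h using Nat.le_induction with
    | base => exact hq N (by simp)
    | succ k hk ih => rwa [fanState, dif_neg (by omega)]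

open NonconservativeSystem in
theorem corollary3p2 {m p : ℕ} (S : NonconservativeSystem m p)
    (Ω : Set (PhaseState m p)) (hΩ_open : IsOpen Ω) (hΩ_convex : Convex ℝ Ω)
    (hS : S.IsSmoothOn Ω)
    (U F : Fin p → PhaseState m p → ℝ) (hUF : S.HasFullSetOfEntropies Ω U F)
    (lam : Fin (m + p) → PhaseState m p → ℝ)
    (hyp : S.IsStrictlyHyperbolicOn Ω lam) (gnl : S.IsGenuinelyNonlinearOn Ω lam)
    (uStar : PhaseState m p) (huStar : uStar ∈ Ω)
    (Φ : Fin p → PhaseState m p → ℝ → ℝ)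
    (hΦ : NonconservativeSystem.IsKineticFunction lam Ω uStar Φ) :
    ∃ V₀ ∈ 𝓝 uStar, V₀ ⊆ Ω ∧
      ∀ V ∈ 𝓝 uStar, V ⊆ V₀ →
        ∃ W ∈ 𝓝 uStar, W ⊆ V ∧
          ∀ ul ∈ W, ∀ ur ∈ W,
            (∃ u : ℝ × ℝ → PhaseState m p, S.IsRiemannSolution U F lam Φ V ul ur u) ∧
            ∀ u u' : ℝ × ℝ → PhaseState m p,
              S.IsRiemannSolution U F lam Φ V ul ur u →
              S.IsRiemannSolution U F lam Φ V ul ur u' →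
              u =ᵐ[volume.restrict {z : ℝ × ℝ | 0 < z.1}] u' := by
  obtain ⟨r, hsmooth, hev, hchar⟩ :=
    exists_characteristicField hΩ_open hS hUF hyp gnl huStar
  have hlam1 : ∀ j, ContDiffAt ℝ 1 (lam j) uStar := fun j => (hsmooth j).1.of_le (by simp)
  have hr1 : ∀ j, ContDiffAt ℝ 1 (r j) uStar := fun j => (hsmooth j).2.of_le (by simp)
  have hdiff : ∀ᶠ u in 𝓝 uStar, ∀ j, DifferentiableAt ℝ (lam j) u ∧ ContinuousAt (r j) u := by
    rw [eventually_all]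
    intro j
    filter_upwards [(hlam1 j).eventually (by simp), (hr1 j).eventually (by simp)] with u h1 h2
    exact ⟨h1.differentiableAt one_ne_zero, h2.continuousAt⟩
  have hcurve : ∀ j, ∃ T s, IsWaveCurve (lam j) (r j) (S.ShockRelation U F Φ) uStar T s := by
    intro j
    obtain ⟨K, hK⟩ := hΦ.exists_isDissipationTerm hΩ_open huStar (hlam1 j)
    obtain ⟨T, s, h⟩ := (hchar j).exists_isWaveCurve hK (hr1 j) (by
      filter_upwards [hdiff, hev] with u h1 h2 using ⟨(h1 j).1, (h2 j).2⟩)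
    simp only [add_sub_cancel] at h
    exact ⟨T, s, h⟩
  choose T s hT using hcurve
  obtain ⟨hmono, -⟩ := hyp uStar huStar
  obtain ⟨δ, hδ, hnonpos⟩ := hΦ.exists_nonpos hΩ_open
  have hΩ_ev : ∀ᶠ u in 𝓝 uStar, u ∈ Ω := hΩ_open.mem_nhds huStar
  have hgood : ∀ᶠ u in 𝓝 uStar, u ∈ Ω ∧ (∀ j, S.A u (r j u) = lam j u • r j u ∧
      fderiv ℝ (lam j) u (r j u) = 1) ∧ (∀ j, DifferentiableAt ℝ (lam j) u ∧ ContinuousAt (r j) u) ∧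
      ∀ j, |lam j u - lam j uStar| < δ :=
    hΩ_ev.and (hev.and (hdiff.and
      (eventually_all.2 fun j => (hlam1 j).continuousAt.eventually (Metric.ball_mem_nhds _ hδ))))
  have hregular : S.IsRegularDomain Ω lam r Φ {u | u ∈ Ω ∧ (∀ j, S.A u (r j u) = lam j u • r j u ∧
      fderiv ℝ (lam j) u (r j u) = 1) ∧ (∀ j, DifferentiableAt ℝ (lam j) u ∧ ContinuousAt (r j) u) ∧
      ∀ j, |lam j u - lam j uStar| < δ} := by
    refine ⟨fun u hu => hu.1, fun u hu => hu.2.1, fun u hu j => (hu.2.2.1 j).1,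
      fun u hu j => (hu.2.2.1 j).2, fun a ha b hb j σ h1 h2 i => ?_⟩
    have h3 := abs_lt.1 (ha.2.2.2 j)
    have h4 := abs_lt.1 (hb.2.2.2 j)
    exact hnonpos a ha.1 j σ (ha.2.2.2 j) (abs_lt.2 ⟨by linarith, by linarith⟩) h2.le i
  obtain ⟨b, hb⟩ := exists_basis_of_eigenvectors finrank_phaseState hmono.injective
    fun j => hregular.hasEigenvector hgood.self_of_nhds j
  have h0 : ∀ j, T j (0, uStar) = uStar := fun j => (hT j).zero.self_of_nhds
  obtain ⟨⟨B, hB, hinj⟩, hsurj⟩ :=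
    exists_fan_inverse h0 (r := fun j => r j uStar) b hb fun j => (hT j).strict
  obtain ⟨c, κ, η, O, hO, hD, hOB⟩ := exists_isFanDomain hmono hT hr1 hlam1 hB
  obtain ⟨R, hR, hball⟩ := Metric.nhds_basis_closedBall.mem_iff.1 (inter_mem hO hgood)
  have hCO : Metric.closedBall uStar R ⊆ O := fun u hu => (hball hu).1
  have hCreg := fun u (hu : u ∈ Metric.closedBall uStar R) => (hball hu).2
  refine ⟨Metric.closedBall uStar R, Metric.closedBall_mem_nhds _ hR, fun u hu => (hCreg u hu).1, ?_⟩
  intro V hV hVC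
  have hfan := eventually_fanState_mem h0 (fun j => (hT j).strict) hV
  rw [nhds_prod_eq] at hfan
  obtain ⟨A, hA, V', hV', hAV⟩ := mem_prod_iff.1 hfan
  obtain ⟨ρ, hρ, hρA⟩ := Metric.mem_nhds_iff.1 hA
  have hbox : ∀ (e : Fin (m + p) → ℝ) (u : PhaseState m p), (∀ j, |e j| < ρ) → u ∈ V' →
      ∀ k, fanState T e u k ∈ V := fun e u he hu =>
    hAV (show (e, u) ∈ A ×ˢ V' from ⟨hρA (by rw [mem_ball_zero_iff, pi_norm_lt_iff hρ]; exact he), hu⟩)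
  have hsolve := hsurj (Metric.ball 0 (min ρ η) ×ˢ univ) (by
    rw [nhds_prod_eq]
    exact prod_mem_prod (Metric.ball_mem_nhds _ (lt_min hρ hD.η_pos)) univ_mem)
  rw [nhds_prod_eq] at hsolve
  obtain ⟨W', hW', hsolve⟩ := mem_prod_same_iff.1 hsolve
  refine ⟨W' ∩ V' ∩ V, inter_mem (inter_mem hW' hV') hV, fun u hu => hu.2, ?_⟩
  intro ul hul ur hur
  constructor
  · obtain ⟨ε, ⟨hε, -⟩, hεur⟩ := hsolve (mk_mem_prod hul.1.1 hur.1.1)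
    rw [mem_ball_zero_iff, pi_norm_lt_iff (lt_min hρ hD.η_pos)] at hε
    have hερ : ∀ j, |ε j| < ρ := fun j => (hε j).trans_le (min_le_left _ _)
    have hεη : ∀ j, |ε j| < η := fun j => (hε j).trans_le (min_le_right _ _)
    have hmemV : ∀ e : Fin (m + p) → ℝ, (∀ j, |e j| ≤ |ε j|) → ∀ k, fanState T e ul k ∈ V :=
      fun e he => hbox e ul (fun j => (he j).trans_lt (hερ j)) hul.1.2
    have hmemO : ∀ e : Fin (m + p) → ℝ, (∀ j, |e j| ≤ |ε j|) → ∀ k, fanState T e ul k ∈ O :=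
      fun e he k => hCO (hVC (hmemV e he k))
    obtain ⟨P, hP⟩ := isWaveProfile_fanProfile hD hεη hmemO
    refine ⟨_, isRiemannSolution_of_isWaveProfile hregular hS hΩ_open Metric.isClosed_closedBall
      hCreg hVC hP (fun ξ => hmemV _ (fun j => abs_waveStrength_le) _) ?_ ?_⟩
    · refine tendsto_const_nhds.congr' ?_
      filter_upwards [eventually_le_atBot (c 0)] with ξ hξ
      exact (fanProfile_of_le hD (hmemO ε fun _ => le_rfl) hεη hξ).symm
    · refine tendsto_const_nhds.congr' ?_
      filter_upwards [eventually_ge_atTop (c (m + p))] with ξ hξ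
      rw [fanProfile_of_ge hD (hmemO ε fun _ => le_rfl) hεη hξ, hεur]
  · have hform : ∀ u, S.IsRiemannSolution U F lam Φ V ul ur u → ∃ ε : Fin (m + p) → ℝ,
        (∀ j, |ε j| < η) ∧ fanState T ε ul (m + p) = ur ∧
        u =ᵐ[volume.restrict {z : ℝ × ℝ | 0 < z.1}] fun z => fanProfile lam T s ε ul (z.2 / z.1) := by
      intro u hu
      obtain ⟨P, hP, hself, hl, hr⟩ :=
        hu.exists_isWaveProfile hregular hyp fun v hv => hCreg v (hVC hv)
      obtain ⟨ε, hε, hεur, hprof⟩ := hP.exists_eq_fanProfile hD Metric.isClosed_closedBall hCO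
        (fun ξ => hVC (hu.mem _ one_pos)) hl hr
      refine ⟨ε, hε, hεur, ?_⟩
      filter_upwards [ae_ratio_notMem P, ae_restrict_mem
        (measurableSet_lt measurable_const measurable_fst)] with z h1 h2
      rw [hself z h2 h1]
      exact hprof _ h1
    intro u u' hu hu'
    obtain ⟨ε, hε, hεur, hprof⟩ := hform u hu
    obtain ⟨ε', hε', hεur', hprof'⟩ := hform u' hu'
    have hulO : ul ∈ O := hCO (hVC hul.2)
    have heq : ε = ε' := hinj ε ε' ul (hOB ε ul hε hulO) (hOB ε' ul hε' hulO) (hεur.trans hεur'.symm)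
    subst heq
    exact hprof.trans hprof'.symm
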